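/- **Setting.** Let $d\ge 1$ be an integer, $p\in(d,\infty)$, $m>0$, $M>0$. On $L^2(\mathbb R^d)=L^2(\mathbb R^d;\mathbb C)$ let $H_0=-\Delta+m^2$ with domain $H^2(\mathbb R^d)$. Let $V:\mathbb R^d\to\mathbb R$ be continuous with $$\|V\|_{W^{1,p}}=\big(\|V\|_{L^p}^p+\|\nabla V\|_{L^p}^p\big)^{1/p}\le M,\qquad |V(x)|\le M(1+|x|^2)^{-1/2}\quad(x\in\mathbb R^d).$$ Let $\lambda\in\mathbb C\setminus((-\infty,-m]\cup[m,\infty))$, $\delta_\lambda=\operatorname{dist}(\lambda^2,[m^2,\infty))$, $W_\lambda=V^2-2\lambda V$, and $$K(\lambda)=(I-\lambda^2H_0^{-1})^{-1}H_0^{-1/2}\,W_\lambda\, H_0^{-1/2},\qquad a_\lambda(\xi)=\frac{(|\xi|^2+m^2)^{1/2}}{|\xi|^2+m^2-\lambda^2}.$$ **Matrices.** For $n\ge1$ put $N_n=(2n^2+1)^d$, $R_n=(2n^2+1)^d n$ and $s_n=\big\lceil (2n^2+1)^d\, n^{1-d}\, n\, R_n^{\,d-d/p}\big\rceil$. For $k\in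 n^{-1}\mathbb Z^d\cap[-n,n]^d$ let $e_k=n^{d/2}\,\widehat{\chi_{k+[0,1/n)^d}}$, with $\hat f(x)=(2\pi)^{-d/2}\int f(\xi)e^{-i\xi\cdot x}\,d\xi$, and for $N\in\mathbb N$ $$E^\lambda_{k,N}(x)=(2\pi)^{-d/2}n^{d/2}\sum_{j\in (k+[0,1/n)^d)\cap (Nn)^{-1}\mathbb Z^d} a_\lambda(j)\int_{j+[0,1/(Nn))^d}e^{-i\xi\cdot x}\,d\xi .$$ Let $K^{(N_n,R_n,s_n)}(\lambda)$ be the matrix with entries $$K_{kl}=s_n^{-d}\sum_{x\in s_n^{-1}\mathbb Z^d\cap[-R_n,R_n)^d}\overline{E^{\bar\lambda}_{k,N_n}(x)}\,E^0_{l,N_n}(x)\,W_\lambda(x),$$ identified with the operator $\sum_{k,l}K_{kl}\,\langle e_l,\cdot\rangle e_k$ on $L^2(\mathbb R^d)$. **Constants.** Let $\|\cdot\|_\infty$ be the norm of $L^\infty(\mathbb R^d)$, and for $\mu\in\{\lambda,0\}$ $$C_1(a_\mu)=\frac{\|\nabla a_\mu\|_\infty\|W_\lambda\|_\infty+\|a_\mu\|_\infty\|xW_\lambda\|_\infty}{m\pi},\qquad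 C_2(a_\mu)=\frac{\|\xi a_\mu\|_\infty\|W_\lambda\|_\infty}{m},$$ $$C_{\rm trunc}^\lambda=\Big(C_1(a_\lambda)^2+C_2(a_\lambda)^2+\big(1+|\lambda|^2/\delta_\lambda\big)^2\big(C_1(a_0)^2+C_2(a_0)^2\big)\Big)^{1/2},$$ $$D_1=\sqrt d\,M(M+2|\lambda|)\big(\|\nabla a_\lambda\|_\infty\|a_0\|_\infty+\|a_\lambda\|_\infty\|\nabla a_0\|_\infty+\sqrt d\,\|\nabla a_\lambda\|_\infty\|\nabla a_0\|_\infty\big),$$ $$D_2=2M(M+|\lambda|)\|a_\lambda\|_\infty\|a_0\|_\infty,\qquad D_3=\frac{2^{1+d-d/p}}{(1-d/p)(2\pi)^d}\,4\sqrt2\,d\,M(M+|\lambda|)\|a_\lambda\|_\infty\|a_0\|_\infty,$$ and $C_K^\lambda=C_{\rm trunc}^\lambda+D_1+D_2+D_3$. **Theorem.** 1. For every $n\ge1$ each entry of $K^{(N_n,R_n,s_n)}(\lambda)$ is computed by finitely many additions, subtractions and multiplications from point values of $V$ on the finite rational grid $s_n^{-1}\mathbb Z^d\cap[-R_n,R_n)^d$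 and from coefficients given by finite formulas in rational numbers, $\pi$, $i$, $m$, $\lambda$, the field operations, square roots and the exponential function. The computation depends on $d$, $p$, $n$ and the entry only, and is the same for all $m$, $\lambda$ and $V$. 2. $I-\lambda^2H_0^{-1}$ is invertible, $K(\lambda)$ is compact, $C_K^\lambda>0$, and for every $n\ge 1$ $$\big\|K(\lambda)-K^{(N_n,R_n,s_n)}(\lambda)\big\|_{L^2\to L^2}\le\frac{C_K^\lambda}{n}.$$ 3. $C_K^\lambda$ is bounded by the explicit function of $M,m,d,p,\lambda$ which results from the formulas above when one replaces $\|W_\lambda\|_\infty$ by $M(M+2|\lambda|)$, $\|xW_\lambda\|_\infty$ by $M(M/2+2|\lambda|)$ and, for $\mu\in\{\lambda,0\}$, $\|a_\mu\|_\infty$ by $\frac{|\mu|+m}{\delta_\mu}$, $\|\nabla a_\mu\|_\infty$ by $\frac{(m+|\mu|)^2+|\mu|^2}{\delta_\mu^2}$ and $\|\xi a_\mu\|_\infty$ by $1+\frac{|\mu|^2}{\delta_\mu}$ (where $\delta_0=m^2$). -/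

import Mathlib

open MeasureTheory
open scoped ENNReal FourierTransform

noncomputable section

namespace KleinGordon

/-- Euclidean space of dimension `d`. -/
abbrev E (d : ℕ) : Type := EuclideanSpace ℝ (Fin d)

/-- The complex Hilbert space of square-integrable functions on Euclidean space. -/
abbrev L2 (d : ℕ) : Type := Lp (α := E d) ℂ 2 (volume : Measure (E d))

/-! ### The hypothesis on the potential -/

/-- `G` is the weak gradient of `V`, tested against smooth compactly supported functions. -/
def HasWeakGradient {d : ℕ} (V : E d → ℝ) (G : E d → E d) : Prop :=
  LocallyIntegrable V ∧ LocallyIntegrable G ∧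
    ∀ φ : E d → ℝ, ContDiff ℝ (⊤ : ℕ∞) φ → HasCompactSupport φ → ∀ l : Fin d,
      ∫ x, V x * fderiv ℝ φ x (EuclideanSpace.single l 1) = -∫ x, G x l * φ x

/-- `V` belongs to the Sobolev space of order one and exponent `p`, with norm
`(‖V‖_p ^ p + ‖∇V‖_p ^ p) ^ (1 / p)` at most `M`. -/
def SobolevNormLE {d : ℕ} (p M : ℝ) (V : E d → ℝ) : Prop :=
  ∃ G : E d → E d, HasWeakGradient V G ∧
    MemLp V (ENNReal.ofReal p) ∧ MemLp G (ENNReal.ofReal p) ∧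
    ((eLpNorm V (ENNReal.ofReal p) volume).toReal ^ p +
      (eLpNorm G (ENNReal.ofReal p) volume).toReal ^ p) ^ (1 / p) ≤ M

/-- The assumptions on the real potential `V`. For `p > d` every Sobolev class has exactly one
continuous representative; it is the one whose point values are used. -/
structure Admissible {d : ℕ} (p M : ℝ) (V : E d → ℝ) : Prop where
  continuous : Continuous V
  sobolev : SobolevNormLE p M V
  decay : ∀ x, |V x| ≤ M / √(1 + ‖x‖ ^ 2)

/-! ### Multiplication operators, Fourier multipliers and the operator `K` -/

/-- Multiplication by an essentially bounded function (and `0` for any other function). -/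
def mulOp {d : ℕ} (g : E d → ℂ) : L2 d →L[ℂ] L2 d :=
  open Classical in
  if hg : MemLp g ∞ volume then
    (ContinuousLinearMap.mul ℂ ℂ).holderL volume ∞ 2 2 (hg.toLp g)
  else 0

/-- The Fourier multiplier with symbol `a`, where the frequency variable `ξ` is that of the unitary
transform `(2π) ^ (-d/2) ∫ f x * exp (-i ξ·x)`; Mathlib's `𝓕` has the kernel `exp (-2πi ξ·x)`,
whence the dilation by `2π`. -/
def fourierMultiplier {d : ℕ} (a : E d → ℂ) : L2 d →L[ℂ] L2 d :=
  ((Lp.fourierTransformₗᵢ (E d) ℂ).symm.toContinuousLinearEquiv : L2 d →L[ℂ] L2 d) ∘L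
    mulOp (fun ξ => a ((2 * Real.pi) • ξ)) ∘L
      ((Lp.fourierTransformₗᵢ (E d) ℂ).toContinuousLinearEquiv : L2 d →L[ℂ] L2 d)

/-- The inverse of `H₀ = -Δ + m²`. -/
def invH0 (d : ℕ) (m : ℝ) : L2 d →L[ℂ] L2 d :=
  fourierMultiplier fun ξ => (((‖ξ‖ ^ 2 + m ^ 2)⁻¹ : ℝ) : ℂ)

/-- The inverse square root of `H₀ = -Δ + m²`. -/
def invSqrtH0 (d : ℕ) (m : ℝ) : L2 d →L[ℂ] L2 d :=
  fourierMultiplier fun ξ => (((√(‖ξ‖ ^ 2 + m ^ 2))⁻¹ : ℝ) : ℂ)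

/-- The function `V² - 2 λ V`. -/
def W {d : ℕ} (lam : ℂ) (V : E d → ℝ) (x : E d) : ℂ :=
  (V x : ℂ) ^ 2 - 2 * lam * (V x : ℂ)

/-- `K(λ) = (1 - λ² H₀⁻¹)⁻¹ H₀^(-1/2) (V² - 2 λ V) H₀^(-1/2)`. -/
def K {d : ℕ} (m : ℝ) (lam : ℂ) (V : E d → ℝ) : L2 d →L[ℂ] L2 d :=
  Ring.inverse (1 - lam ^ 2 • invH0 d m) * invSqrtH0 d m * mulOp (W lam V) * invSqrtH0 d m

/-! ### The basis functions and the approximating matrices -/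

/-- The half-open cube with lower corner `c` and side length `h`. -/
def cube {d : ℕ} (c : E d) (h : ℝ) : Set (E d) :=
  {x | ∀ l, c l ≤ x l ∧ x l < c l + h}

/-- The point `κ / n` of the lattice of mesh `1 / n`. -/
def latticePoint {d : ℕ} (n : ℕ) (κ : Fin d → ℤ) : E d :=
  WithLp.toLp 2 fun l => (κ l : ℝ) / n

/-- The points `κ / n` with `κ` in this index set are those of the lattice of mesh `1 / n` in the
box `[-r, r]^d`, where `q = n r`. -/
abbrev GridIndex (d q : ℕ) : Type := Fin d → ↥(Finset.Icc (-(q : ℤ)) (q : ℤ))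

/-- The integer vector of a grid index. -/
def GridIndex.toInt {d q : ℕ} (k : GridIndex d q) : Fin d → ℤ := fun l => (k l : ℤ)

/-- The cube `κ / n + [0, 1 / n)^d`, written in Mathlib's frequency variable. -/
def scaledCube {d : ℕ} (n : ℕ) (κ : Fin d → ℤ) : Set (E d) :=
  {y | (2 * Real.pi) • y ∈ cube (latticePoint n κ) (1 / n)}

theorem measurableSet_scaledCube {d : ℕ} (n : ℕ) (κ : Fin d → ℤ) :
    MeasurableSet (scaledCube (d := d) n κ) := by
  have : scaledCube n κ = ⋂ l : Fin d,
      ({y : E d | latticePoint n κ l ≤ ((2 * Real.pi) • y) l} ∩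
        {y : E d | ((2 * Real.pi) • y) l < latticePoint n κ l + 1 / n}) := by
    ext y; simp [scaledCube, cube]
  rw [this]
  refine MeasurableSet.iInter fun l => MeasurableSet.inter ?_ ?_
  · exact (isClosed_le continuous_const (by fun_prop)).measurableSet
  · exact (isOpen_lt (by fun_prop) continuous_const).measurableSet

theorem volume_scaledCube_ne_top {d : ℕ} (n : ℕ) (κ : Fin d → ℤ) :
    volume (scaledCube (d := d) n κ) ≠ ∞ := by
  have hsub : scaledCube (d := d) n κ ⊆ (EuclideanSpace.equiv (Fin d) ℝ) ⁻¹'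
      (Set.Icc (fun l => latticePoint n κ l / (2 * Real.pi))
        (fun l => (latticePoint n κ l + 1 / n) / (2 * Real.pi))) := by
    intro y hy
    have h2 : (0 : ℝ) < 2 * Real.pi := by positivity
    refine ⟨fun l => ?_, fun l => ?_⟩
    · have := (hy l).1
      rw [div_le_iff₀ h2]
      simpa [mul_comm] using this
    · have := (hy l).2.le
      rw [le_div_iff₀ h2]
      simpa [mul_comm] using this
  refine ne_top_of_le_ne_top ?_ (measure_mono hsub)
  refine (IsCompact.measure_lt_top ?_).ne
  exact ((EuclideanSpace.equiv (Fin d) ℝ).toHomeomorph.isCompact_preimage).2 isCompact_Icc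

/-- The basis function `n ^ (d/2)` times the unitary Fourier transform of the indicator function of
`κ / n + [0, 1 / n)^d`. -/
def basisFun {d : ℕ} (n : ℕ) (κ : Fin d → ℤ) : L2 d :=
  Lp.fourierTransformₗᵢ (E d) ℂ
    (indicatorConstLp 2 (measurableSet_scaledCube n κ) (volume_scaledCube_ne_top n κ)
      (((2 * Real.pi * n) ^ ((d : ℝ) / 2) : ℝ) : ℂ))

/-- The symbol `a_λ(ξ) = (|ξ|² + m²)^(1/2) / (|ξ|² + m² - λ²)`. -/
def symbol {d : ℕ} (m : ℝ) (lam : ℂ) (ξ : E d) : ℂ :=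
  ((√(‖ξ‖ ^ 2 + m ^ 2) : ℝ) : ℂ) / (((‖ξ‖ ^ 2 + m ^ 2 : ℝ) : ℂ) - lam ^ 2)

/-- The lower corners `κ / n + t / (N n)`, `0 ≤ t < N`, of the subcubes of `κ / n + [0, 1 / n)^d`. -/
def subPoint {d : ℕ} (n N : ℕ) (κ : Fin d → ℤ) (t : Fin d → Fin N) : E d :=
  WithLp.toLp 2 fun l => (κ l : ℝ) / n + ((t l : ℕ) : ℝ) / (N * n)

/-- The approximation `E_{κ,N}` of the image of the basis function under the multiplier `a`. -/
def approxFun {d : ℕ} (n N : ℕ) (a : E d → ℂ) (κ : Fin d → ℤ) (x : E d) : ℂ :=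
  (((n / (2 * Real.pi)) ^ ((d : ℝ) / 2) : ℝ) : ℂ) *
    ∑ t : Fin d → Fin N, a (subPoint n N κ t) *
      ∫ ξ in cube (subPoint n N κ t) (1 / (N * n)),
        Complex.exp (-(Complex.I * ((inner ℝ ξ x : ℝ) : ℂ)))

/-- The Riemann sum over the lattice of mesh `1 / s` in `[-R, R)^d`. -/
def quad {d : ℕ} (R s : ℕ) (f : E d → ℂ) : ℂ :=
  (((s : ℝ) ^ d)⁻¹ : ℝ) *
    ∑ i ∈ Fintype.piFinset fun _ : Fin d => Finset.Ico (-((R * s : ℕ) : ℤ)) ((R * s : ℕ) : ℤ),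
      f (latticePoint s i)

/-- The matrix `K^(N,R,s)(λ)`, indexed by the lattice of mesh `1 / n` in `[-r, r]^d`. -/
def approxMatrix {d : ℕ} (n r N R s : ℕ) (m : ℝ) (lam : ℂ) (V : E d → ℝ) :
    Matrix (GridIndex d (n * r)) (GridIndex d (n * r)) ℂ :=
  Matrix.of fun k l => quad R s fun x =>
    (starRingEnd ℂ) (approxFun n N (symbol m ((starRingEnd ℂ) lam)) k.toInt x) *
      approxFun n N (symbol m 0) l.toInt x * W lam V x

/-- The operator with matrix `A` with respect to the basis functions, extended by `0` to the
orthogonal complement of their span. -/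
def matrixOp {d : ℕ} (n r : ℕ) (A : Matrix (GridIndex d (n * r)) (GridIndex d (n * r)) ℂ) :
    L2 d →L[ℂ] L2 d :=
  ∑ k, ∑ l, A k l • InnerProductSpace.rankOne ℂ (basisFun n k.toInt) (basisFun n l.toInt)

/-! ### The choice of the parameters, with `r = n` -/

/-- `N_n = (2 n r + 1)^d` with `r = n`. -/
def paramN (d n : ℕ) : ℕ := (2 * n * n + 1) ^ d

/-- `R_n = (2 n r + 1)^d n` with `r = n`. -/
def paramR (d n : ℕ) : ℕ := (2 * n * n + 1) ^ d * n

/-- `s_n = ⌈(2 n r + 1)^d n^(1-d) r R_n^(d-d/p)⌉` with `r = n`. -/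
def paramS (d : ℕ) (p : ℝ) (n : ℕ) : ℕ :=
  ⌈((2 * n * n + 1 : ℕ) : ℝ) ^ d * (n : ℝ) ^ (1 - (d : ℝ)) * n *
    (paramR d n : ℝ) ^ ((d : ℝ) - d / p)⌉₊

/-- The matrix `K^(N_n,R_n,s_n)(λ)`. -/
def Kmatrix {d : ℕ} (p : ℝ) (n : ℕ) (m : ℝ) (lam : ℂ) (V : E d → ℝ) :
    Matrix (GridIndex d (n * n)) (GridIndex d (n * n)) ℂ :=
  approxMatrix n n (paramN d n) (paramR d n) (paramS d p n) m lam V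

/-- The operator `K^(N_n,R_n,s_n)(λ) ⊕ 0`. -/
def Kapprox {d : ℕ} (p : ℝ) (n : ℕ) (m : ℝ) (lam : ℂ) (V : E d → ℝ) : L2 d →L[ℂ] L2 d :=
  matrixOp n n (Kmatrix p n m lam V)

/-! ### The constants -/

/-- The distance from `λ²` to `[m², ∞)`. -/
def specDist (m : ℝ) (lam : ℂ) : ℝ :=
  Metric.infDist (lam ^ 2) ((fun t : ℝ => (t : ℂ)) '' Set.Ici (m ^ 2))

/-- The (essential) supremum norm. -/
def supNorm {d : ℕ} {F : Type*} [NormedAddCommGroup F] (f : E d → F) : ℝ :=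
  (eLpNorm f ∞ volume).toReal

/-- Three numbers attached to a symbol `a`: the suprema of `|a|`, of `|∇a|` and of `|ξ a|`, or upper
bounds for them. -/
structure SymbolSize where
  sup : ℝ
  grad : ℝ
  xi : ℝ

/-- The suprema of `|a_λ|`, `|∇a_λ|` and `|ξ a_λ|`. As `a_λ` is radial, the norm of its derivative is
the Euclidean norm of its gradient. -/
def symbolSize (d : ℕ) (m : ℝ) (lam : ℂ) : SymbolSize where
  sup := supNorm (symbol (d := d) m lam)
  grad := supNorm (fderiv ℝ (symbol (d := d) m lam))
  xi := supNorm fun ξ : E d => (‖ξ‖ : ℂ) * symbol m lam ξ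

/-- Explicit upper bounds for the suprema of `|a_λ|`, `|∇a_λ|` and `|ξ a_λ|`. -/
def symbolBound (m : ℝ) (lam : ℂ) : SymbolSize where
  sup := (‖lam‖ + m) / specDist m lam
  grad := ((m + ‖lam‖) ^ 2 + ‖lam‖ ^ 2) / specDist m lam ^ 2
  xi := 1 + ‖lam‖ ^ 2 / specDist m lam

/-- The truncation constant `C₁(a)`; `w` stands for `‖W‖_∞` and `xw` for `‖x W‖_∞`. -/
def const1 (m : ℝ) (S : SymbolSize) (w xw : ℝ) : ℝ :=
  (m * Real.pi)⁻¹ * (S.grad * w + S.sup * xw)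

/-- The truncation constant `C₂(a)`. -/
def const2 (m : ℝ) (S : SymbolSize) (w : ℝ) : ℝ :=
  m⁻¹ * S.xi * w

/-- The truncation constant; `S` belongs to the symbol `a_λ` and `S₀` to `a_0`. -/
def constTrunc (m : ℝ) (lam : ℂ) (S S₀ : SymbolSize) (w xw : ℝ) : ℝ :=
  √(const1 m S w xw ^ 2 + const2 m S w ^ 2 +
    (1 + ‖lam‖ ^ 2 / specDist m lam) ^ 2 * (const1 m S₀ w xw ^ 2 + const2 m S₀ w ^ 2))

/-- The constant `D₁`. -/
def constD1 (d : ℕ) (M : ℝ) (lam : ℂ) (S S₀ : SymbolSize) : ℝ :=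
  √d * M * (M + 2 * ‖lam‖) * (S.grad * S₀.sup + S.sup * S₀.grad + √d * S.grad * S₀.grad)

/-- The constant `D₂`. -/
def constD2 (M : ℝ) (lam : ℂ) (S S₀ : SymbolSize) : ℝ :=
  2 * M * (M + ‖lam‖) * S.sup * S₀.sup

/-- The constant `D₃`. -/
def constD3 (d : ℕ) (p M : ℝ) (lam : ℂ) (S S₀ : SymbolSize) : ℝ :=
  2 ^ (1 + (d : ℝ) - d / p) / ((1 - d / p) * (2 * Real.pi) ^ d) *
    (4 * √2 * d) * M * (M + ‖lam‖) * S.sup * S₀.sup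

/-- The constant `C_mat = D₁ + D₂ + D₃`. -/
def constMat (d : ℕ) (p M : ℝ) (lam : ℂ) (S S₀ : SymbolSize) : ℝ :=
  constD1 d M lam S S₀ + constD2 M lam S S₀ + constD3 d p M lam S S₀

/-- The constant `C_K = C_trunc + C_mat`. -/
def constK {d : ℕ} (p M m : ℝ) (lam : ℂ) (V : E d → ℝ) : ℝ :=
  constTrunc m lam (symbolSize d m lam) (symbolSize d m 0)
      (supNorm (W lam V)) (supNorm fun x : E d => (‖x‖ : ℂ) * W lam V x) +
    constMat d p M lam (symbolSize d m lam) (symbolSize d m 0)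

/-- The upper bound for `C_K` in terms of `M`, `m`, `d`, `p` and `λ` alone. -/
def constKExplicit (d : ℕ) (p M m : ℝ) (lam : ℂ) : ℝ :=
  constTrunc m lam (symbolBound m lam) (symbolBound m 0)
      (M * (M + 2 * ‖lam‖)) (M * (M / 2 + 2 * ‖lam‖)) +
    constMat d p M lam (symbolBound m lam) (symbolBound m 0)

/-! ### Computations with finitely many arithmetic operations -/

/-- Formulas for coefficients that do not involve the potential: they are built from rational
numbers, `π`, the imaginary unit, the mass `m` and the spectral parameter `λ` by field operations,
real square roots and the exponential function. -/
inductive Coeff : Type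
  | rat (q : ℚ)
  | pi
  | imag
  | mass
  | spec
  | add (a b : Coeff)
  | mul (a b : Coeff)
  | inv (a : Coeff)
  | sqrt (a : Coeff)
  | exp (a : Coeff)

/-- The value of a coefficient formula. -/
def Coeff.eval (m : ℝ) (lam : ℂ) : Coeff → ℂ
  | .rat q => (q : ℂ)
  | .pi => (Real.pi : ℂ)
  | .imag => Complex.I
  | .mass => (m : ℂ)
  | .spec => lam
  | .add a b => a.eval m lam + b.eval m lam
  | .mul a b => a.eval m lam * b.eval m lam
  | .inv a => (a.eval m lam)⁻¹
  | .sqrt a => ((√(a.eval m lam).re : ℝ) : ℂ)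
  | .exp a => Complex.exp (a.eval m lam)

/-- Finite arithmetic computations: point values of the potential at rational points and coefficients
are combined by additions, subtractions and multiplications. -/
inductive Arith (d : ℕ) : Type
  | coeff (c : Coeff)
  | value (q : Fin d → ℚ)
  | add (a b : Arith d)
  | sub (a b : Arith d)
  | mul (a b : Arith d)

/-- The result of an arithmetic computation. -/
def Arith.eval {d : ℕ} (m : ℝ) (lam : ℂ) (V : E d → ℝ) : Arith d → ℂ
  | .coeff c => c.eval m lam
  | .value q => ((V (WithLp.toLp 2 fun l => (q l : ℝ)) : ℝ) : ℂ)
  | .add a b => a.eval m lam V + b.eval m lam V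
  | .sub a b => a.eval m lam V - b.eval m lam V
  | .mul a b => a.eval m lam V * b.eval m lam V

/-- The points at which an arithmetic computation reads the potential. -/
def Arith.queries {d : ℕ} : Arith d → Set (Fin d → ℚ)
  | .coeff _ => ∅
  | .value q => {q}
  | .add a b => a.queries ∪ b.queries
  | .sub a b => a.queries ∪ b.queries
  | .mul a b => a.queries ∪ b.queries

/-- The rational grid of mesh `1 / s` in `[-R, R)^d`. -/
def rationalGrid (d R s : ℕ) : Set (Fin d → ℚ) :=
  {q | ∀ l, (∃ j : ℤ, q l = j / s) ∧ -(R : ℚ) ≤ q l ∧ q l < R}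

/-! ### The two multipliers are the inverse and the inverse square root of `-Δ + m²` -/

theorem mulOp_coeFn {d : ℕ} {g : E d → ℂ} (hg : MemLp g ∞ volume) (f : L2 d) :
    mulOp g f =ᵐ[volume] fun x => g x * f x := by
  rw [mulOp, dif_pos hg]
  filter_upwards [(ContinuousLinearMap.mul ℂ ℂ).coeFn_holder (r := 2) (hg.toLp g) f,
    hg.coeFn_toLp] with x h1 h2
  rw [ContinuousLinearMap.holderL_apply_apply, h1, h2]
  rfl

theorem memLp_invH0 {d : ℕ} {m : ℝ} (hm : 0 < m) :
    MemLp (fun ξ : E d => (((‖(2 * Real.pi) • ξ‖ ^ 2 + m ^ 2)⁻¹ : ℝ) : ℂ)) ∞ volume := by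
  have h0 : ∀ ξ : E d, ‖(2 * Real.pi) • ξ‖ ^ 2 + m ^ 2 ≠ 0 := fun ξ => by positivity
  refine memLp_top_of_bound (C := (m ^ 2)⁻¹) (Continuous.aestronglyMeasurable
    (Complex.continuous_ofReal.comp (Continuous.inv₀ (by fun_prop) h0))) ?_
  refine Filter.Eventually.of_forall fun ξ => ?_
  rw [Complex.norm_real, Real.norm_eq_abs, abs_of_nonneg (by positivity)]
  exact inv_anti₀ (by positivity) (by simp)

theorem memLp_invSqrtH0 {d : ℕ} {m : ℝ} (hm : 0 < m) :
    MemLp (fun ξ : E d => (((√(‖(2 * Real.pi) • ξ‖ ^ 2 + m ^ 2))⁻¹ : ℝ) : ℂ)) ∞ volume := by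
  have h0 : ∀ ξ : E d, √(‖(2 * Real.pi) • ξ‖ ^ 2 + m ^ 2) ≠ 0 := fun ξ => by positivity
  refine memLp_top_of_bound (C := m⁻¹) (Continuous.aestronglyMeasurable
    (Complex.continuous_ofReal.comp (Continuous.inv₀ (by fun_prop) h0))) ?_
  refine Filter.Eventually.of_forall fun ξ => ?_
  rw [Complex.norm_real, Real.norm_eq_abs, abs_of_nonneg (by positivity)]
  exact inv_anti₀ hm (Real.le_sqrt_of_sq_le (by simp))

theorem fourier_fourierMultiplier {d : ℕ} {a : E d → ℂ}
    (ha : MemLp (fun ξ => a ((2 * Real.pi) • ξ)) ∞ volume) (f : L2 d) :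
    (𝓕 (fourierMultiplier a f) : L2 d) =ᵐ[volume]
      fun ξ => a ((2 * Real.pi) • ξ) * (𝓕 f : L2 d) ξ := by
  have : (𝓕 (fourierMultiplier a f) : L2 d) = mulOp (fun ξ => a ((2 * Real.pi) • ξ)) (𝓕 f : L2 d) :=
    (Lp.fourierTransformₗᵢ (E d) ℂ).apply_symm_apply _
  rw [this]
  exact mulOp_coeFn ha _

open Laplacian TemperedDistribution in
/-- In the sense of distributions, `m² u - Δ u = f` for `u = H₀⁻¹ f`. -/
theorem invH0_spec {d : ℕ} {m : ℝ} (hm : 0 < m) (f : L2 d) :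
    (m ^ 2 : ℂ) • Lp.toTemperedDistribution (invH0 d m f) -
      Δ (Lp.toTemperedDistribution (invH0 d m f)) = Lp.toTemperedDistribution f := by
  have h1 : (fun x : E d => Complex.ofReal (‖x‖ ^ 2)).HasTemperateGrowth := by fun_prop
  rw [laplacian_eq_fourierMultiplierCLM, fourierMultiplierCLM_apply,
    Lp.fourier_toTemperedDistribution_eq]
  have e := fourier_fourierMultiplier (d := d)
    (a := fun ξ => (((‖ξ‖ ^ 2 + m ^ 2)⁻¹ : ℝ) : ℂ)) (memLp_invH0 hm) f
  have h2 : (fun _ : E d => (m ^ 2 : ℂ)).HasTemperateGrowth := by fun_prop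
  have h3 : (((2 * Real.pi) ^ 2 : ℂ) • fun x : E d => Complex.ofReal (‖x‖ ^ 2)).HasTemperateGrowth :=
    by
      have : (fun x : E d => ((2 * Real.pi) ^ 2 : ℂ) * Complex.ofReal (‖x‖ ^ 2)).HasTemperateGrowth :=
        by fun_prop
      exact this
  have key : smulLeftCLM ℂ ((fun _ : E d => (m ^ 2 : ℂ)) +
      (((2 * Real.pi) ^ 2 : ℂ) • fun x : E d => Complex.ofReal (‖x‖ ^ 2)))
        (Lp.toTemperedDistribution (𝓕 (invH0 d m f) : L2 d)) =
      Lp.toTemperedDistribution (𝓕 f : L2 d) := by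
    ext φ
    rw [smulLeftCLM_apply_apply, Lp.toTemperedDistribution_apply, Lp.toTemperedDistribution_apply]
    refine integral_congr_ae ?_
    filter_upwards [e] with x hx
    have hx' : (𝓕 (invH0 d m f) : L2 d) x = _ := hx
    rw [hx', SchwartzMap.smulLeftCLM_apply_apply (h2.add h3)]
    have hpos : ((‖(2 * Real.pi) • x‖ ^ 2 + m ^ 2 : ℝ) : ℂ) ≠ 0 := by
      exact_mod_cast (by positivity : ‖(2 * Real.pi) • x‖ ^ 2 + m ^ 2 ≠ 0)
    have hh : ((fun _ : E d => (m ^ 2 : ℂ)) +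
      (((2 * Real.pi) ^ 2 : ℂ) • fun x : E d => Complex.ofReal (‖x‖ ^ 2))) x =
        ((‖(2 * Real.pi) • x‖ ^ 2 + m ^ 2 : ℝ) : ℂ) := by
      rw [norm_smul, Real.norm_of_nonneg (by positivity)]
      simp only [Pi.add_apply, Pi.smul_apply, smul_eq_mul]
      push_cast
      ring
    rw [hh, Complex.ofReal_inv, smul_eq_mul, smul_eq_mul, smul_eq_mul]
    field_simp
  rw [smulLeftCLM_add h2 h3, smulLeftCLM_smul h1] at key
  have key2 := congrArg (fun T : TemperedDistribution (E d) ℂ => 𝓕⁻ T) key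
  simp only [_root_.add_apply, _root_.smul_apply, smulLeftCLM_const,
    FourierTransform.fourierInv_add, FourierTransform.fourierInv_smul] at key2
  rw [← Lp.fourier_toTemperedDistribution_eq, ← Lp.fourier_toTemperedDistribution_eq,
    FourierTransform.fourierInv_fourier_eq, FourierTransform.fourierInv_fourier_eq] at key2
  rw [← key2, neg_smul, sub_neg_eq_add, ← Lp.fourier_toTemperedDistribution_eq]
  congr 1
  rw [← Complex.coe_smul]
  push_cast
  rfl

/-- The two multipliers are related as their names say. -/
theorem invSqrtH0_mul_self {d : ℕ} {m : ℝ} (hm : 0 < m) :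
    invSqrtH0 d m * invSqrtH0 d m = invH0 d m := by
  ext1 f
  apply (Lp.fourierTransformₗᵢ (E d) ℂ).injective
  apply Lp.ext
  have e1 := fourier_fourierMultiplier (d := d)
    (a := fun ξ => (((√(‖ξ‖ ^ 2 + m ^ 2))⁻¹ : ℝ) : ℂ)) (memLp_invSqrtH0 hm) (invSqrtH0 d m f)
  have e2 := fourier_fourierMultiplier (d := d)
    (a := fun ξ => (((√(‖ξ‖ ^ 2 + m ^ 2))⁻¹ : ℝ) : ℂ)) (memLp_invSqrtH0 hm) f
  have e3 := fourier_fourierMultiplier (d := d)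
    (a := fun ξ => (((‖ξ‖ ^ 2 + m ^ 2)⁻¹ : ℝ) : ℂ)) (memLp_invH0 hm) f
  refine Filter.EventuallyEq.trans e1 (Filter.EventuallyEq.trans ?_ e3.symm)
  filter_upwards [e2] with ξ h
  have h' : (𝓕 (invSqrtH0 d m f) : L2 d) ξ = _ := h
  rw [h', ← mul_assoc, ← Complex.ofReal_mul, ← mul_inv, Real.mul_self_sqrt (by positivity)]

theorem invSqrtH0_nonneg {d : ℕ} {m : ℝ} (hm : 0 < m) (f : L2 d) :
    ∃ t : ℝ, 0 ≤ t ∧ inner ℂ f (invSqrtH0 d m f) = (t : ℂ) := by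
  have e := fourier_fourierMultiplier (d := d)
    (a := fun ξ => (((√(‖ξ‖ ^ 2 + m ^ 2))⁻¹ : ℝ) : ℂ)) (memLp_invSqrtH0 hm) f
  refine ⟨∫ ξ, (√(‖(2 * Real.pi) • ξ‖ ^ 2 + m ^ 2))⁻¹ * ‖(𝓕 f : L2 d) ξ‖ ^ 2,
    integral_nonneg fun ξ => by positivity, ?_⟩
  rw [← Lp.inner_fourier_eq, L2.inner_def, ← integral_complex_ofReal]
  refine integral_congr_ae ?_
  filter_upwards [e] with ξ h
  have h' : (𝓕 (invSqrtH0 d m f) : L2 d) ξ = _ := h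
  rw [h', ← smul_eq_mul, inner_smul_right, inner_self_eq_norm_sq_to_K]
  push_cast
  rfl

end KleinGordon

end

open KleinGordon

noncomputable section

namespace KleinGordon

/-! ### The Fourier transform on square-integrable functions -/

/-! Write `A_μ` for the Fourier multiplier with symbol `a_μ`. The resolvent factor merges with the
left inverse root, so that `K = A_λ W A_0` (`K_eq`). Let `P` be the orthogonal projection onto the
span of the `e_k`. The error splits into `K - PKP` and `PKP - K_n`, where `K_n` is the operator of
the matrix.

Truncation. The ranges of `(1 - P)K` and `PK(1 - P)` are orthogonal, so the squares of their bounds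
add (`norm_sub_basisProj_mul_mul_basisProj_le`). On the frequency side `P` averages over cubes of
side `1/n` that cover a box, and annihilates the rest. In `A_λ W f` the frequency function is the
product of `a_λ` and the transform of `W f`. Its gradient is square integrable because `W` and `xW`
are bounded. The Poincaré inequality on cubes, with constant `1/π` in every dimension
(`poincare_unitCube`), gives the error `1/(πn)` times the gradient. Outside the box `|ξ| ≥ n`, so
`|a_λ| ≤ ‖ξ a_λ‖_∞ / n`. The part `K(1 - P)` follows by duality from the same estimate with `λ = 0`,
with the bounded resolvent in front (`norm_K_sub_basisProj_le`).

Matrix. There are `N_n` basis functions, so an error `ε` in each entry costs at most `N_n ε` in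
operator norm (`norm_matrixOp_le`); the entries must therefore be accurate to order `1/(N_n n)`.
Three errors occur: the symbols become constant on subcubes (`D₁`, a Lipschitz estimate), the
integral is cut off to `[-R, R)^d` (`D₂`, the decay of `V`), and the integral becomes a Riemann sum
(`D₃`). For the last one the gradient of `V` is only in `L^p`. The difference between a function and
its value at a cube corner is an integral of the gradient along segments. Hölder's inequality on the
cubes of side `t/s` costs `t^(-d/p)`, which is integrable at `0` exactly because `p > d`
(`integral_sum_integral_cubeMap_le`). Mollification carries this over to weak gradients, and
continuity of `V` controls the point values in the limit.

The explicit bounds for the symbols rest on `mul_specDist_le`. Compactness follows from the error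
estimate, since the `K_n` have finite rank. The entries are arithmetic expressions because the
integrals of exponentials over cubes are elementary (`integral_cube_exp`). -/

theorem fourier_toLp_ae {d : ℕ} {f : E d → ℂ} (hf : MemLp f 2) (hf1 : Integrable f) :
    (𝓕 (hf.toLp f) : L2 d) =ᵐ[volume] 𝓕 f := by
  have hc : Continuous (𝓕 f) :=
    VectorFourier.fourierIntegral_continuous Real.continuous_fourierChar
      (by exact continuous_inner) hf1
  -- Both transforms satisfy the multiplication formula `∫ g 𝓕f = ∫ 𝓕g f` against test functions
  -- `g`: the one on `L²` by duality in tempered distributions, the integral by Fubini.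
  refine ae_eq_of_integral_contDiff_smul_eq
    ((Lp.memLp _).locallyIntegrable (by norm_num)) hc.locallyIntegrable fun g hg hgs => ?_
  have hgs' : HasCompactSupport (fun x => (g x : ℂ)) := hgs.comp_left (g := Complex.ofReal) rfl
  have hg' : ContDiff ℝ (⊤ : ℕ∞) (fun x => (g x : ℂ)) := Complex.ofRealCLM.contDiff.comp hg
  set G : SchwartzMap (E d) ℂ := hgs'.toSchwartzMap hg' with hG
  have hGx : ∀ x, G x = (g x : ℂ) := fun x => rfl
  have h1 := congrArg (fun T : TemperedDistribution (E d) ℂ => T G)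
    (Lp.fourier_toTemperedDistribution_eq (hf.toLp f))
  simp only [TemperedDistribution.fourier_apply, Lp.toTemperedDistribution_apply] at h1
  have h2 : ∫ x, g x • (𝓕 (hf.toLp f) : L2 d) x = ∫ x, G x • (𝓕 (hf.toLp f) : L2 d) x := by
    refine integral_congr_ae (Filter.Eventually.of_forall fun x => ?_)
    simp [hGx]
  have h3 : ∫ x, g x • 𝓕 f x = ∫ x, G x • 𝓕 f x := by
    refine integral_congr_ae (Filter.Eventually.of_forall fun x => ?_)
    simp [hGx]
  rw [h2, h3, ← h1]
  have h4 := VectorFourier.integral_fourierIntegral_smul_eq_flip (L := innerₗ (E d))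
    (μ := volume) (ν := volume) (f := (G : E d → ℂ)) (g := f)
    Real.continuous_fourierChar (by exact continuous_inner) G.integrable hf1
  have h5 : ∫ x, (𝓕 G) x • (hf.toLp f) x = ∫ x, (𝓕 G) x • f x := by
    refine integral_congr_ae ?_
    filter_upwards [hf.coeFn_toLp] with x hx
    rw [hx]
  rw [h5, flip_innerₗ] at *
  exact h4

/-- The reflection `f(x) ↦ f(-x)` on `L²`. -/
def reflection (d : ℕ) : L2 d →ₗᵢ[ℂ] L2 d :=
  Lp.compMeasurePreservingₗᵢ ℂ (fun x : E d => -x) (Measure.measurePreserving_neg volume)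

theorem reflection_coeFn {d : ℕ} (f : L2 d) : reflection d f =ᵐ[volume] fun x => f (-x) :=
  Lp.coeFn_compMeasurePreserving f (Measure.measurePreserving_neg volume)

theorem ae_neg {d : ℕ} {p : E d → Prop} (h : ∀ᵐ x, p x) : ∀ᵐ x, p (-x) :=
  (Measure.measurePreserving_neg (volume : Measure (E d))).quasiMeasurePreserving.ae h

theorem reflection_reflection {d : ℕ} (f : L2 d) : reflection d (reflection d f) = f := by
  apply Lp.ext
  filter_upwards [reflection_coeFn (reflection d f), ae_neg (reflection_coeFn f)] with x h1 h2
  rw [h1, h2, neg_neg]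

/-- Pointwise true for Schwartz functions, which are dense, and both sides are continuous. -/
theorem fourierInv_eq_reflection_fourier {d : ℕ} (f : L2 d) :
    (𝓕⁻ f : L2 d) = reflection d (𝓕 f) := by
  refine DenseRange.induction_on
    (p := fun f : L2 d => (𝓕⁻ f : L2 d) = reflection d (𝓕 f))
    (SchwartzMap.denseRange_toLpCLM (p := 2) (F := ℂ) (E := E d) (μ := volume)
      ENNReal.ofNat_ne_top) f ?_ ?_
  · exact isClosed_eq (Lp.fourierTransformₗᵢ (E d) ℂ).symm.continuous
      ((reflection d).continuous.comp (Lp.fourierTransformₗᵢ (E d) ℂ).continuous)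
  · intro g
    simp only [SchwartzMap.toLpCLM_apply, SchwartzMap.toLp_fourier_eq,
      SchwartzMap.toLp_fourierInv_eq]
    apply Lp.ext
    filter_upwards [reflection_coeFn ((𝓕 g).toLp 2), (𝓕⁻ g).coeFn_toLp 2 volume,
      ae_neg ((𝓕 g).coeFn_toLp 2 volume)] with x h1 h2 h3
    rw [h1, h2, h3, SchwartzMap.fourierInv_coe, SchwartzMap.fourier_coe]
    exact Real.fourierInv_eq_fourier_neg _ _

theorem fourier_fourier {d : ℕ} (f : L2 d) : (𝓕 (𝓕 f : L2 d) : L2 d) = reflection d f := by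
  have h := fourierInv_eq_reflection_fourier (𝓕 f : L2 d)
  rw [FourierTransform.fourierInv_fourier_eq] at h
  rw [h, reflection_reflection, ← h]

theorem fourierInv_eq_fourier_reflection {d : ℕ} (f : L2 d) :
    (𝓕⁻ f : L2 d) = 𝓕 (reflection d f) := by
  rw [← fourier_fourier f, fourier_fourier, ← fourierInv_eq_reflection_fourier]

/-! ### Multiplication operators -/

theorem mulOp_toLp {d : ℕ} {g f : E d → ℂ} (hg : MemLp g ∞ volume) (hf : MemLp f 2)
    (hgf : MemLp (fun x => g x * f x) 2) : mulOp g (hf.toLp f) = hgf.toLp _ := by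
  apply Lp.ext
  filter_upwards [mulOp_coeFn hg (hf.toLp f), hf.coeFn_toLp, hgf.coeFn_toLp] with x h1 h2 h3
  rw [h1, h2, h3]

theorem mulOp_mul {d : ℕ} {g h : E d → ℂ} (hg : MemLp g ∞ volume) (hh : MemLp h ∞ volume)
    (hgh : MemLp (fun x => g x * h x) ∞ volume) :
    mulOp g * mulOp h = mulOp (fun x => g x * h x) := by
  ext1 f
  apply Lp.ext
  filter_upwards [mulOp_coeFn hg (mulOp h f), mulOp_coeFn hh f, mulOp_coeFn hgh f] with x h1 h2 h3
  rw [mul_apply_eq_comp, h1, h2, h3, mul_assoc]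

theorem mulOp_one {d : ℕ} : mulOp (fun _ : E d => (1 : ℂ)) = 1 := by
  ext1 f
  apply Lp.ext
  have h : MemLp (fun _ : E d => (1 : ℂ)) ∞ volume := memLp_top_const 1
  filter_upwards [mulOp_coeFn h f] with x h1
  rw [h1, one_mul]; rfl

theorem norm_le_of_ae_le_mul {d : ℕ} {f g : L2 d} {C : ℝ}
    (h : ∀ᵐ x, ‖f x‖ ≤ C * ‖g x‖) : ‖f‖ ≤ C * ‖g‖ :=
  Lp.norm_le_mul_norm_of_ae_le_mul h

theorem norm_mulOp_apply_le {d : ℕ} {g : E d → ℂ} (hg : MemLp g ∞ volume) {C : ℝ}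
    (h : ∀ᵐ x, ‖g x‖ ≤ C) (f : L2 d) : ‖mulOp g f‖ ≤ C * ‖f‖ := by
  refine norm_le_of_ae_le_mul ?_
  filter_upwards [h, mulOp_coeFn hg f] with x h1 h2
  rw [h2, norm_mul]
  gcongr

theorem inner_mulOp_left {d : ℕ} {g : E d → ℂ} (hg : MemLp g ∞ volume) (f h : L2 d) :
    inner ℂ (mulOp g f) h = inner ℂ f (mulOp (fun x => (starRingEnd ℂ) (g x)) h) := by
  rw [L2.inner_def, L2.inner_def]
  refine integral_congr_ae ?_
  filter_upwards [mulOp_coeFn hg f, mulOp_coeFn (g := fun x => (starRingEnd ℂ) (g x)) hg.star h]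
    with x h1 h2
  rw [h1, h2]
  simp [RCLike.inner_apply]
  ring

/-! ### Fourier multipliers -/

theorem fourierMultiplier_apply {d : ℕ} (a : E d → ℂ) (f : L2 d) :
    fourierMultiplier a f = 𝓕⁻ (mulOp (fun ξ => a ((2 * Real.pi) • ξ)) (𝓕 f : L2 d)) := rfl

theorem norm_fourierInv {d : ℕ} (f : L2 d) : ‖(𝓕⁻ f : L2 d)‖ = ‖f‖ :=
  (Lp.fourierTransformₗᵢ (E d) ℂ).symm.norm_map f

theorem mulOp_reflection {d : ℕ} {g : E d → ℂ} (hg : MemLp g ∞ volume)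
    (heven : ∀ x, g (-x) = g x) (f : L2 d) :
    mulOp g (reflection d f) = reflection d (mulOp g f) := by
  apply Lp.ext
  filter_upwards [mulOp_coeFn hg (reflection d f), reflection_coeFn f,
    reflection_coeFn (mulOp g f), ae_neg (mulOp_coeFn hg f)] with x h1 h2 h3 h4
  rw [h1, h2, h3, h4, heven]

/-- Reflection exchanges `𝓕` and `𝓕⁻`, and an even symbol commutes with it. In this form the
multiplier acts directly on the basis functions, which are forward transforms of indicators. -/
theorem fourierMultiplier_apply_of_even {d : ℕ} {a : E d → ℂ}
    (ha : MemLp (fun ξ => a ((2 * Real.pi) • ξ)) ∞ volume) (heven : ∀ x, a (-x) = a x) (f : L2 d) :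
    fourierMultiplier a f = 𝓕 (mulOp (fun ξ => a ((2 * Real.pi) • ξ)) (𝓕⁻ f : L2 d)) := by
  rw [fourierMultiplier_apply, fourierInv_eq_fourier_reflection, fourierInv_eq_reflection_fourier,
    mulOp_reflection ha]
  intro x
  rw [smul_neg, heven]

theorem fourierMultiplier_mul {d : ℕ} {a b : E d → ℂ}
    (ha : MemLp (fun ξ => a ((2 * Real.pi) • ξ)) ∞ volume)
    (hb : MemLp (fun ξ => b ((2 * Real.pi) • ξ)) ∞ volume)
    (hab : MemLp (fun ξ => a ((2 * Real.pi) • ξ) * b ((2 * Real.pi) • ξ)) ∞ volume) :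
    fourierMultiplier a * fourierMultiplier b = fourierMultiplier (fun ξ => a ξ * b ξ) := by
  ext1 f
  rw [mul_apply_eq_comp, fourierMultiplier_apply, fourierMultiplier_apply,
    fourierMultiplier_apply, FourierTransform.fourier_fourierInv_eq,
    ← mulOp_mul ha hb hab, mul_apply_eq_comp]

theorem fourierMultiplier_one {d : ℕ} : fourierMultiplier (fun _ : E d => (1 : ℂ)) = 1 := by
  ext1 f
  rw [fourierMultiplier_apply, mulOp_one, one_apply_eq_self,
    FourierTransform.fourierInv_fourier_eq, one_apply_eq_self]

theorem norm_fourierMultiplier_le {d : ℕ} {a : E d → ℂ}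
    (ha : MemLp (fun ξ => a ((2 * Real.pi) • ξ)) ∞ volume) {C : ℝ} (h : ∀ ξ, ‖a ξ‖ ≤ C)
    (hC : 0 ≤ C) : ‖fourierMultiplier a‖ ≤ C := by
  refine ContinuousLinearMap.opNorm_le_bound _ hC fun f => ?_
  rw [fourierMultiplier_apply, norm_fourierInv, ← Lp.norm_fourier_eq f]
  exact norm_mulOp_apply_le ha (Filter.Eventually.of_forall fun x => h _) _

theorem inner_fourierMultiplier_left {d : ℕ} {a : E d → ℂ}
    (ha : MemLp (fun ξ => a ((2 * Real.pi) • ξ)) ∞ volume) (f g : L2 d) :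
    inner ℂ (fourierMultiplier a f) g =
      inner ℂ f (fourierMultiplier (fun ξ => (starRingEnd ℂ) (a ξ)) g) := by
  rw [← Lp.inner_fourier_eq, ← Lp.inner_fourier_eq f, fourierMultiplier_apply,
    fourierMultiplier_apply, FourierTransform.fourier_fourierInv_eq,
    FourierTransform.fourier_fourierInv_eq, inner_mulOp_left ha]

/-! ### The distance to the spectrum -/

theorem specDist_nonneg (m : ℝ) (lam : ℂ) : 0 ≤ specDist m lam := Metric.infDist_nonneg

theorem specDist_le {m t : ℝ} (lam : ℂ) (ht : m ^ 2 ≤ t) : specDist m lam ≤ ‖(t : ℂ) - lam ^ 2‖ := by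
  rw [← dist_eq_norm, dist_comm]
  exact Metric.infDist_le_dist_of_mem ⟨t, ht, rfl⟩

/-- The half-line is closed, and `λ² = t ≥ m²` would force `λ = ±√t`, which is excluded. -/
theorem specDist_pos {m : ℝ} {lam : ℂ} (h : ∀ t : ℝ, m ≤ |t| → lam ≠ (t : ℂ)) :
    0 < specDist m lam := by
  have hc : IsClosed ((fun t : ℝ => (t : ℂ)) '' Set.Ici (m ^ 2)) :=
    Complex.isometry_ofReal.isClosedEmbedding.isClosedMap _ isClosed_Ici
  refine (hc.notMem_iff_infDist_pos ⟨_, m ^ 2, Set.self_mem_Ici, rfl⟩).1 ?_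
  rintro ⟨t, ht, hlam⟩
  have ht : m ^ 2 ≤ t := ht
  have ht0 : 0 ≤ t := le_trans (sq_nonneg m) ht
  have h1 : m ≤ √t := Real.le_sqrt_of_sq_le ht
  have h2 : (lam - (√t : ℝ)) * (lam + (√t : ℝ)) = 0 := by
    have : ((√t : ℝ) : ℂ) ^ 2 = (t : ℂ) := by
      rw [← Complex.ofReal_pow, Real.sq_sqrt ht0]
    linear_combination -this - hlam
  rcases mul_eq_zero.1 h2 with h3 | h3
  · exact h (√t) (by rwa [abs_of_nonneg (Real.sqrt_nonneg t)]) (sub_eq_zero.1 h3)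
  · refine h (-√t) (by rwa [abs_neg, abs_of_nonneg (Real.sqrt_nonneg t)]) ?_
    push_cast
    exact eq_neg_of_add_eq_zero_left h3

theorem specDist_zero_pos {m : ℝ} (hm : 0 < m) : 0 < specDist m 0 := by
  refine specDist_pos fun t ht h => ?_
  have : t = 0 := by exact_mod_cast h.symm
  rw [this, abs_zero] at ht
  linarith

theorem norm_ofReal_sub_sq_ge (t : ℝ) (lam : ℂ) : t - ‖lam‖ ^ 2 ≤ ‖(t : ℂ) - lam ^ 2‖ := by
  have h := norm_sub_norm_le (t : ℂ) (lam ^ 2)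
  rw [norm_pow, Complex.norm_real, Real.norm_eq_abs] at h
  linarith [le_abs_self t]

/-- With `s = √(|ξ|² + m²)` this is the bound for `|a_λ(ξ)|`. For `s ≤ |λ| + m` the definition of
the distance suffices. For larger `s` there are two cases. Either the point `|λ|⁴/s²` still lies in
`[m², ∞)`, and it is nearer to `λ²` than `s²` by the factor `|λ|²/s²`; or `|λ|² ≤ m s`, and the
triangle inequality is strong enough. -/
theorem mul_specDist_le {m s : ℝ} (hm : 0 < m) (lam : ℂ) (hs : m ≤ s) :
    s * specDist m lam ≤ (‖lam‖ + m) * ‖((s ^ 2 : ℝ) : ℂ) - lam ^ 2‖ := by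
  have hr := norm_nonneg lam
  have hδ := specDist_nonneg m lam
  have hs0 : 0 < s := lt_of_lt_of_le hm hs
  have hN := norm_nonneg (((s ^ 2 : ℝ) : ℂ) - lam ^ 2)
  rcases le_or_gt s (‖lam‖ + m) with h1 | h1
  · have := specDist_le (m := m) (t := s ^ 2) lam (by gcongr)
    exact mul_le_mul h1 this hδ (by positivity)
  rcases le_or_gt (m ^ 2) (‖lam‖ ^ 4 / s ^ 2) with h2 | h2
  -- Inversion of `s²` in the circle of radius `|λ|²` about the origin, on which `λ²` lies.
  · have key : ‖((‖lam‖ ^ 4 / s ^ 2 : ℝ) : ℂ) - lam ^ 2‖ =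
        ‖lam‖ ^ 2 / s ^ 2 * ‖((s ^ 2 : ℝ) : ℂ) - lam ^ 2‖ := by
      have e1 : ((‖lam‖ : ℝ) : ℂ) ^ 2 = lam * (starRingEnd ℂ) lam := (Complex.mul_conj' lam).symm
      have hsc : (s : ℂ) ≠ 0 := by exact_mod_cast hs0.ne'
      have e2 : ((‖lam‖ ^ 4 / s ^ 2 : ℝ) : ℂ) - lam ^ 2 =
          -(lam ^ 2 / ((s ^ 2 : ℝ) : ℂ)) * (starRingEnd ℂ) (((s ^ 2 : ℝ) : ℂ) - lam ^ 2) := by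
        simp only [map_sub, Complex.conj_ofReal, map_pow]
        push_cast
        have : ((‖lam‖ : ℝ) : ℂ) ^ 4 = (lam * (starRingEnd ℂ) lam) ^ 2 := by rw [← e1]; ring
        rw [this]
        field_simp
        ring
      rw [e2, norm_mul, RCLike.norm_conj, norm_neg, norm_div, norm_pow, Complex.norm_real,
        Real.norm_of_nonneg (by positivity : (0 : ℝ) ≤ s ^ 2)]
    have h3 := specDist_le (m := m) lam h2
    rw [key] at h3
    have h4 : s * (‖lam‖ ^ 2 / s ^ 2) ≤ ‖lam‖ := by
      rw [show s * (‖lam‖ ^ 2 / s ^ 2) = ‖lam‖ ^ 2 / s by field_simp, div_le_iff₀ hs0]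
      nlinarith
    calc s * specDist m lam ≤ s * (‖lam‖ ^ 2 / s ^ 2 * ‖((s ^ 2 : ℝ) : ℂ) - lam ^ 2‖) := by gcongr
      _ = s * (‖lam‖ ^ 2 / s ^ 2) * ‖((s ^ 2 : ℝ) : ℂ) - lam ^ 2‖ := by ring
      _ ≤ (‖lam‖ + m) * ‖((s ^ 2 : ℝ) : ℂ) - lam ^ 2‖ := by gcongr; linarith
  · have h3 : ‖lam‖ ^ 2 ≤ m * s := by
      rw [div_lt_iff₀ (by positivity)] at h2
      refine le_of_sq_le_sq ?_ (by positivity)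
      nlinarith
    have h4 : specDist m lam ≤ m ^ 2 + ‖lam‖ ^ 2 := by
      refine (specDist_le (m := m) lam le_rfl).trans ((norm_sub_le _ _).trans ?_)
      rw [norm_pow, Complex.norm_real, Real.norm_of_nonneg (by positivity)]
    have h5 := norm_ofReal_sub_sq_ge (s ^ 2) lam
    have h6 : s * (m ^ 2 + ‖lam‖ ^ 2) ≤ (‖lam‖ + m) * (s ^ 2 - ‖lam‖ ^ 2) := by
      have a1 : ‖lam‖ * s * (s - (‖lam‖ + m)) ≥ 0 := by
        have := sub_pos.2 h1; positivity
      have a2 : m * s * (s - (‖lam‖ + m)) ≥ 0 := by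
        have := sub_pos.2 h1; positivity
      nlinarith [mul_nonneg hr (sub_nonneg.2 h3), mul_nonneg hm.le (sub_nonneg.2 h3)]
    calc s * specDist m lam ≤ s * (m ^ 2 + ‖lam‖ ^ 2) := by gcongr
      _ ≤ _ := h6
      _ ≤ _ := by gcongr

/-! ### The symbol -/

section symbol

variable {d : ℕ} {m : ℝ} {lam : ℂ}

theorem symbol_den_ge (m : ℝ) (lam : ℂ) (ξ : E d) :
    specDist m lam ≤ ‖((‖ξ‖ ^ 2 + m ^ 2 : ℝ) : ℂ) - lam ^ 2‖ :=
  specDist_le lam (by nlinarith [norm_nonneg ξ])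

theorem symbol_den_ne_zero (h : 0 < specDist m lam) (ξ : E d) :
    ((‖ξ‖ ^ 2 + m ^ 2 : ℝ) : ℂ) - lam ^ 2 ≠ 0 :=
  norm_pos_iff.1 (h.trans_le (symbol_den_ge m lam ξ))

theorem continuous_symbol (h : 0 < specDist m lam) : Continuous (symbol (d := d) m lam) := by
  unfold symbol
  refine Continuous.div (by fun_prop) (by fun_prop) fun ξ => symbol_den_ne_zero h ξ

theorem symbol_neg (ξ : E d) : symbol m lam (-ξ) = symbol m lam ξ := by
  simp [symbol]

theorem symbol_conj (ξ : E d) :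
    symbol m ((starRingEnd ℂ) lam) ξ = (starRingEnd ℂ) (symbol m lam ξ) := by
  simp [symbol]

theorem symbol_ne_zero (hm : 0 < m) (h : 0 < specDist m lam) (ξ : E d) : symbol m lam ξ ≠ 0 := by
  have : √(‖ξ‖ ^ 2 + m ^ 2) ≠ 0 := by positivity
  exact div_ne_zero (by exact_mod_cast this) (symbol_den_ne_zero h ξ)

theorem norm_symbol_le (hm : 0 < m) (h : 0 < specDist m lam) (ξ : E d) :
    ‖symbol m lam ξ‖ ≤ (symbolBound m lam).sup := by
  have hs : m ≤ √(‖ξ‖ ^ 2 + m ^ 2) := Real.le_sqrt_of_sq_le (by nlinarith [norm_nonneg ξ])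
  have h1 := mul_specDist_le hm lam hs
  rw [Real.sq_sqrt (by positivity)] at h1
  rw [symbol, norm_div, Complex.norm_real, Real.norm_of_nonneg (by positivity), symbolBound,
    div_le_div_iff₀ (norm_pos_iff.2 (symbol_den_ne_zero h ξ)) h]
  exact h1

/-- With `T = |ξ|² + m²` the numerator is at most `T ≤ |T - λ²| + |λ|²`, and `|T - λ²|` is at least
the distance `δ`. -/
theorem norm_xi_symbol_le (hm : 0 < m) (h : 0 < specDist m lam) (ξ : E d) :
    ‖(‖ξ‖ : ℂ) * symbol m lam ξ‖ ≤ (symbolBound m lam).xi := by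
  set T := ‖ξ‖ ^ 2 + m ^ 2 with hT
  have hT0 : 0 < T := by positivity
  have hD := symbol_den_ge m lam ξ
  have hDp : 0 < ‖((T : ℝ) : ℂ) - lam ^ 2‖ := h.trans_le hD
  have h1 : ‖ξ‖ ≤ √T := Real.le_sqrt_of_sq_le (by nlinarith)
  have h2 : T ≤ ‖((T : ℝ) : ℂ) - lam ^ 2‖ + ‖lam‖ ^ 2 := by
    linarith [norm_ofReal_sub_sq_ge T lam]
  rw [symbol, ← hT, norm_mul, norm_div, Complex.norm_real, Complex.norm_real, norm_norm,
    Real.norm_of_nonneg (by positivity), symbolBound, ← mul_div_assoc]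
  calc ‖ξ‖ * √T / ‖(T : ℂ) - lam ^ 2‖ ≤ √T * √T / ‖(T : ℂ) - lam ^ 2‖ := by gcongr
    _ = T / ‖(T : ℂ) - lam ^ 2‖ := by rw [Real.mul_self_sqrt hT0.le]
    _ ≤ (‖((T : ℝ) : ℂ) - lam ^ 2‖ + ‖lam‖ ^ 2) / ‖(T : ℂ) - lam ^ 2‖ := by gcongr
    _ = 1 + ‖lam‖ ^ 2 / ‖(T : ℂ) - lam ^ 2‖ := by rw [add_div, div_self hDp.ne']
    _ ≤ 1 + ‖lam‖ ^ 2 / specDist m lam := by gcongr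

/-- The factor `ψ` in `∇ a_λ(ξ) = ψ(ξ) ξ`. -/
def symbolDer (m : ℝ) (lam : ℂ) (ξ : E d) : ℂ :=
  -(((‖ξ‖ ^ 2 + m ^ 2 : ℝ) : ℂ) + lam ^ 2) /
    (((√(‖ξ‖ ^ 2 + m ^ 2) : ℝ) : ℂ) * (((‖ξ‖ ^ 2 + m ^ 2 : ℝ) : ℂ) - lam ^ 2) ^ 2)

theorem hasFDerivAt_symbol (hm : 0 < m) (h : 0 < specDist m lam) (ξ : E d) :
    HasFDerivAt (symbol m lam) ((innerSL ℝ ξ).smulRight (symbolDer m lam ξ)) ξ := by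
  set T := ‖ξ‖ ^ 2 + m ^ 2 with hT
  have hT0 : 0 < T := by positivity
  have hD : (T : ℂ) - lam ^ 2 ≠ 0 := symbol_den_ne_zero h ξ
  have h1 : HasDerivAt (fun t : ℝ => ((√t : ℝ) : ℂ)) ((1 / (2 * √T) : ℝ) : ℂ) T :=
    (Real.hasDerivAt_sqrt hT0.ne').ofReal_comp
  have h2 : HasDerivAt (fun t : ℝ => (t : ℂ) - lam ^ 2) 1 T :=
    (Complex.ofRealCLM.hasDerivAt (x := T)).sub_const _
  have h3 := h1.div h2 hD
  have h4 : HasFDerivAt (fun ξ : E d => ‖ξ‖ ^ 2 + m ^ 2) (2 • innerSL ℝ ξ) ξ :=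
    (hasStrictFDerivAt_norm_sq ξ).hasFDerivAt.add_const _
  have h5 := HasFDerivAt.comp (f := fun ξ : E d => ‖ξ‖ ^ 2 + m ^ 2) ξ h3.hasFDerivAt h4
  refine h5.congr_fderiv ?_
  ext v
  have hs : ((√T : ℝ) : ℂ) ≠ 0 := by
    have : √T ≠ 0 := by positivity
    exact_mod_cast this
  have hss : ((√T : ℝ) : ℂ) ^ 2 = T := by rw [← Complex.ofReal_pow, Real.sq_sqrt hT0.le]
  simp only [symbolDer, ← hT, ContinuousLinearMap.smulRight_apply]
  simp only [nsmul_eq_mul, Nat.cast_ofNat, smul_apply,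
    ContinuousLinearMap.toSpanSingleton_apply, ContinuousLinearMap.comp_apply, Complex.real_smul,
    innerSL_apply_apply]
  simp
  field_simp
  rw [hss]
  ring

theorem continuous_symbolDer (hm : 0 < m) (h : 0 < specDist m lam) :
    Continuous (symbolDer (d := d) m lam) := by
  unfold symbolDer
  refine Continuous.div (by fun_prop) (by fun_prop) fun ξ => ?_
  refine mul_ne_zero ?_ (pow_ne_zero _ (symbol_den_ne_zero h ξ))
  have : √(‖ξ‖ ^ 2 + m ^ 2) ≠ 0 := by positivity
  exact_mod_cast this

theorem fderiv_symbol (hm : 0 < m) (h : 0 < specDist m lam) :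
    fderiv ℝ (symbol (d := d) m lam) = fun ξ => (innerSL ℝ ξ).smulRight (symbolDer m lam ξ) :=
  funext fun ξ => (hasFDerivAt_symbol hm h ξ).fderiv

theorem norm_fderiv_symbol (hm : 0 < m) (h : 0 < specDist m lam) (ξ : E d) :
    ‖fderiv ℝ (symbol (d := d) m lam) ξ‖ = ‖ξ‖ * ‖symbolDer m lam ξ‖ := by
  rw [fderiv_symbol hm h, ContinuousLinearMap.norm_smulRight_apply, innerSL_apply_norm]

theorem continuous_fderiv_symbol (hm : 0 < m) (h : 0 < specDist m lam) :
    Continuous (fderiv ℝ (symbol (d := d) m lam)) := by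
  rw [fderiv_symbol hm h]
  have := continuous_symbolDer (d := d) hm h
  exact ((ContinuousLinearMap.smulRightL ℝ (E d) ℂ).continuous.comp
    (innerSL ℝ).continuous).clm_apply this

/-- The gradient is at most `(T + |λ|²) / |T - λ²|²` with `T = |ξ|² + m²`. Here `T / |T - λ²|²` is
`|a_λ|²`, already estimated by `mul_specDist_le`; in the other term the denominator is at least
`δ²`. -/
theorem norm_fderiv_symbol_le (hm : 0 < m) (h : 0 < specDist m lam) (ξ : E d) :
    ‖fderiv ℝ (symbol (d := d) m lam) ξ‖ ≤ (symbolBound m lam).grad := by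
  rw [norm_fderiv_symbol hm h]
  set T := ‖ξ‖ ^ 2 + m ^ 2 with hT
  have hT0 : 0 < T := by positivity
  have hD := symbol_den_ge m lam ξ
  rw [← hT] at hD
  have hDp : 0 < ‖((T : ℝ) : ℂ) - lam ^ 2‖ := h.trans_le hD
  have h1 : ‖ξ‖ ≤ √T := Real.le_sqrt_of_sq_le (by nlinarith)
  have hs : m ≤ √T := Real.le_sqrt_of_sq_le (by nlinarith [norm_nonneg ξ])
  have h2 := mul_specDist_le hm lam hs
  rw [Real.sq_sqrt hT0.le] at h2
  have h3 : ‖(T : ℂ) + lam ^ 2‖ ≤ T + ‖lam‖ ^ 2 := by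
    refine (norm_add_le _ _).trans ?_
    rw [norm_pow, Complex.norm_real, Real.norm_of_nonneg hT0.le]
  have hsq : 0 < √T := by positivity
  rw [symbolDer, ← hT, norm_div, norm_neg, norm_mul, norm_pow, Complex.norm_real,
    Real.norm_of_nonneg hsq.le, symbolBound]
  set N := ‖(T : ℂ) - lam ^ 2‖
  calc ‖ξ‖ * (‖(T : ℂ) + lam ^ 2‖ / (√T * N ^ 2)) ≤ √T * ((T + ‖lam‖ ^ 2) / (√T * N ^ 2)) := by
        gcongr
    _ = (T + ‖lam‖ ^ 2) / N ^ 2 := by field_simp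
    _ ≤ ((m + ‖lam‖) ^ 2 + ‖lam‖ ^ 2) / specDist m lam ^ 2 := by
        rw [add_div T, add_div ((m + ‖lam‖) ^ 2)]
        refine add_le_add ?_ (div_le_div_of_nonneg_left (by positivity) (by positivity)
          (pow_le_pow_left₀ h.le hD 2))
        rw [div_le_div_iff₀ (by positivity) (by positivity)]
        have h4 := pow_le_pow_left₀ (by positivity) h2 2
        rw [mul_pow, Real.sq_sqrt hT0.le, mul_pow] at h4
        rw [add_comm m]
        exact h4

theorem differentiable_symbol (hm : 0 < m) (h : 0 < specDist m lam) :
    Differentiable ℝ (symbol (d := d) m lam) :=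
  fun ξ => (hasFDerivAt_symbol hm h ξ).differentiableAt

end symbol

/-! ### Suprema -/

section supNorm

variable {d : ℕ} {F : Type*} [NormedAddCommGroup F]

theorem supNorm_nonneg (f : E d → F) : 0 ≤ supNorm f := ENNReal.toReal_nonneg

theorem supNorm_le {f : E d → F} {C : ℝ} (hC : 0 ≤ C) (h : ∀ x, ‖f x‖ ≤ C) : supNorm f ≤ C := by
  refine ENNReal.toReal_le_of_le_ofReal hC ?_
  rw [eLpNorm_exponent_top]
  exact eLpNormEssSup_le_of_ae_bound (Filter.Eventually.of_forall h)

/-- A strict superlevel set of a continuous function is open, hence of positive measure unless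
empty; so the essential supremum bounds every value. The bound `C` only ensures finiteness, without
which `toReal` would return `0`. -/
theorem norm_le_supNorm {f : E d → F} (hf : Continuous f) {C : ℝ} (h : ∀ x, ‖f x‖ ≤ C) (x : E d) :
    ‖f x‖ ≤ supNorm f := by
  have hfin : eLpNorm f ∞ volume ≠ ∞ := by
    rw [eLpNorm_exponent_top]
    exact (lt_of_le_of_lt (eLpNormEssSup_le_of_ae_bound (Filter.Eventually.of_forall h))
      ENNReal.ofReal_lt_top).ne
  by_contra hx
  have hopen : IsOpen {y : E d | supNorm f < ‖f y‖} := isOpen_lt continuous_const hf.norm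
  have hpos := hopen.measure_pos volume ⟨x, not_le.1 hx⟩
  have hnull : volume {y : E d | supNorm f < ‖f y‖} = 0 := by
    have hae := ae_le_eLpNormEssSup (f := f) (μ := volume)
    refine measure_mono_null (fun y hy => ?_) (ae_iff.1 hae)
    simp only [Set.mem_ofPred_eq, not_le] at hy ⊢
    rw [eLpNorm_exponent_top] at hfin
    rw [supNorm, eLpNorm_exponent_top] at hy
    rw [← ENNReal.ofReal_toReal hfin, ← ofReal_norm]
    exact (ENNReal.ofReal_lt_ofReal_iff (ENNReal.toReal_nonneg.trans_lt hy)).2 hy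
  exact hpos.ne' hnull

end supNorm

/-! ### Pointwise bounds by the suprema of the symbols. -/

section symbolSize

variable {d : ℕ} {m : ℝ} {lam : ℂ}

theorem norm_symbol_le_size (hm : 0 < m) (h : 0 < specDist m lam) (ξ : E d) :
    ‖symbol m lam ξ‖ ≤ (symbolSize d m lam).sup :=
  norm_le_supNorm (continuous_symbol h) (norm_symbol_le hm h) ξ

theorem norm_fderiv_symbol_le_size (hm : 0 < m) (h : 0 < specDist m lam) (ξ : E d) :
    ‖fderiv ℝ (symbol m lam) ξ‖ ≤ (symbolSize d m lam).grad :=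
  norm_le_supNorm (continuous_fderiv_symbol hm h) (norm_fderiv_symbol_le hm h) ξ

theorem norm_xi_symbol_le_size (hm : 0 < m) (h : 0 < specDist m lam) (ξ : E d) :
    ‖ξ‖ * ‖symbol m lam ξ‖ ≤ (symbolSize d m lam).xi := by
  have h1 : Continuous fun ξ : E d => (‖ξ‖ : ℂ) * symbol m lam ξ :=
    Continuous.mul (by fun_prop) (continuous_symbol h)
  simpa [symbolSize] using norm_le_supNorm h1 (norm_xi_symbol_le hm h) ξ

theorem symbolSize_sup_nonneg : 0 ≤ (symbolSize d m lam).sup := supNorm_nonneg _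
theorem symbolSize_grad_nonneg : 0 ≤ (symbolSize d m lam).grad := supNorm_nonneg _
theorem symbolSize_xi_nonneg : 0 ≤ (symbolSize d m lam).xi := supNorm_nonneg _

theorem symbolSize_sup_pos (hm : 0 < m) (h : 0 < specDist m lam) : 0 < (symbolSize d m lam).sup :=
  (norm_pos_iff.2 (symbol_ne_zero hm h 0)).trans_le (norm_symbol_le_size hm h (0 : E d))

theorem symbolSize_sup_le (hm : 0 < m) (h : 0 < specDist m lam) :
    (symbolSize d m lam).sup ≤ (symbolBound m lam).sup :=
  supNorm_le ((norm_nonneg _).trans (norm_symbol_le hm h (0 : E d))) (norm_symbol_le hm h)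

theorem symbolSize_grad_le (hm : 0 < m) (h : 0 < specDist m lam) :
    (symbolSize d m lam).grad ≤ (symbolBound m lam).grad :=
  supNorm_le ((norm_nonneg _).trans (norm_fderiv_symbol_le hm h (0 : E d)))
    (norm_fderiv_symbol_le hm h)

theorem symbolSize_xi_le (hm : 0 < m) (h : 0 < specDist m lam) :
    (symbolSize d m lam).xi ≤ (symbolBound m lam).xi :=
  supNorm_le ((norm_nonneg _).trans (norm_xi_symbol_le hm h (0 : E d)))
    (norm_xi_symbol_le hm h)

theorem specDist_conj : specDist m ((starRingEnd ℂ) lam) = specDist m lam := by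
  have key : ∀ μ : ℂ, specDist m ((starRingEnd ℂ) μ) ≤ specDist m μ := by
    intro μ
    refine (Metric.le_infDist (Set.Nonempty.image _ Set.nonempty_Ici)).2 ?_
    rintro _ ⟨t, ht, rfl⟩
    refine (specDist_le (m := m) _ ht).trans (le_of_eq ?_)
    rw [dist_comm, dist_eq_norm, ← RCLike.norm_conj]
    simp
  refine le_antisymm (key lam) ?_
  simpa using key ((starRingEnd ℂ) lam)

end symbolSize

/-! ### The potential -/

section potential

variable {d : ℕ} {p M : ℝ} {V : E d → ℝ} {lam : ℂ}

theorem Admissible.nonneg (hV : Admissible p M V) : 0 ≤ M := by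
  have := (abs_nonneg (V 0)).trans (hV.decay 0)
  simpa using this

theorem Admissible.abs_le (hV : Admissible p M V) (x : E d) : |V x| ≤ M := by
  refine (hV.decay x).trans (div_le_self hV.nonneg ?_)
  exact Real.one_le_sqrt.2 (by nlinarith [norm_nonneg x])

theorem Admissible.norm_mul_abs_le (hV : Admissible p M V) (x : E d) : ‖x‖ * |V x| ≤ M := by
  have h1 : 0 < √(1 + ‖x‖ ^ 2) := by positivity
  have h2 := hV.decay x
  rw [le_div_iff₀ h1] at h2
  have h3 : ‖x‖ ≤ √(1 + ‖x‖ ^ 2) := Real.le_sqrt_of_sq_le (by linarith)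
  nlinarith [mul_le_mul_of_nonneg_left h3 (abs_nonneg (V x))]

/-- From `2|x| ≤ 1 + |x|²`; this is the source of the `M / 2` in the bound for `‖xW‖_∞`. -/
theorem Admissible.norm_mul_sq_le (hV : Admissible p M V) (x : E d) :
    ‖x‖ * |V x| ^ 2 ≤ M ^ 2 / 2 := by
  have h1 : 0 < √(1 + ‖x‖ ^ 2) := by positivity
  have h2 := pow_le_pow_left₀ (abs_nonneg _) (hV.decay x) 2
  rw [div_pow, Real.sq_sqrt (by positivity), le_div_iff₀ (by positivity)] at h2
  have h3 : 2 * ‖x‖ ≤ 1 + ‖x‖ ^ 2 := by nlinarith [sq_nonneg (‖x‖ - 1)]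
  nlinarith [mul_le_mul_of_nonneg_left h3 (sq_nonneg |V x|)]

theorem norm_W_le (lam : ℂ) (V : E d → ℝ) (x : E d) :
    ‖W lam V x‖ ≤ |V x| * (|V x| + 2 * ‖lam‖) := by
  have : W lam V x = (V x : ℂ) * ((V x : ℂ) - 2 * lam) := by unfold W; ring
  rw [this, norm_mul, Complex.norm_real, Real.norm_eq_abs]
  gcongr
  refine (norm_sub_le _ _).trans ?_
  simp

theorem continuous_W (hV : Continuous V) : Continuous (W lam V) := by
  unfold W
  fun_prop

theorem Admissible.norm_W_le (hV : Admissible p M V) (x : E d) :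
    ‖W lam V x‖ ≤ M * (M + 2 * ‖lam‖) := by
  refine (KleinGordon.norm_W_le lam V x).trans ?_
  have := hV.abs_le x
  have := hV.nonneg
  gcongr

theorem Admissible.norm_mul_W_le (hV : Admissible p M V) (x : E d) :
    ‖(‖x‖ : ℂ) * W lam V x‖ ≤ M * (M / 2 + 2 * ‖lam‖) := by
  rw [norm_mul, Complex.norm_real, norm_norm]
  have h1 := mul_le_mul_of_nonneg_left (KleinGordon.norm_W_le lam V x) (norm_nonneg x)
  have h2 := hV.norm_mul_abs_le x
  have h3 := hV.norm_mul_sq_le x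
  have h4 := mul_le_mul_of_nonneg_right h2 (norm_nonneg lam)
  nlinarith

theorem Admissible.norm_W_le_supNorm (hV : Admissible p M V) (x : E d) :
    ‖W lam V x‖ ≤ supNorm (W lam V) :=
  norm_le_supNorm (continuous_W hV.continuous) hV.norm_W_le x

theorem Admissible.norm_mul_W_le_supNorm (hV : Admissible p M V) (x : E d) :
    ‖x‖ * ‖W lam V x‖ ≤ supNorm fun x : E d => (‖x‖ : ℂ) * W lam V x := by
  have h1 : Continuous fun x : E d => (‖x‖ : ℂ) * W lam V x :=
    Continuous.mul (by fun_prop) (continuous_W hV.continuous)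
  simpa using norm_le_supNorm h1 hV.norm_mul_W_le x

theorem Admissible.memLp_W (hV : Admissible p M V) : MemLp (W lam V) ∞ volume :=
  memLp_top_of_bound (continuous_W hV.continuous).aestronglyMeasurable _
    (Filter.Eventually.of_forall hV.norm_W_le)

theorem Admissible.supNorm_W_le (hV : Admissible p M V) :
    supNorm (W lam V) ≤ M * (M + 2 * ‖lam‖) :=
  supNorm_le ((norm_nonneg _).trans (hV.norm_W_le (lam := lam) 0)) hV.norm_W_le

theorem Admissible.supNorm_mul_W_le (hV : Admissible p M V) :
    supNorm (fun x : E d => (‖x‖ : ℂ) * W lam V x) ≤ M * (M / 2 + 2 * ‖lam‖) :=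
  supNorm_le ((norm_nonneg _).trans (hV.norm_mul_W_le (lam := lam) 0)) hV.norm_mul_W_le

end potential

/-! ### The constants -/

section constants

variable {d : ℕ} {p M m : ℝ} {lam : ℂ} {V : E d → ℝ}

/-- All three numbers of `S` lie between `0` and those of `S'`. -/
structure SymbolSize.LE (S S' : SymbolSize) : Prop where
  sup_nonneg : 0 ≤ S.sup
  grad_nonneg : 0 ≤ S.grad
  xi_nonneg : 0 ≤ S.xi
  sup_le : S.sup ≤ S'.sup
  grad_le : S.grad ≤ S'.grad
  xi_le : S.xi ≤ S'.xi

theorem symbolSize_le_bound (hm : 0 < m) (h : 0 < specDist m lam) :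
    (symbolSize d m lam).LE (symbolBound m lam) :=
  ⟨symbolSize_sup_nonneg, symbolSize_grad_nonneg, symbolSize_xi_nonneg, symbolSize_sup_le hm h,
    symbolSize_grad_le hm h, symbolSize_xi_le hm h⟩

theorem constTrunc_mono (hm : 0 < m) {S S' S₀ S₀' : SymbolSize} (h : S.LE S') (h₀ : S₀.LE S₀')
    {w w' xw xw' : ℝ} (hw : 0 ≤ w) (hxw : 0 ≤ xw) (hw' : w ≤ w') (hxw' : xw ≤ xw') :
    constTrunc m lam S S₀ w xw ≤ constTrunc m lam S' S₀' w' xw' := by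
  obtain ⟨a1, a2, a3, b1, b2, b3⟩ := h
  obtain ⟨a4, a5, a6, b4, b5, b6⟩ := h₀
  have c1 := a1.trans b1
  have c2 := a2.trans b2
  have c3 := a3.trans b3
  have c4 := a4.trans b4
  have c5 := a5.trans b5
  have c6 := a6.trans b6
  have := specDist_nonneg m lam
  have := Real.pi_pos
  unfold constTrunc const1 const2
  gcongr

theorem constMat_mono (hd : (d : ℝ) < p) (hM : 0 ≤ M) {S S' S₀ S₀' : SymbolSize} (h : S.LE S')
    (h₀ : S₀.LE S₀') : constMat d p M lam S S₀ ≤ constMat d p M lam S' S₀' := by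
  obtain ⟨a1, a2, a3, b1, b2, b3⟩ := h
  obtain ⟨a4, a5, a6, b4, b5, b6⟩ := h₀
  have hp : 0 < p := (Nat.cast_nonneg d).trans_lt hd
  have h1 : 0 < 1 - d / p := by rw [sub_pos, div_lt_one hp]; exact hd
  have c1 := a1.trans b1
  have c2 := a2.trans b2
  have := Real.pi_pos
  unfold constMat constD1 constD2 constD3
  gcongr

theorem Admissible.constK_le_explicit (hV : Admissible p M V) (hd : (d : ℝ) < p) (hm : 0 < m)
    (h : 0 < specDist m lam) : constK p M m lam V ≤ constKExplicit d p M m lam :=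
  add_le_add
    (constTrunc_mono hm (symbolSize_le_bound hm h) (symbolSize_le_bound hm (specDist_zero_pos hm))
      (supNorm_nonneg _) (supNorm_nonneg _) hV.supNorm_W_le hV.supNorm_mul_W_le)
    (constMat_mono hd hV.nonneg (symbolSize_le_bound hm h)
      (symbolSize_le_bound hm (specDist_zero_pos hm)))

theorem constD1_nonneg (hM : 0 ≤ M) :
    0 ≤ constD1 d M lam (symbolSize d m lam) (symbolSize d m 0) := by
  have h1 := symbolSize_sup_nonneg (d := d) (m := m) (lam := lam)
  have h2 := symbolSize_grad_nonneg (d := d) (m := m) (lam := lam)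
  have h3 := symbolSize_sup_nonneg (d := d) (m := m) (lam := 0)
  have h4 := symbolSize_grad_nonneg (d := d) (m := m) (lam := 0)
  unfold constD1
  positivity

theorem constD3_nonneg (hd : (d : ℝ) < p) (hM : 0 ≤ M) :
    0 ≤ constD3 d p M lam (symbolSize d m lam) (symbolSize d m 0) := by
  have hp : 0 < p := (Nat.cast_nonneg d).trans_lt hd
  have h1 : 0 < 1 - d / p := by rw [sub_pos, div_lt_one hp]; exact hd
  have h2 := symbolSize_sup_nonneg (d := d) (m := m) (lam := lam)
  have h3 := symbolSize_sup_nonneg (d := d) (m := m) (lam := 0)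
  have := Real.pi_pos
  unfold constD3
  positivity

/-- `D₂` alone is enough: it contains no norm of `W`, so it stays positive even when the potential
vanishes. -/
theorem constK_pos (hd : (d : ℝ) < p) (hM : 0 < M) (hm : 0 < m) (h : 0 < specDist m lam) :
    0 < constK p M m lam V := by
  have h1 : 0 < constD2 M lam (symbolSize d m lam) (symbolSize d m 0) := by
    have h2 := symbolSize_sup_pos (d := d) hm h
    have h3 := symbolSize_sup_pos (d := d) hm (specDist_zero_pos hm)
    unfold constD2
    positivity
  have h4 := constD1_nonneg (d := d) (m := m) (lam := lam) hM.le
  have h5 := constD3_nonneg (d := d) (m := m) (lam := lam) hd hM.le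
  have h6 : 0 ≤ constTrunc m lam (symbolSize d m lam) (symbolSize d m 0)
      (supNorm (W lam V)) (supNorm fun x : E d => (‖x‖ : ℂ) * W lam V x) := Real.sqrt_nonneg _
  unfold constK constMat
  linarith

end constants

/-! ### Factorization of `K` -/

section factorization

variable {d : ℕ} {p M m : ℝ} {lam : ℂ} {V : E d → ℝ}

theorem memLp_comp_smul {a : E d → ℂ} (ha : Continuous a) {C : ℝ} (h : ∀ ξ, ‖a ξ‖ ≤ C) :
    MemLp (fun ξ => a ((2 * Real.pi) • ξ)) ∞ volume :=
  memLp_top_of_bound (ha.comp (continuous_const_smul _)).aestronglyMeasurable C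
    (Filter.Eventually.of_forall fun _ => h _)

/-- The symbol of `(1 - λ² H₀⁻¹)⁻¹`. -/
def resolventSymbol (m : ℝ) (lam : ℂ) (ξ : E d) : ℂ :=
  ((‖ξ‖ ^ 2 + m ^ 2 : ℝ) : ℂ) / (((‖ξ‖ ^ 2 + m ^ 2 : ℝ) : ℂ) - lam ^ 2)

theorem continuous_resolventSymbol (h : 0 < specDist m lam) :
    Continuous (resolventSymbol (d := d) m lam) := by
  unfold resolventSymbol
  refine Continuous.div (by fun_prop) (by fun_prop) fun ξ => symbol_den_ne_zero h ξ

/-- The symbol equals `1 + λ² / (|ξ|² + m² - λ²)`. -/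
theorem norm_resolventSymbol_le (h : 0 < specDist m lam) (ξ : E d) :
    ‖resolventSymbol m lam ξ‖ ≤ 1 + ‖lam‖ ^ 2 / specDist m lam := by
  have h1 := symbol_den_ne_zero h ξ
  have h2 : resolventSymbol m lam ξ =
      1 + lam ^ 2 / (((‖ξ‖ ^ 2 + m ^ 2 : ℝ) : ℂ) - lam ^ 2) := by
    unfold resolventSymbol
    field_simp
    ring
  rw [h2]
  refine (norm_add_le _ _).trans ?_
  rw [norm_one, norm_div, norm_pow]
  gcongr
  exact symbol_den_ge m lam ξ

theorem memLp_symbol (hm : 0 < m) (h : 0 < specDist m lam) :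
    MemLp (fun ξ : E d => symbol m lam ((2 * Real.pi) • ξ)) ∞ volume :=
  memLp_comp_smul (continuous_symbol h) (norm_symbol_le hm h)

theorem memLp_resolventSymbol (h : 0 < specDist m lam) :
    MemLp (fun ξ : E d => resolventSymbol m lam ((2 * Real.pi) • ξ)) ∞ volume :=
  memLp_comp_smul (continuous_resolventSymbol h) (norm_resolventSymbol_le h)

theorem mulOp_add {g h : E d → ℂ} (hg : MemLp g ∞ volume) (hh : MemLp h ∞ volume) :
    mulOp (fun x => g x + h x) = mulOp g + mulOp h := by
  ext1 f
  apply Lp.ext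
  have hgh : MemLp (fun x => g x + h x) ∞ volume := hg.add hh
  filter_upwards [mulOp_coeFn hg f, mulOp_coeFn hh f, mulOp_coeFn hgh f,
    Lp.coeFn_add (mulOp g f) (mulOp h f)] with x h1 h2 h3 h4
  rw [_root_.add_apply, h4, Pi.add_apply, h1, h2, h3, add_mul]

theorem mulOp_const_mul {g : E d → ℂ} (hg : MemLp g ∞ volume) (c : ℂ) :
    mulOp (fun x => c * g x) = c • mulOp g := by
  ext1 f
  apply Lp.ext
  have hcg : MemLp (fun x => c * g x) ∞ volume := hg.const_mul c
  filter_upwards [mulOp_coeFn hg f, mulOp_coeFn hcg f, Lp.coeFn_smul c (mulOp g f)]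
    with x h1 h2 h3
  rw [_root_.smul_apply, h3, Pi.smul_apply, h1, h2, smul_eq_mul, mul_assoc]

theorem one_sub_smul_invH0 (hm : 0 < m) : 1 - lam ^ 2 • invH0 d m =
    fourierMultiplier fun ξ : E d => 1 + -lam ^ 2 * (((‖ξ‖ ^ 2 + m ^ 2)⁻¹ : ℝ) : ℂ) := by
  have h1 : MemLp (fun _ : E d => (1 : ℂ)) ∞ volume := memLp_top_const 1
  have h2 := memLp_invH0 (d := d) hm
  have h3 : MemLp (fun ξ : E d => -lam ^ 2 * (((‖(2 * Real.pi) • ξ‖ ^ 2 + m ^ 2)⁻¹ : ℝ) : ℂ)) ∞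
    volume := h2.const_mul (-lam ^ 2)
  unfold fourierMultiplier
  rw [mulOp_add h1 h3, mulOp_const_mul h2, mulOp_one, invH0, fourierMultiplier]
  ext1 f
  simp [sub_eq_add_neg]

theorem memLp_one_sub (hm : 0 < m) : MemLp (fun ξ : E d =>
    1 + -lam ^ 2 * (((‖(2 * Real.pi) • ξ‖ ^ 2 + m ^ 2)⁻¹ : ℝ) : ℂ)) ∞ volume :=
  (memLp_top_const (1 : ℂ)).add ((memLp_invH0 (d := d) hm).const_mul (-lam ^ 2))

theorem symbol_T_ne_zero (hm : 0 < m) (ξ : E d) : ((‖ξ‖ ^ 2 + m ^ 2 : ℝ) : ℂ) ≠ 0 := by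
  exact_mod_cast (by positivity : ‖ξ‖ ^ 2 + m ^ 2 ≠ 0)

theorem one_sub_mul_resolventSymbol (hm : 0 < m) (h : 0 < specDist m lam) (ξ : E d) :
    (1 + -lam ^ 2 * (((‖ξ‖ ^ 2 + m ^ 2)⁻¹ : ℝ) : ℂ)) * resolventSymbol m lam ξ = 1 := by
  have h1 := symbol_den_ne_zero h ξ
  have h2 := symbol_T_ne_zero hm ξ
  rw [resolventSymbol, Complex.ofReal_inv]
  generalize ((‖ξ‖ ^ 2 + m ^ 2 : ℝ) : ℂ) = T at *
  field_simp
  ring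

theorem one_sub_mul_resolvent (hm : 0 < m) (h : 0 < specDist m lam) :
    (1 - lam ^ 2 • invH0 d m) * fourierMultiplier (resolventSymbol m lam) = 1 := by
  have h1 : (fun ξ : E d => (1 + -lam ^ 2 * (((‖ξ‖ ^ 2 + m ^ 2)⁻¹ : ℝ) : ℂ)) *
      resolventSymbol m lam ξ) = fun _ => 1 := funext (one_sub_mul_resolventSymbol hm h)
  rw [one_sub_smul_invH0 hm, fourierMultiplier_mul (memLp_one_sub hm) (memLp_resolventSymbol h), h1,
    fourierMultiplier_one]
  simp_rw [one_sub_mul_resolventSymbol hm h]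
  exact memLp_top_const 1

theorem resolvent_mul_one_sub (hm : 0 < m) (h : 0 < specDist m lam) :
    fourierMultiplier (resolventSymbol m lam) * (1 - lam ^ 2 • invH0 d m) = 1 := by
  have h0 : ∀ ξ : E d, resolventSymbol m lam ξ *
      (1 + -lam ^ 2 * (((‖ξ‖ ^ 2 + m ^ 2)⁻¹ : ℝ) : ℂ)) = 1 := fun ξ => by
    rw [mul_comm, one_sub_mul_resolventSymbol hm h]
  rw [one_sub_smul_invH0 hm, fourierMultiplier_mul (memLp_resolventSymbol h) (memLp_one_sub hm),
    funext h0, fourierMultiplier_one]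
  simp_rw [h0]
  exact memLp_top_const 1

theorem isUnit_one_sub (hm : 0 < m) (h : 0 < specDist m lam) :
    IsUnit (1 - lam ^ 2 • invH0 d m) :=
  ⟨⟨_, _, one_sub_mul_resolvent hm h, resolvent_mul_one_sub hm h⟩, rfl⟩

/-- `Ring.inverse` is `0` off the units; the explicit two-sided inverse shows that this default does
not occur here. -/
theorem ringInverse_one_sub (hm : 0 < m) (h : 0 < specDist m lam) :
    Ring.inverse (1 - lam ^ 2 • invH0 d m) = fourierMultiplier (resolventSymbol m lam) :=
  Ring.inverse_unit ⟨_, _, one_sub_mul_resolvent hm h, resolvent_mul_one_sub hm h⟩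

theorem symbol_zero (hm : 0 < m) (ξ : E d) :
    symbol m 0 ξ = (((√(‖ξ‖ ^ 2 + m ^ 2))⁻¹ : ℝ) : ℂ) := by
  rw [symbol, zero_pow two_ne_zero, sub_zero, ← Complex.ofReal_div]
  congr 1
  have : 0 < ‖ξ‖ ^ 2 + m ^ 2 := by positivity
  rw [Real.sqrt_div_self]

theorem invSqrtH0_eq (hm : 0 < m) : invSqrtH0 d m = fourierMultiplier (symbol m 0) := by
  rw [invSqrtH0, funext (symbol_zero (d := d) hm)]

theorem resolventSymbol_mul (hm : 0 < m) (ξ : E d) :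
    resolventSymbol m lam ξ * symbol m 0 ξ = symbol m lam ξ := by
  rw [symbol_zero hm, resolventSymbol, symbol, div_mul_eq_mul_div, ← Complex.ofReal_mul]
  congr 2
  have : 0 < ‖ξ‖ ^ 2 + m ^ 2 := by positivity
  rw [← div_eq_mul_inv, Real.div_sqrt]

/-- The resolvent and the left inverse root are both multipliers, and the product of their symbols
is `a_λ`. -/
theorem K_eq (hm : 0 < m) (h : 0 < specDist m lam) : K m lam V =
    fourierMultiplier (symbol m lam) * mulOp (W lam V) * fourierMultiplier (symbol m 0) := by
  have h0 := specDist_zero_pos hm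
  rw [K, ringInverse_one_sub hm h, invSqrtH0_eq hm,
    fourierMultiplier_mul (memLp_resolventSymbol h) (memLp_symbol hm h0),
    funext (resolventSymbol_mul hm)]
  simp_rw [resolventSymbol_mul hm]
  exact memLp_symbol hm h

theorem norm_invSqrtH0_le (hm : 0 < m) : ‖fourierMultiplier (symbol (d := d) m 0)‖ ≤ m⁻¹ := by
  refine norm_fourierMultiplier_le (memLp_symbol hm (specDist_zero_pos hm)) (fun ξ => ?_)
    (by positivity)
  rw [symbol_zero hm, Complex.norm_real, Real.norm_of_nonneg (by positivity)]
  exact inv_anti₀ hm (Real.le_sqrt_of_sq_le (by nlinarith [norm_nonneg ξ]))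

theorem norm_resolvent_le (h : 0 < specDist m lam) :
    ‖fourierMultiplier (resolventSymbol (d := d) m lam)‖ ≤ 1 + ‖lam‖ ^ 2 / specDist m lam :=
  norm_fourierMultiplier_le (memLp_resolventSymbol h) (norm_resolventSymbol_le h) (by positivity)

/-- The unmerged form serves the estimate of `K(1 - P)`: there `W A_0 (1 - P)` carries the
smallness, and the two factors on the left are only bounded in norm. -/
theorem K_eq_resolvent (hm : 0 < m) (h : 0 < specDist m lam) : K m lam V =
    fourierMultiplier (resolventSymbol m lam) * fourierMultiplier (symbol m 0) *
      mulOp (W lam V) * fourierMultiplier (symbol m 0) := by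
  rw [K, ringInverse_one_sub hm h, invSqrtH0_eq hm]

end factorization

/-! ### The Poincaré inequality on the unit cube -/

section poincare

open Set Filter Topology

/-- The logarithmic derivative `ψ` of `cos (κ (x - 1/2))` solves the Riccati equation `ψ' = -κ² -
ψ²`. Hence `u² - κ² U² - (U² ψ)' = (u - ψ U)² ≥ 0`, and the boundary terms of `U² ψ` vanish. For `κ
< π` the cosine has no zero on `[0, 1]`; the value `π` is reached by a limit only afterwards. -/
theorem integral_dirichlet_le {U u : ℝ → ℝ} (hU : ∀ x, HasDerivAt U (u x) x) (hu : Continuous u)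
    (h0 : U 0 = 0) (h1 : U 1 = 0) {κ : ℝ} (hκ0 : 0 < κ) (hκ : κ < Real.pi) :
    κ ^ 2 * ∫ x in (0 : ℝ)..1, U x ^ 2 ≤ ∫ x in (0 : ℝ)..1, u x ^ 2 := by
  have hUc : Continuous U := continuous_iff_continuousAt.2 fun x => (hU x).continuousAt
  have hcos : ∀ x ∈ Icc (0 : ℝ) 1, Real.cos (κ * (x - 1 / 2)) ≠ 0 := by
    intro x hx
    refine (Real.cos_pos_of_mem_Ioo ⟨?_, ?_⟩).ne' <;> nlinarith [hx.1, hx.2]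
  set ψ : ℝ → ℝ := fun x => -(κ * Real.tan (κ * (x - 1 / 2))) with hψ
  have hψd : ∀ x ∈ Icc (0 : ℝ) 1, HasDerivAt ψ (-κ ^ 2 - ψ x ^ 2) x := by
    intro x hx
    have e1 : HasDerivAt (fun x : ℝ => κ * (x - 1 / 2)) κ x := by
      simpa using ((hasDerivAt_id x).sub_const (1 / 2 : ℝ)).const_mul κ
    have e2 := (((Real.hasDerivAt_tan (hcos x hx)).comp x e1).const_mul κ).neg
    refine e2.congr_deriv ?_
    have h3 : 1 / Real.cos (κ * (x - 1 / 2)) ^ 2 = 1 + Real.tan (κ * (x - 1 / 2)) ^ 2 := by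
      have h4 := hcos x hx
      rw [Real.tan_eq_sin_div_cos]
      generalize κ * (x - 1 / 2) = θ at *
      field_simp
      rw [add_comm, Real.sin_sq_add_cos_sq]
    simp only [hψ]
    rw [h3]
    ring
  have hψc : ContinuousOn ψ (Icc 0 1) := fun x hx => (hψd x hx).continuousAt.continuousWithinAt
  set F' : ℝ → ℝ := fun x => 2 * U x * u x * ψ x + U x ^ 2 * (-κ ^ 2 - ψ x ^ 2) with hF'
  have hFc : ContinuousOn F' (Icc 0 1) := by
    have := hUc.continuousOn (s := Icc (0 : ℝ) 1)
    have := hu.continuousOn (s := Icc (0 : ℝ) 1)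
    fun_prop
  have hI : Set.uIcc (0 : ℝ) 1 = Icc 0 1 := Set.uIcc_of_le zero_le_one
  have hFi : IntervalIntegrable F' volume 0 1 := ContinuousOn.intervalIntegrable (by rwa [hI])
  have hF : ∫ x in (0 : ℝ)..1, F' x = 0 := by
    have := intervalIntegral.integral_eq_sub_of_hasDerivAt (f := fun x => U x ^ 2 * ψ x) (f' := F')
      (a := 0) (b := 1) (fun x hx => ?_) hFi
    · rw [this, h0, h1]; simp
    · rw [hI] at hx
      refine (((hU x).pow 2).mul (hψd x hx)).congr_deriv ?_
      simp [hF']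
  have hUi : IntervalIntegrable (fun x => κ ^ 2 * U x ^ 2) volume 0 1 :=
    Continuous.intervalIntegrable (by fun_prop) 0 1
  have hle : ∫ x in (0 : ℝ)..1, (κ ^ 2 * U x ^ 2 + F' x) ≤ ∫ x in (0 : ℝ)..1, u x ^ 2 := by
    refine intervalIntegral.integral_mono_on zero_le_one ?_ ?_ fun x _ => ?_
    · exact hUi.add hFi
    · exact (hu.pow 2).intervalIntegrable 0 1
    · simp only [hF']
      nlinarith [sq_nonneg (u x - ψ x * U x)]
  rw [intervalIntegral.integral_add hUi hFi, hF, add_zero,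
    intervalIntegral.integral_const_mul] at hle
  exact hle

/-- As `u` has mean zero, its primitive `U` vanishes at both ends and obeys the Dirichlet
inequality; `∫ u² = -∫ U u'` then passes from `U` to `u'`. -/
theorem integral_sq_le_of_integral_eq_zero {u u' : ℝ → ℝ} (hu : ∀ x, HasDerivAt u (u' x) x)
    (hu' : Continuous u') (h0 : ∫ x in (0 : ℝ)..1, u x = 0) :
    Real.pi ^ 2 * ∫ x in (0 : ℝ)..1, u x ^ 2 ≤ ∫ x in (0 : ℝ)..1, u' x ^ 2 := by
  have huc : Continuous u := continuous_iff_continuousAt.2 fun x => (hu x).continuousAt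
  set U : ℝ → ℝ := fun x => ∫ t in (0 : ℝ)..x, u t with hUdef
  have hU : ∀ x, HasDerivAt U (u x) x := fun x =>
    intervalIntegral.integral_hasDerivAt_right (huc.intervalIntegrable _ _)
      (huc.stronglyMeasurableAtFilter _ _) huc.continuousAt
  have hUc : Continuous U := continuous_iff_continuousAt.2 fun x => (hU x).continuousAt
  have hU0 : U 0 = 0 := by simp [hUdef]
  have hU1 : U 1 = 0 := h0
  have i1 : ∀ {f : ℝ → ℝ}, Continuous f → IntervalIntegrable f volume 0 1 :=
    fun hf => hf.intervalIntegrable 0 1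
  have hparts : ∫ x in (0 : ℝ)..1, (u x ^ 2 + U x * u' x) = 0 := by
    have := intervalIntegral.integral_eq_sub_of_hasDerivAt (f := fun x => U x * u x)
      (f' := fun x => u x ^ 2 + U x * u' x) (a := 0) (b := 1)
      (fun x _ => ((hU x).mul (hu x)).congr_deriv (by ring)) (i1 (by fun_prop))
    rw [this, hU0, hU1]; simp
  rw [intervalIntegral.integral_add (i1 (by fun_prop)) (i1 (by fun_prop))] at hparts
  have key : ∀ κ : ℝ, 0 < κ → κ < Real.pi →
      κ ^ 2 * ∫ x in (0 : ℝ)..1, u x ^ 2 ≤ ∫ x in (0 : ℝ)..1, u' x ^ 2 := by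
    intro κ hκ0 hκ
    have hD := integral_dirichlet_le hU huc hU0 hU1 hκ0 hκ
    -- The left side is `2κ² ∫ u²`. On the right, `κ⁴ ∫ U² ≤ κ² ∫ u²` by the Dirichlet inequality,
    -- which absorbs one of the two copies.
    have hle : ∫ x in (0 : ℝ)..1, -(κ ^ 2 * (2 * (U x * u' x))) ≤
        ∫ x in (0 : ℝ)..1, (κ ^ 2 * (κ ^ 2 * U x ^ 2) + u' x ^ 2) := by
      refine intervalIntegral.integral_mono_on zero_le_one (i1 (by fun_prop)) (i1 (by fun_prop))
        fun x _ => ?_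
      nlinarith [sq_nonneg (κ ^ 2 * U x + u' x)]
    rw [intervalIntegral.integral_add (i1 (by fun_prop)) (i1 (by fun_prop)),
      intervalIntegral.integral_neg, intervalIntegral.integral_const_mul,
      intervalIntegral.integral_const_mul, intervalIntegral.integral_const_mul,
      intervalIntegral.integral_const_mul] at hle
    have := mul_le_mul_of_nonneg_left hD (sq_nonneg κ)
    nlinarith
  have hlim : Tendsto (fun κ : ℝ => κ ^ 2 * ∫ x in (0 : ℝ)..1, u x ^ 2) (𝓝[<] Real.pi)
      (𝓝 (Real.pi ^ 2 * ∫ x in (0 : ℝ)..1, u x ^ 2)) := by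
    refine Tendsto.mono_left (Continuous.tendsto ?_ _) nhdsWithin_le_nhds
    fun_prop
  refine le_of_tendsto hlim ?_
  filter_upwards [Ioo_mem_nhdsLT Real.pi_pos] with κ hκ
  exact key κ hκ.1 hκ.2

/-- When the square is expanded, `f` enters the cross term through its mean only. -/
theorem integral_norm_sub_sq {X : Type*} [MeasurableSpace X] {μ : Measure X}
    [IsProbabilityMeasure μ] {f : X → ℂ} (hf : Integrable f μ)
    (hf2 : Integrable (fun x => ‖f x‖ ^ 2) μ) (c : ℂ) :
    ∫ x, ‖f x - c‖ ^ 2 ∂μ = ∫ x, ‖f x - ∫ y, f y ∂μ‖ ^ 2 ∂μ + ‖(∫ y, f y ∂μ) - c‖ ^ 2 := by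
  have expand : ∀ c : ℂ, ∫ x, ‖f x - c‖ ^ 2 ∂μ =
      ∫ x, ‖f x‖ ^ 2 ∂μ - 2 * inner ℝ c (∫ y, f y ∂μ) + ‖c‖ ^ 2 := by
    intro c
    have h1 : Integrable (fun x => 2 * inner ℝ c (f x)) μ := (hf.const_inner c).const_mul 2
    have h2 : ∀ x, ‖f x - c‖ ^ 2 = ‖f x‖ ^ 2 - 2 * inner ℝ c (f x) + ‖c‖ ^ 2 := fun x => by
      rw [norm_sub_sq_real, real_inner_comm]
    have h3 : Integrable (fun x => ‖f x‖ ^ 2 - 2 * inner ℝ c (f x)) μ := hf2.sub h1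
    simp_rw [h2]
    rw [integral_add h3 (integrable_const _), integral_sub hf2 h1, integral_const_mul,
      integral_inner hf]
    simp
  rw [expand, expand, norm_sub_sq_real, real_inner_self_eq_norm_sq, real_inner_comm c]
  ring

theorem norm_integral_sq_le {X : Type*} [MeasurableSpace X] {μ : Measure X}
    [IsProbabilityMeasure μ] {f : X → ℂ} (hf : Integrable f μ)
    (hf2 : Integrable (fun x => ‖f x‖ ^ 2) μ) :
    ‖∫ x, f x ∂μ‖ ^ 2 ≤ ∫ x, ‖f x‖ ^ 2 ∂μ := by
  have h := integral_norm_sub_sq hf hf2 0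
  simp only [sub_zero] at h
  rw [h]
  have : 0 ≤ ∫ x, ‖f x - ∫ y, f y ∂μ‖ ^ 2 ∂μ := integral_nonneg fun x => by positivity
  linarith

instance isProbabilityMeasure_restrict_unitCube (d : ℕ) :
    IsProbabilityMeasure ((volume : Measure (Fin d → ℝ)).restrict (Icc 0 1)) := by
  constructor
  rw [Measure.restrict_apply_univ, Real.volume_Icc_pi]
  simp

instance isProbabilityMeasure_restrict_unitInterval :
    IsProbabilityMeasure ((volume : Measure ℝ).restrict (Icc 0 1)) := by
  constructor
  simp

theorem poincare_unitInterval {g g' : ℝ → ℂ} (hg : ∀ x, HasDerivAt g (g' x) x)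
    (hg' : Continuous g') :
    ∫ x in Icc (0 : ℝ) 1, ‖g x - ∫ y in Icc (0 : ℝ) 1, g y‖ ^ 2 ≤
      (Real.pi ^ 2)⁻¹ * ∫ x in Icc (0 : ℝ) 1, ‖g' x‖ ^ 2 := by
  have hgc : Continuous g := continuous_iff_continuousAt.2 fun x => (hg x).continuousAt
  set c := ∫ y in Icc (0 : ℝ) 1, g y with hc
  have conv : ∀ {F : Type} [NormedAddCommGroup F] [NormedSpace ℝ F] (f : ℝ → F),
      ∫ x in Icc (0 : ℝ) 1, f x = ∫ x in (0 : ℝ)..1, f x := fun f => by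
    rw [intervalIntegral.integral_of_le zero_le_one, integral_Icc_eq_integral_Ioc]
  have hci : ∫ x in (0 : ℝ)..1, (g x - c) = 0 := by
    rw [intervalIntegral.integral_sub (hgc.intervalIntegrable _ _) (by simp), ← conv, ← hc]
    simp
  have part : ∀ L : ℂ →L[ℝ] ℝ, Real.pi ^ 2 * ∫ x in (0 : ℝ)..1, L (g x - c) ^ 2 ≤
      ∫ x in (0 : ℝ)..1, L (g' x) ^ 2 := by
    intro L
    refine integral_sq_le_of_integral_eq_zero
      (fun x => L.hasFDerivAt.comp_hasDerivAt x ((hg x).sub_const c)) (by fun_prop) ?_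
    have hi : IntervalIntegrable (fun x => g x - c) volume 0 1 :=
      Continuous.intervalIntegrable (by fun_prop) 0 1
    rw [L.intervalIntegral_comp_comm hi, hci, map_zero]
  have hsq : ∀ z : ℂ, ‖z‖ ^ 2 = Complex.reCLM z ^ 2 + Complex.imCLM z ^ 2 := fun z => by
    rw [Complex.sq_norm, Complex.normSq_apply]
    simp [sq]
  have split : ∀ {f : ℝ → ℂ}, Continuous f → ∫ x in Icc (0 : ℝ) 1, ‖f x‖ ^ 2 =
      (∫ x in (0 : ℝ)..1, Complex.reCLM (f x) ^ 2) +
        ∫ x in (0 : ℝ)..1, Complex.imCLM (f x) ^ 2 := by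
    intro f hf
    rw [conv, ← intervalIntegral.integral_add]
    · simp_rw [hsq]
    · exact Continuous.intervalIntegrable (by fun_prop) _ _
    · exact Continuous.intervalIntegrable (by fun_prop) _ _
  rw [split (f := fun x => g x - c) (by fun_prop), split hg',
    le_inv_mul_iff₀ (by positivity), mul_add]
  exact add_le_add (part _) (part _)

/-- Tensorization of the variance. -/
theorem integral_variance_le {d : ℕ} {G : ℝ → (Fin d → ℝ) → ℂ}
    (hG : Continuous (Function.uncurry G)) :
    ∫ x in Icc (0 : ℝ) 1, ∫ y in Icc (0 : Fin d → ℝ) 1,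
        ‖G x y - ∫ x in Icc (0 : ℝ) 1, ∫ y in Icc (0 : Fin d → ℝ) 1, G x y‖ ^ 2 ≤
      (∫ x in Icc (0 : ℝ) 1, ∫ y in Icc (0 : Fin d → ℝ) 1,
        ‖G x y - ∫ y in Icc (0 : Fin d → ℝ) 1, G x y‖ ^ 2) +
      ∫ y in Icc (0 : Fin d → ℝ) 1, ∫ x in Icc (0 : ℝ) 1,
        ‖G x y - ∫ x in Icc (0 : ℝ) 1, G x y‖ ^ 2 := by
  have kX : IsCompact (Icc (0 : ℝ) 1) := isCompact_Icc
  have kY : IsCompact (Icc (0 : Fin d → ℝ) 1) := isCompact_Icc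
  have hG1 : ∀ y, Continuous fun x => G x y := fun y => hG.comp (Continuous.prodMk_left y)
  have hG2 : ∀ x, Continuous fun y => G x y := fun x => hG.comp (Continuous.prodMk_right x)
  set h : ℝ → ℂ := fun x => ∫ y in Icc (0 : Fin d → ℝ) 1, G x y with hh
  set q : (Fin d → ℝ) → ℂ := fun y => ∫ x in Icc (0 : ℝ) 1, G x y with hq
  have hhc : Continuous h := continuous_parametric_integral_of_continuous (f := G) hG kY
  have hqc : Continuous q := by
    have : Continuous (Function.uncurry fun y x => G x y) := hG.comp continuous_swap
    exact continuous_parametric_integral_of_continuous (f := fun y x => G x y) this kX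
  have hG' : Continuous fun z : (Fin d → ℝ) × ℝ => G z.2 z.1 := hG.comp continuous_swap
  set c : ℂ := ∫ x in Icc (0 : ℝ) 1, h x with hc
  have iX : ∀ {F : Type} [NormedAddCommGroup F] {f : ℝ → F}, Continuous f →
      IntegrableOn f (Icc 0 1) := fun hf => hf.continuousOn.integrableOn_compact kX
  have iY : ∀ {F : Type} [NormedAddCommGroup F] {f : (Fin d → ℝ) → F}, Continuous f →
      IntegrableOn f (Icc 0 1) := fun hf => hf.continuousOn.integrableOn_compact kY
  have swap : ∀ f : ℝ → (Fin d → ℝ) → ℝ, Continuous (Function.uncurry f) →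
      ∫ x in Icc (0 : ℝ) 1, ∫ y in Icc (0 : Fin d → ℝ) 1, f x y =
        ∫ y in Icc (0 : Fin d → ℝ) 1, ∫ x in Icc (0 : ℝ) 1, f x y := by
    intro f hf
    refine integral_integral_swap ?_
    rw [Measure.prod_restrict]
    exact hf.continuousOn.integrableOn_compact (kX.prod kY)
  have cG : ∀ f : ℝ → ℂ, Continuous f →
      Continuous (Function.uncurry fun x y => ‖G x y - f x‖ ^ 2) := fun f hf =>
    ((hG.sub (hf.comp continuous_fst)).norm).pow 2
  rw [swap _ (cG (fun _ => c) continuous_const), swap _ (cG h hhc),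
    ← integral_add]
  rotate_left
  · refine iY (continuous_parametric_integral_of_continuous
      (f := fun y x => ‖G x y - h x‖ ^ 2) ((cG h hhc).comp continuous_swap) kX)
  · refine iY (continuous_parametric_integral_of_continuous
      (f := fun y x => ‖G x y - q y‖ ^ 2) ?_ kX)
    exact ((hG'.sub (hqc.comp continuous_fst)).norm).pow 2
  refine integral_mono_of_nonneg (Eventually.of_forall fun y => integral_nonneg fun x => by
    positivity) ?_ (Eventually.of_forall fun y => ?_)
  · refine (iY (continuous_parametric_integral_of_continuous
      (f := fun y x => ‖G x y - h x‖ ^ 2) ((cG h hhc).comp continuous_swap) kX)).add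
      (iY (continuous_parametric_integral_of_continuous
      (f := fun y x => ‖G x y - q y‖ ^ 2) ?_ kX))
    exact ((hG'.sub (hqc.comp continuous_fst)).norm).pow 2
  -- For fixed `y` the mean square about `c` is the variance about `q y` plus `‖q y - c‖²`. Since `q
  -- y - c` is the mean over `x` of `G x y - h x`, its square is at most the mean square.
  · have e1 := integral_norm_sub_sq (iX (hG1 y)) (iX ((hG1 y).norm.pow 2)) c
    have hcont : Continuous fun x => G x y - h x := (hG1 y).sub hhc
    have e2 := norm_integral_sq_le (iX hcont) (iX (hcont.norm.pow 2))
    rw [integral_sub (iX (hG1 y)) (iX hhc)] at e2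
    simp only
    rw [e1]
    linarith

theorem integral_unitCube_succ {d : ℕ} {F : Type*} [NormedAddCommGroup F] [NormedSpace ℝ F]
    {f : (Fin (d + 1) → ℝ) → F} (hf : Continuous f) :
    ∫ x in Icc (0 : Fin (d + 1) → ℝ) 1, f x =
      ∫ t in Icc (0 : ℝ) 1, ∫ y in Icc (0 : Fin d → ℝ) 1, f (Fin.cons t y) := by
  have hmp := (volume_preserving_piFinSuccAbove (fun _ : Fin (d + 1) => ℝ) 0).symm
  have hpre : (MeasurableEquiv.piFinSuccAbove (fun _ : Fin (d + 1) => ℝ) 0).symm ⁻¹'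
      (Icc (0 : Fin (d + 1) → ℝ) 1) = Icc (0 : ℝ) 1 ×ˢ Icc (0 : Fin d → ℝ) 1 := by
    ext ⟨t, y⟩
    simp [Pi.le_def, Fin.forall_fin_succ, MeasurableEquiv.piFinSuccAbove, Fin.insertNthEquiv]
  rw [← hmp.setIntegral_preimage_emb (MeasurableEquiv.measurableEmbedding _), hpre,
    Measure.volume_eq_prod, setIntegral_prod]
  · simp [MeasurableEquiv.piFinSuccAbove, Fin.insertNthEquiv]
  · refine ContinuousOn.integrableOn_compact (isCompact_Icc.prod isCompact_Icc) ?_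
    refine (hf.comp ?_).continuousOn
    simp only [MeasurableEquiv.piFinSuccAbove, Fin.insertNthEquiv]
    simp
    fun_prop

/-- Induction on the dimension through `integral_variance_le`: splitting off a coordinate makes
variances add, and each coordinate is charged only with its own partial derivative. Hence the
constant does not depend on `d`. -/
theorem poincare_unitCube {d : ℕ} {g : (Fin d → ℝ) → ℂ} {g' : Fin d → (Fin d → ℝ) → ℂ}
    (hg : Continuous g) (hg' : ∀ l, Continuous (g' l))
    (h : ∀ l x t, HasDerivAt (fun t => g (Function.update x l t)) (g' l (Function.update x l t)) t) :
    ∫ x in Icc (0 : Fin d → ℝ) 1, ‖g x - ∫ y in Icc (0 : Fin d → ℝ) 1, g y‖ ^ 2 ≤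
      (Real.pi ^ 2)⁻¹ * ∑ l, ∫ x in Icc (0 : Fin d → ℝ) 1, ‖g' l x‖ ^ 2 := by
  induction d with
  | zero =>
    have : ∀ x, g x = g 0 := fun x => by rw [Subsingleton.elim x 0]
    have hI : ∫ y in Icc (0 : Fin 0 → ℝ) 1, g y = g 0 := by
      rw [funext this, integral_const, probReal_univ, one_smul]
    simp_rw [hI, this, sub_self]
    simp
  | succ d ih =>
    have hcons : Continuous fun z : ℝ × (Fin d → ℝ) => (Fin.cons z.1 z.2 : Fin (d + 1) → ℝ) := by
      fun_prop
    have hc1 : ∀ t, Continuous fun y : Fin d → ℝ => (Fin.cons t y : Fin (d + 1) → ℝ) := fun t =>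
      hcons.comp (Continuous.prodMk_right t)
    have hc2 : ∀ y : Fin d → ℝ, Continuous fun t => (Fin.cons t y : Fin (d + 1) → ℝ) := fun y =>
      hcons.comp (Continuous.prodMk_left y)
    rw [integral_unitCube_succ hg, integral_unitCube_succ (by fun_prop)]
    refine (integral_variance_le (G := fun t y => g (Fin.cons t y)) (hg.comp hcons)).trans ?_
    have kX : IsCompact (Icc (0 : ℝ) 1) := isCompact_Icc
    have kY : IsCompact (Icc (0 : Fin d → ℝ) 1) := isCompact_Icc
    have cD : ∀ l, Continuous (Function.uncurry fun (t : ℝ) (y : Fin d → ℝ) =>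
        ‖g' l (Fin.cons t y)‖ ^ 2) := fun l => (((hg' l).comp hcons).norm).pow 2
    have i1 : ∀ l, IntegrableOn (fun t : ℝ => ∫ y in Icc (0 : Fin d → ℝ) 1,
        ‖g' l (Fin.cons t y)‖ ^ 2) (Icc 0 1) := fun l =>
      (continuous_parametric_integral_of_continuous (cD l) kY).continuousOn.integrableOn_compact kX
    have i2 : IntegrableOn (fun y : Fin d → ℝ => ∫ t in Icc (0 : ℝ) 1,
        ‖g' 0 (Fin.cons t y)‖ ^ 2) (Icc 0 1) :=
      (continuous_parametric_integral_of_continuous (f := fun (y : Fin d → ℝ) (t : ℝ) =>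
        ‖g' 0 (Fin.cons t y)‖ ^ 2) ((cD 0).comp continuous_swap) kX).continuousOn.integrableOn_compact
        kY
    rw [Fin.sum_univ_succ, mul_add, add_comm]
    refine add_le_add ?_ ?_
    · rw [integral_unitCube_succ (f := fun x => ‖g' 0 x‖ ^ 2) (by fun_prop)]
      rw [integral_integral_swap (f := fun t y => ‖g' 0 (Fin.cons t y)‖ ^ 2), ← integral_const_mul]
      · refine integral_mono_of_nonneg (Eventually.of_forall fun y => integral_nonneg fun x => by
          positivity) (i2.const_mul _) (Eventually.of_forall fun y => ?_)
        refine poincare_unitInterval (fun t => ?_) ((hg' 0).comp (hc2 y))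
        simpa using h 0 (Fin.cons 0 y) t
      · rw [Measure.prod_restrict]
        exact (cD 0).continuousOn.integrableOn_compact (kX.prod kY)
    · have e : ∀ l : Fin d, ∫ x in Icc (0 : Fin (d + 1) → ℝ) 1, ‖g' l.succ x‖ ^ 2 =
          ∫ t in Icc (0 : ℝ) 1, ∫ y in Icc (0 : Fin d → ℝ) 1, ‖g' l.succ (Fin.cons t y)‖ ^ 2 :=
        fun l => integral_unitCube_succ (((hg' l.succ).norm).pow 2)
      simp_rw [e]
      rw [← integral_finsetSum _ fun (l : Fin d) _ => i1 l.succ, ← integral_const_mul]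
      refine integral_mono_of_nonneg (Eventually.of_forall fun y => integral_nonneg fun x => by
          positivity) ((integrable_finsetSum _ fun (l : Fin d) _ => i1 l.succ).const_mul _)
          (Eventually.of_forall fun t => ?_)
      refine ih (g' := fun l y => g' l.succ (Fin.cons t y)) (hg.comp (hc1 t))
        (fun l => (hg' l.succ).comp (hc1 t)) fun l x s => ?_
      simpa [Fin.cons_update] using h l.succ (Fin.cons t x) s

end poincare

/-! ### Cubes and lattices -/

section cubes

open Set

variable {d : ℕ}

theorem measurableSet_cube (c : E d) (h : ℝ) : MeasurableSet (cube c h) := by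
  have : cube c h = ⋂ l : Fin d, ({y : E d | c l ≤ y l} ∩ {y : E d | y l < c l + h}) := by
    ext y; simp [cube]
  rw [this]
  refine MeasurableSet.iInter fun l => MeasurableSet.inter ?_ ?_
  · exact (isClosed_le continuous_const (by fun_prop)).measurableSet
  · exact (isOpen_lt (by fun_prop) continuous_const).measurableSet

/-- The parametrization of the cube with corner `c` and side `h` by the unit cube. -/
def cubeMap (c : E d) (h : ℝ) (x : Fin d → ℝ) : E d := c + h • WithLp.toLp 2 x

@[simp] theorem cubeMap_apply (c : E d) (h : ℝ) (x : Fin d → ℝ) (l : Fin d) :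
    cubeMap c h x l = c l + h * x l := by
  simp [cubeMap]

theorem continuous_cubeMap (c : E d) (h : ℝ) : Continuous (cubeMap c h) := by
  have := PiLp.continuous_toLp 2 (fun _ : Fin d => ℝ)
  unfold cubeMap
  fun_prop

/-- Affine substitution. The half-open cube is traded for the closed one, which differs by a null
set and is compact, so that continuous functions are integrable on it. -/
theorem setIntegral_cube {F : Type*} [NormedAddCommGroup F] [NormedSpace ℝ F] (c : E d) {h : ℝ}
    (hh : 0 < h) (f : E d → F) :
    ∫ ξ in cube c h, f ξ = h ^ d • ∫ x in Icc (0 : Fin d → ℝ) 1, f (cubeMap c h x) := by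
  have e1 : ∫ x : Fin d → ℝ, (cube c h).indicator f (cubeMap c h x) =
      (h ^ d)⁻¹ • ∫ ξ, (cube c h).indicator f ξ := by
    have h1 := (PiLp.volume_preserving_toLp (Fin d)).integral_comp
      (MeasurableEquiv.toLp 2 (Fin d → ℝ)).measurableEmbedding
      (fun z : E d => (cube c h).indicator f (c + h • z))
    have h2 := Measure.integral_comp_smul_of_nonneg (volume : Measure (E d))
      (fun z : E d => (cube c h).indicator f (c + z)) h (hR := hh.le)
    rw [finrank_euclideanSpace_fin, integral_add_left_eq_self
      (f := fun z : E d => (cube c h).indicator f z)] at h2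
    rw [← h2]
    exact h1
  have e2 : ∀ x : Fin d → ℝ, (cube c h).indicator f (cubeMap c h x) =
      (univ.pi fun _ : Fin d => Ico (0 : ℝ) 1).indicator (fun x => f (cubeMap c h x)) x := by
    intro x
    have : cubeMap c h x ∈ cube c h ↔ x ∈ univ.pi fun _ : Fin d => Ico (0 : ℝ) 1 := by
      simp only [cube, Set.mem_ofPred_eq, cubeMap_apply, Set.mem_univ_pi, Set.mem_Ico]
      refine forall_congr' fun l => and_congr ?_ ?_
      · rw [le_add_iff_nonneg_right, mul_nonneg_iff_of_pos_left hh]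
      · rw [add_lt_add_iff_left, mul_lt_iff_lt_one_right hh]
    by_cases hx : x ∈ univ.pi fun _ : Fin d => Ico (0 : ℝ) 1
    · rw [indicator_of_mem hx, indicator_of_mem (this.2 hx)]
    · rw [indicator_of_notMem hx, indicator_of_notMem (mt this.1 hx)]
  have e3 : (univ.pi fun _ : Fin d => Ico (0 : ℝ) 1) =ᵐ[volume] Icc (0 : Fin d → ℝ) 1 :=
    Measure.univ_pi_Ico_ae_eq_Icc (f := (0 : Fin d → ℝ)) (g := 1)
  rw [← integral_indicator (measurableSet_cube c h), ← setIntegral_congr_set e3,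
    ← integral_indicator (MeasurableSet.univ_pi fun _ => measurableSet_Ico)]
  simp_rw [e2] at e1
  rw [e1, smul_inv_smul₀ (pow_pos hh d).ne']

theorem integrableOn_cube {F : Type*} [NormedAddCommGroup F] {f : E d → F} (hf : Continuous f)
    (c : E d) (h : ℝ) : IntegrableOn f (cube c h) := by
  have hk : IsCompact ((EuclideanSpace.equiv (Fin d) ℝ) ⁻¹'
      (Set.Icc (fun l => c l) (fun l => c l + h))) :=
    ((EuclideanSpace.equiv (Fin d) ℝ).toHomeomorph.isCompact_preimage).2 isCompact_Icc
  refine (hf.continuousOn.integrableOn_compact hk).mono_set fun x hx => ?_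
  exact ⟨fun l => (hx l).1, fun l => (hx l).2.le⟩

theorem volume_real_cube (c : E d) {h : ℝ} (hh : 0 < h) : volume.real (cube c h) = h ^ d := by
  have := setIntegral_cube c hh (fun _ => (1 : ℝ))
  simpa only [integral_const, measureReal_restrict_apply_univ, probReal_univ, smul_eq_mul, mul_one]
    using this

@[simp] theorem latticePoint_apply (n : ℕ) (κ : Fin d → ℤ) (l : Fin d) :
    latticePoint n κ l = (κ l : ℝ) / n := rfl

/-- The lattice cubes are the fibres of a floor map; disjointness and covering follow from this. -/
theorem mem_cube_latticePoint_iff {n : ℕ} (hn : 0 < n) (κ : Fin d → ℤ) (x : E d) :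
    x ∈ cube (latticePoint n κ) (1 / n) ↔ κ = fun l => ⌊n * x l⌋ := by
  have hn' : (0 : ℝ) < n := by exact_mod_cast hn
  rw [funext_iff]
  refine forall_congr' fun l => ?_
  rw [eq_comm, Int.floor_eq_iff, latticePoint_apply, ← add_div, div_le_iff₀ hn', lt_div_iff₀ hn',
    mul_comm]

theorem disjoint_cube_latticePoint {n : ℕ} (hn : 0 < n) {κ κ' : Fin d → ℤ} (h : κ ≠ κ') :
    Disjoint (cube (d := d) (latticePoint n κ) (1 / n)) (cube (latticePoint n κ') (1 / n)) := by
  rw [Set.disjoint_left]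
  intro x hx hx'
  rw [mem_cube_latticePoint_iff hn] at hx hx'
  exact h (hx.trans hx'.symm)

/-- A point outside of the cubes with lower corners in `[-q/n, q/n)^d` has norm at least `q/n`. -/
theorem le_norm_of_notMem_cube {n q : ℕ} (hn : 0 < n) {x : E d}
    (h : ∀ κ : Fin d → ℤ, (∀ l, -(q : ℤ) ≤ κ l ∧ κ l < q) →
      x ∉ cube (latticePoint n κ) (1 / n)) : (q : ℝ) ≤ n * ‖x‖ := by
  have hn' : (0 : ℝ) < n := by exact_mod_cast hn
  by_contra hlt
  rw [not_le] at hlt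
  refine h (fun l => ⌊n * x l⌋) (fun l => ?_) ((mem_cube_latticePoint_iff hn _ x).2 rfl)
  have h1 : |x l| ≤ ‖x‖ := by simpa using PiLp.norm_apply_le x l
  have h2 : |n * x l| < q := by
    rw [abs_mul, abs_of_pos hn']
    exact (mul_le_mul_of_nonneg_left h1 hn'.le).trans_lt hlt
  rw [abs_lt] at h2
  constructor
  · rw [Int.le_floor]
    push_cast
    exact h2.1.le
  · rw [Int.floor_lt]
    exact_mod_cast h2.2

theorem cube_subset_cube (c : E d) {h h' : ℝ} (hh : h ≤ h') : cube c h ⊆ cube c h' :=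
  fun _ hx l => ⟨(hx l).1, (hx l).2.trans_le (by linarith)⟩

theorem norm_sub_le_of_mem_cube {c x : E d} {h : ℝ} (hx : x ∈ cube c h) : ‖x - c‖ ≤ √d * h := by
  rcases Nat.eq_zero_or_pos d with rfl | hd
  · have : x - c = 0 := Subsingleton.elim _ _
    simp [this]
  have hh : 0 ≤ h := by
    have := hx ⟨0, hd⟩
    linarith [this.1, this.2]
  rw [EuclideanSpace.norm_eq, Real.sqrt_le_left (by positivity), mul_pow,
    Real.sq_sqrt (by positivity)]
  calc ∑ l, ‖(x - c) l‖ ^ 2 ≤ ∑ _l : Fin d, h ^ 2 := by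
        refine Finset.sum_le_sum fun l _ => ?_
        have := hx l
        rw [PiLp.sub_apply, Real.norm_eq_abs, sq_abs]
        nlinarith [this.1, this.2]
    _ = d * h ^ 2 := by simp

theorem norm_toLp_le {x : Fin d → ℝ} (hx : x ∈ Icc (0 : Fin d → ℝ) 1) :
    ‖(WithLp.toLp 2 x : E d)‖ ≤ √d := by
  rw [EuclideanSpace.norm_eq]
  refine Real.sqrt_le_sqrt ?_
  calc ∑ l, ‖(WithLp.toLp 2 x : E d) l‖ ^ 2 ≤ ∑ _l : Fin d, (1 : ℝ) := by
        refine Finset.sum_le_sum fun l _ => ?_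
        have h0 := hx.1 l
        have h1 := hx.2 l
        simp only [Pi.zero_apply, Pi.one_apply] at h0 h1
        rw [Real.norm_eq_abs, sq_abs]
        change x l ^ 2 ≤ 1
        nlinarith
    _ = d := by simp

end cubes

/-! ### The quadrature error of continuously differentiable functions -/

section quadrature

open Set

variable {d : ℕ}

/-- The derivative is integrated along the segment from the corner, of length at most `√d h`. The
integral over `t` is kept instead of a supremum because `H` will be controlled in `L^p` only. -/
theorem norm_cubeMap_sub_le {f : E d → ℂ} {f' : E d → E d →L[ℝ] ℂ} (hf : ∀ x, HasFDerivAt f (f' x) x)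
    (hf' : Continuous f') {H : E d → ℝ} (hH : Continuous H) (hfH : ∀ x, ‖f' x‖ ≤ H x) (c : E d)
    {h : ℝ} (hh : 0 ≤ h) {x : Fin d → ℝ} (hx : x ∈ Icc (0 : Fin d → ℝ) 1) :
    ‖f (cubeMap c h x) - f c‖ ≤ √d * h * ∫ t in (0 : ℝ)..1, H (cubeMap c (t * h) x) := by
  set v : E d := h • WithLp.toLp 2 x with hv
  have hline : ∀ t : ℝ, cubeMap c (t * h) x = c + t • v := fun t => by
    rw [cubeMap, hv, smul_smul]
  have hvn : ‖v‖ ≤ √d * h := by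
    rw [hv, norm_smul, Real.norm_of_nonneg hh, mul_comm]
    gcongr
    exact norm_toLp_le hx
  have hd : ∀ t : ℝ, HasDerivAt (fun t : ℝ => f (c + t • v)) (f' (c + t • v) v) t := fun t => by
    have h1 : HasDerivAt (fun t : ℝ => c + t • v) v t := by
      simpa using ((hasDerivAt_id t).smul_const v).const_add c
    exact (hf _).comp_hasDerivAt t h1
  have hc : Continuous fun t : ℝ => f' (c + t • v) v := by fun_prop
  have hint := intervalIntegral.integral_eq_sub_of_hasDerivAt (a := 0) (b := 1) (fun t _ => hd t)
    (hc.intervalIntegrable _ _)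
  have h1 : cubeMap c h x = c + (1 : ℝ) • v := by rw [← hline, one_mul]
  have h0 : f c = f (c + (0 : ℝ) • v) := by rw [zero_smul, add_zero]
  rw [h1, h0, ← hint, ← intervalIntegral.integral_const_mul]
  refine intervalIntegral.norm_integral_le_of_norm_le zero_le_one
    (Filter.Eventually.of_forall fun t _ => ?_) ?_
  · rw [hline]
    refine ((f' _).le_opNorm v).trans ?_
    rw [mul_comm]
    exact mul_le_mul hvn (hfH _) (norm_nonneg _) (by positivity)
  · simp_rw [hline]
    exact Continuous.intervalIntegrable (by fun_prop) _ _

/-- The mean over many disjoint small cubes is controlled by the `L^p` norm. -/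
theorem sum_integral_cubeMap_le {p : ℝ} (hp : 1 ≤ p) {H : E d → ℝ} (hH : Continuous H)
    (hH0 : ∀ x, 0 ≤ H x) {C : ℝ} (hC : 0 ≤ C) (hHi : Integrable fun x => H x ^ p)
    (hHC : ∫ x, H x ^ p ≤ C ^ p) {ι : Type*} (s : Finset ι) (c : ι → E d) {τ : ℝ} (hτ : 0 < τ)
    (hdisj : (s : Set ι).Pairwise (Function.onFun Disjoint fun i => cube (c i) τ)) :
    ∑ i ∈ s, ∫ x in Icc (0 : Fin d → ℝ) 1, H (cubeMap (c i) τ x) ≤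
      (s.card : ℝ) ^ (1 - 1 / p) * τ ^ (-(d / p)) * C := by
  have hp0 : 0 < p := by linarith
  have hcont : ∀ i, Continuous fun x : Fin d → ℝ => H (cubeMap (c i) τ x) := fun i =>
    hH.comp (continuous_cubeMap _ _)
  have hpow : ∀ i, Continuous fun x : Fin d → ℝ => H (cubeMap (c i) τ x) ^ p := fun i =>
    (hcont i).rpow_const fun _ => Or.inr hp0.le
  have iI : ∀ {f : (Fin d → ℝ) → ℝ}, Continuous f → IntegrableOn f (Icc 0 1) := fun hf =>
    hf.continuousOn.integrableOn_compact isCompact_Icc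
  have hnn : ∀ i, 0 ≤ ∫ x in Icc (0 : Fin d → ℝ) 1, H (cubeMap (c i) τ x) := fun i =>
    integral_nonneg fun x => hH0 _
  -- Jensen's inequality, as the integral over the unit cube is a mean.
  have h1 : ∀ i, (∫ x in Icc (0 : Fin d → ℝ) 1, H (cubeMap (c i) τ x)) ^ p ≤
      ∫ x in Icc (0 : Fin d → ℝ) 1, H (cubeMap (c i) τ x) ^ p := fun i =>
    (convexOn_rpow hp).map_integral_le (continuousOn_id.rpow_const fun _ _ => Or.inr hp0.le)
      isClosed_Ici (Filter.Eventually.of_forall fun x => hH0 _) (iI (hcont i)) (iI (hpow i))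
  have h2 : ∑ i ∈ s, ∫ x in Icc (0 : Fin d → ℝ) 1, H (cubeMap (c i) τ x) ^ p ≤
      (τ ^ d)⁻¹ * C ^ p := by
    have e : ∀ i, ∫ x in Icc (0 : Fin d → ℝ) 1, H (cubeMap (c i) τ x) ^ p =
        (τ ^ d)⁻¹ * ∫ ξ in cube (c i) τ, H ξ ^ p := fun i => by
      rw [setIntegral_cube _ hτ, smul_eq_mul, inv_mul_cancel_left₀ (pow_pos hτ d).ne']
    simp_rw [e]
    rw [← Finset.mul_sum, ← integral_biUnion_finset s (fun i _ => measurableSet_cube _ _) hdisj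
      fun i _ => hHi.integrableOn]
    gcongr
    refine (setIntegral_le_integral hHi (Filter.Eventually.of_forall fun x => ?_)).trans hHC
    exact Real.rpow_nonneg (hH0 x) p
  -- The power mean inequality for the sum over the cubes: its factor `card ^ (p - 1)` becomes `card
  -- ^ (1 - 1/p)` after the root.
  have h3 := (Real.rpow_sum_le_const_mul_sum_rpow_of_nonneg s hp (fun i _ => hnn i)).trans
    (mul_le_mul_of_nonneg_left ((Finset.sum_le_sum fun i _ => h1 i).trans h2)
      (Real.rpow_nonneg (Nat.cast_nonneg _) _))
  have h4 := Real.rpow_le_rpow (Real.rpow_nonneg (Finset.sum_nonneg fun i _ => hnn i) _) h3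
    (by positivity : 0 ≤ 1 / p)
  rw [← Real.rpow_mul (Finset.sum_nonneg fun i _ => hnn i), mul_one_div_cancel hp0.ne',
    Real.rpow_one] at h4
  refine h4.trans (le_of_eq ?_)
  rw [Real.mul_rpow (by positivity) (by positivity), Real.mul_rpow (by positivity) (by positivity),
    ← Real.rpow_mul (by positivity), ← Real.rpow_mul hC, mul_one_div_cancel hp0.ne', Real.rpow_one,
    ← Real.rpow_natCast, ← Real.rpow_neg hτ.le, ← Real.rpow_mul hτ.le, mul_assoc]
  congr 2
  · field_simp
  · ring_nf

/-- The lattice points of mesh `1 / s` in `[-R, R)^d`, as integer vectors. -/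
abbrev boxIndex (d q : ℕ) : Finset (Fin d → ℤ) :=
  Fintype.piFinset fun _ : Fin d => Finset.Ico (-(q : ℤ)) (q : ℤ)

theorem card_boxIndex (d q : ℕ) : (boxIndex d q).card = (2 * q) ^ d := by
  rw [Fintype.card_piFinset]
  simp only [Int.card_Ico, Finset.prod_const, Finset.card_univ, Fintype.card_fin]
  congr 1
  omega

/-- For each `t` the shrunken cubes of side `t h` remain disjoint, and `sum_integral_cubeMap_le`
costs `(t h)^(-d/p)`. This is integrable at `t = 0` because `p > d`, with integral `1 / (1 - d/p)`
in `t`. -/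
theorem integral_sum_integral_cubeMap_le {p : ℝ} (hp : 1 ≤ p) (hdp : (d : ℝ) < p) {H : E d → ℝ}
    (hH : Continuous H) (hH0 : ∀ x, 0 ≤ H x) {C : ℝ} (hC : 0 ≤ C)
    (hHi : Integrable fun x => H x ^ p) (hHC : ∫ x, H x ^ p ≤ C ^ p) {ι : Type*} (s : Finset ι)
    (c : ι → E d) {h : ℝ} (hh : 0 < h)
    (hdisj : (s : Set ι).Pairwise (Function.onFun Disjoint fun i => cube (c i) h)) :
    ∑ i ∈ s, ∫ x in Icc (0 : Fin d → ℝ) 1, ∫ t in (0 : ℝ)..1, H (cubeMap (c i) (t * h) x) ≤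
      (s.card : ℝ) ^ (1 - 1 / p) * h ^ (-(d / p)) * C / (1 - d / p) := by
  have hp0 : 0 < p := by linarith
  have hdp1 : (d : ℝ) / p < 1 := (div_lt_one hp0).2 hdp
  have hcont : ∀ i, Continuous fun z : ℝ × (Fin d → ℝ) => H (cubeMap (c i) (z.1 * h) z.2) := by
    intro i
    have := PiLp.continuous_toLp 2 (fun _ : Fin d => ℝ)
    unfold cubeMap
    fun_prop
  have hswap : ∀ i, ∫ x in Icc (0 : Fin d → ℝ) 1, ∫ t in (0 : ℝ)..1, H (cubeMap (c i) (t * h) x) =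
      ∫ t in (0 : ℝ)..1, ∫ x in Icc (0 : Fin d → ℝ) 1, H (cubeMap (c i) (t * h) x) := by
    intro i
    simp_rw [intervalIntegral.integral_of_le (zero_le_one (α := ℝ)),
      ← integral_Icc_eq_integral_Ioc]
    refine integral_integral_swap (f := fun x t => H (cubeMap (c i) (t * h) x)) ?_
    rw [Measure.prod_restrict]
    exact ((hcont i).comp continuous_swap).continuousOn.integrableOn_compact
      (isCompact_Icc.prod isCompact_Icc)
  have hci : ∀ i, Continuous fun t : ℝ => ∫ x in Icc (0 : Fin d → ℝ) 1,
      H (cubeMap (c i) (t * h) x) := fun i =>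
    continuous_parametric_integral_of_continuous
      (f := fun (t : ℝ) (x : Fin d → ℝ) => H (cubeMap (c i) (t * h) x)) (hcont i) isCompact_Icc
  have hr : -1 < -((d : ℝ) / p) := by linarith
  simp_rw [hswap]
  rw [← intervalIntegral.integral_finsetSum fun i _ => (hci i).intervalIntegrable _ _]
  calc ∫ t in (0 : ℝ)..1, ∑ i ∈ s, ∫ x in Icc (0 : Fin d → ℝ) 1, H (cubeMap (c i) (t * h) x)
      ≤ ∫ t in (0 : ℝ)..1, (s.card : ℝ) ^ (1 - 1 / p) * h ^ (-((d : ℝ) / p)) * C *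
          t ^ (-((d : ℝ) / p)) := by
        refine intervalIntegral.integral_mono_on_of_le_Ioo zero_le_one
          (Continuous.intervalIntegrable (by fun_prop) _ _)
          ((intervalIntegral.intervalIntegrable_rpow' hr).const_mul _) fun t ht => ?_
        refine (sum_integral_cubeMap_le hp hH hH0 hC hHi hHC s c (mul_pos ht.1 hh)
          fun i hi j hj hij => ?_).trans (le_of_eq ?_)
        · have hth : t * h ≤ h := mul_le_of_le_one_left hh.le ht.2.le
          exact (hdisj hi hj hij).mono (cube_subset_cube _ hth) (cube_subset_cube _ hth)
        · rw [Real.mul_rpow ht.1.le hh.le]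
          ring
    _ = _ := by
        rw [intervalIntegral.integral_const_mul, integral_rpow (Or.inl hr), Real.one_rpow,
          Real.zero_rpow (by linarith)]
        rw [sub_zero, mul_one_div]
        congr 1
        ring

/-- The error of the quadrature rule for a continuously differentiable function, in terms of the
`L^p` norm of its gradient. -/
theorem norm_sum_integral_sub_quad_le {p : ℝ} (hp : 1 ≤ p) (hdp : (d : ℝ) < p) {f : E d → ℂ}
    {f' : E d → E d →L[ℝ] ℂ} (hf : ∀ x, HasFDerivAt f (f' x) x) (hf' : Continuous f') {H : E d → ℝ}
    (hH : Continuous H) (hfH : ∀ x, ‖f' x‖ ≤ H x) {C : ℝ} (hC : 0 ≤ C)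
    (hHi : Integrable fun x => H x ^ p) (hHC : ∫ x, H x ^ p ≤ C ^ p) (R : ℕ) {s : ℕ} (hs : 0 < s) :
    ‖(∑ i ∈ boxIndex d (R * s), ∫ x in cube (latticePoint s i) (1 / s), f x) - quad R s f‖ ≤
      √d / s * (2 * R) ^ (d - d / p : ℝ) / (1 - d / p) * C := by
  have hp0 : 0 < p := by linarith
  have hdp1 : (d : ℝ) / p < 1 := (div_lt_one hp0).2 hdp
  have hs' : (0 : ℝ) < s := by exact_mod_cast hs
  have hh : (0 : ℝ) < 1 / s := by positivity
  have hH0 : ∀ x, 0 ≤ H x := fun x => (norm_nonneg _).trans (hfH x)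
  have hfc : Continuous f := continuous_iff_continuousAt.2 fun x => (hf x).continuousAt
  have hfcube : ∀ i : Fin d → ℤ, Continuous fun x : Fin d → ℝ =>
      f (cubeMap (latticePoint s i) (1 / s) x) := fun i => hfc.comp (continuous_cubeMap _ _)
  have iI : ∀ {F : Type} [NormedAddCommGroup F] {f : (Fin d → ℝ) → F}, Continuous f →
      IntegrableOn f (Icc 0 1) := fun hf => hf.continuousOn.integrableOn_compact isCompact_Icc
  have hdiff : (∑ i ∈ boxIndex d (R * s), ∫ x in cube (latticePoint s i) (1 / s), f x) -
      quad R s f =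
      (((1 / s : ℝ) ^ d : ℝ) : ℂ) * ∑ i ∈ boxIndex d (R * s), ∫ x in Icc (0 : Fin d → ℝ) 1,
        (f (cubeMap (latticePoint s i) (1 / s) x) - f (latticePoint s i)) := by
    have e1 : ∀ i : Fin d → ℤ, ∫ x in Icc (0 : Fin d → ℝ) 1,
        (f (cubeMap (latticePoint s i) (1 / s) x) - f (latticePoint s i)) =
        (∫ x in Icc (0 : Fin d → ℝ) 1, f (cubeMap (latticePoint s i) (1 / s) x)) -
          f (latticePoint s i) := fun i => by
      rw [integral_sub (iI (hfcube i)) (integrable_const _), integral_const, probReal_univ,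
        one_smul]
    rw [Finset.sum_congr rfl fun i _ => e1 i,
      Finset.sum_congr rfl fun i _ => setIntegral_cube (latticePoint s i) hh f, quad]
    rw [Finset.sum_sub_distrib, mul_sub]
    congr 1
    · rw [Finset.mul_sum]
      simp
    · refine congrArg₂ _ ?_ rfl
      simp
  rw [hdiff, norm_mul, Complex.norm_real, Real.norm_of_nonneg (by positivity)]
  have hsum : ‖∑ i ∈ boxIndex d (R * s), ∫ x in Icc (0 : Fin d → ℝ) 1,
        (f (cubeMap (latticePoint s i) (1 / s) x) - f (latticePoint s i))‖ ≤
      √d * (1 / s) * ∑ i ∈ boxIndex d (R * s), ∫ x in Icc (0 : Fin d → ℝ) 1,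
        ∫ t in (0 : ℝ)..1, H (cubeMap (latticePoint s i) (t * (1 / s)) x) := by
    rw [Finset.mul_sum]
    refine norm_sum_le_of_le _ fun i _ => ?_
    rw [← integral_const_mul]
    have hcont : Continuous fun x : Fin d → ℝ =>
        ∫ t in (0 : ℝ)..1, H (cubeMap (latticePoint s i) (t * (1 / s)) x) := by
      refine intervalIntegral.continuous_parametric_intervalIntegral_of_continuous' ?_ _ _
      have := PiLp.continuous_toLp 2 (fun _ : Fin d => ℝ)
      unfold cubeMap
      fun_prop
    have hint := iI hcont
    refine norm_integral_le_of_norm_le (Integrable.const_mul hint _) ?_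
    · refine (ae_restrict_iff' measurableSet_Icc).2 (Filter.Eventually.of_forall fun x hx => ?_)
      exact norm_cubeMap_sub_le hf hf' hH hfH _ hh.le hx
  have hmain := integral_sum_integral_cubeMap_le hp hdp hH hH0 hC hHi hHC (boxIndex d (R * s))
    (latticePoint s) hh fun i _ j _ hij => disjoint_cube_latticePoint hs hij
  calc (1 / s : ℝ) ^ d * ‖∑ i ∈ boxIndex d (R * s), ∫ x in Icc (0 : Fin d → ℝ) 1,
        (f (cubeMap (latticePoint s i) (1 / s) x) - f (latticePoint s i))‖
      ≤ (1 / s : ℝ) ^ d * (√d * (1 / s) * (((boxIndex d (R * s)).card : ℝ) ^ (1 - 1 / p) *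
          (1 / s : ℝ) ^ (-(d / p)) * C / (1 - d / p))) := by
        gcongr
        exact hsum.trans (by gcongr)
    _ = _ := by
        rw [card_boxIndex]
        push_cast
        have e1 : ((2 * (R * s : ℝ)) ^ d) ^ (1 - 1 / p) =
            (2 * R : ℝ) ^ (d - d / p : ℝ) * (s : ℝ) ^ (d - d / p : ℝ) := by
          rw [← Real.rpow_natCast, ← Real.rpow_mul (by positivity), ← mul_assoc,
            Real.mul_rpow (by positivity) (by positivity)]
          congr 2 <;> ring
        -- The powers of `s` from the cell volume, the number of points and Hölder's inequality
        -- cancel; only the `1 / s` from the length of the segments survives.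
        have e2 : (1 / s : ℝ) ^ d * ((s : ℝ) ^ (d - d / p : ℝ) * (1 / s : ℝ) ^ (-(d / p : ℝ))) = 1 := by
          rw [one_div, Real.inv_rpow hs'.le, ← Real.rpow_neg hs'.le, ← Real.rpow_add hs', neg_neg,
            sub_add_cancel, Real.rpow_natCast, inv_pow, inv_mul_cancel₀ (by positivity)]
        rw [e1]
        linear_combination (√d / s * (2 * R) ^ (d - d / p : ℝ) / (1 - d / p) * C) * e2

end quadrature

/-! ### Mollification -/

section mollification

open Set Filter Topology
open scoped Convolution

variable {d : ℕ}

/-- Jensen's inequality for the probability measure with density `φ`. -/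
theorem rpow_integral_mul_le {X : Type*} [MeasurableSpace X] {μ : Measure X} {φ g : X → ℝ} {p : ℝ}
    (hp : 1 ≤ p) (hφ0 : ∀ x, 0 ≤ φ x) (hφi : Integrable φ μ) (hφm : Measurable φ)
    (hφ1 : ∫ x, φ x ∂μ = 1) (hg0 : ∀ x, 0 ≤ g x) (hφg : Integrable (fun x => φ x * g x) μ)
    (hφgp : Integrable (fun x => φ x * g x ^ p) μ) :
    (∫ x, φ x * g x ∂μ) ^ p ≤ ∫ x, φ x * g x ^ p ∂μ := by
  have hp0 : 0 < p := by linarith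
  set ν : Measure X := μ.withDensity fun x => ENNReal.ofReal (φ x) with hν
  have hm : Measurable fun x => ENNReal.ofReal (φ x) := hφm.ennreal_ofReal
  have hlt : ∀ᵐ x ∂μ, ENNReal.ofReal (φ x) < ∞ := Eventually.of_forall fun _ => ENNReal.ofReal_lt_top
  have : IsProbabilityMeasure ν := by
    constructor
    rw [hν, withDensity_apply _ MeasurableSet.univ, Measure.restrict_univ,
      ← ofReal_integral_eq_lintegral_ofReal hφi (Eventually.of_forall hφ0), hφ1, ENNReal.ofReal_one]
  have e : ∀ f : X → ℝ, ∫ x, f x ∂ν = ∫ x, φ x * f x ∂μ := fun f => by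
    rw [hν, integral_withDensity_eq_integral_toReal_smul₀ hm.aemeasurable hlt]
    simp_rw [ENNReal.toReal_ofReal (hφ0 _), smul_eq_mul]
  have i : ∀ f : X → ℝ, Integrable (fun x => φ x * f x) μ → Integrable f ν := fun f hf => by
    rw [hν, integrable_withDensity_iff_integrable_smul' hm hlt]
    simpa only [ENNReal.toReal_ofReal (hφ0 _), smul_eq_mul] using hf
  rw [← e, ← e]
  exact (convexOn_rpow hp).map_integral_le (continuousOn_id.rpow_const fun _ _ => Or.inr hp0.le)
    isClosed_Ici (Eventually.of_forall hg0) (i _ hφg) (i _ hφgp)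

theorem locallyIntegrable_norm {F : Type*} [NormedAddCommGroup F] {g : E d → F}
    (hg : LocallyIntegrable g) : LocallyIntegrable fun x => ‖g x‖ := fun x => by
  obtain ⟨s, hs, h⟩ := hg x
  exact ⟨s, hs, h.norm⟩

/-- The mollification of the norm of `g`. -/
def mollifiedNorm {F : Type*} [NormedAddCommGroup F] (φ : E d → ℝ) (g : E d → F) : E d → ℝ :=
  φ ⋆[ContinuousLinearMap.lsmul ℝ ℝ, volume] fun x => ‖g x‖

theorem mollifiedNorm_eq {F : Type*} [NormedAddCommGroup F] (φ : E d → ℝ) (g : E d → F) (x : E d) :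
    mollifiedNorm φ g x = ∫ t, φ t * ‖g (x - t)‖ := rfl

theorem mollifiedNorm_eq_swap {F : Type*} [NormedAddCommGroup F] (φ : E d → ℝ) (g : E d → F)
    (x : E d) : mollifiedNorm φ g x = ∫ t, φ (x - t) * ‖g t‖ :=
  convolution_lsmul_swap

section young

variable {F : Type*} [NormedAddCommGroup F] {φ : E d → ℝ} {g : E d → F} {p : ℝ}

theorem continuous_mollifiedNorm (hφ : Continuous φ) (hφs : HasCompactSupport φ)
    (hg : LocallyIntegrable g) : Continuous (mollifiedNorm φ g) :=
  hφs.continuous_convolution_left _ hφ (locallyIntegrable_norm hg)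

theorem mollifiedNorm_nonneg (hφ0 : ∀ x, 0 ≤ φ x) (x : E d) : 0 ≤ mollifiedNorm φ g x := by
  rw [mollifiedNorm_eq]
  exact integral_nonneg fun t => mul_nonneg (hφ0 t) (norm_nonneg _)

/-- Young's inequality: by Jensen the `p`-th power of the mollification is at most the mollification
of the `p`-th power, and the latter has the same integral as the `p`-th power itself. -/
theorem integrable_mollifiedNorm_rpow (hp : 1 ≤ p) (hφ : Continuous φ) (hφs : HasCompactSupport φ)
    (hφ0 : ∀ x, 0 ≤ φ x) (hφ1 : ∫ x, φ x = 1) (hgl : LocallyIntegrable g)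
    (hgp : Integrable fun x => ‖g x‖ ^ p) :
    Integrable (fun x => mollifiedNorm φ g x ^ p) ∧
      ∫ x, mollifiedNorm φ g x ^ p ≤ ∫ x, ‖g x‖ ^ p := by
  have hp0 : 0 < p := by linarith
  have hφi : Integrable φ := hφ.integrable_of_hasCompactSupport hφs
  set Q : E d → ℝ := φ ⋆[ContinuousLinearMap.lsmul ℝ ℝ, volume] fun x => ‖g x‖ ^ p with hQ
  have hQi : Integrable Q := hφi.integrable_convolution _ hgp
  have hle : ∀ x, mollifiedNorm φ g x ^ p ≤ Q x := by
    intro x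
    have e1 := hφs.convolutionExists_left (ContinuousLinearMap.lsmul ℝ ℝ) hφ
      (locallyIntegrable_norm hgl) x
    have e2 := hφs.convolutionExists_left (ContinuousLinearMap.lsmul ℝ ℝ) hφ hgp.locallyIntegrable x
    exact rpow_integral_mul_le hp hφ0 hφi hφ.measurable hφ1 (fun t => norm_nonneg (g (x - t))) e1 e2
  have hQint : ∫ x, Q x = ∫ x, ‖g x‖ ^ p := by
    rw [hQ, integral_convolution _ hφi hgp, hφ1]
    simp
  have hc : Continuous fun x => mollifiedNorm φ g x ^ p :=
    (continuous_mollifiedNorm hφ hφs hgl).rpow_const fun _ => Or.inr hp0.le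
  have hnn : ∀ x, 0 ≤ mollifiedNorm φ g x ^ p := fun x =>
    Real.rpow_nonneg (mollifiedNorm_nonneg hφ0 x) p
  refine ⟨hQi.mono' hc.aestronglyMeasurable (Eventually.of_forall fun x => ?_), ?_⟩
  · rw [Real.norm_of_nonneg (hnn x)]
    exact hle x
  · rw [← hQint]
    exact integral_mono_of_nonneg (Eventually.of_forall hnn) hQi (Eventually.of_forall hle)

theorem eLpNorm_mollifiedNorm_le (hp : 1 ≤ p) (hφ : Continuous φ) (hφs : HasCompactSupport φ)
    (hφ0 : ∀ x, 0 ≤ φ x) (hφ1 : ∫ x, φ x = 1) (hg : MemLp g (ENNReal.ofReal p)) :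
    MemLp (mollifiedNorm φ g) (ENNReal.ofReal p) ∧
      eLpNorm (mollifiedNorm φ g) (ENNReal.ofReal p) volume ≤
        eLpNorm g (ENNReal.ofReal p) volume := by
  have hp0 : 0 < p := by linarith
  have hpE : ENNReal.ofReal p ≠ 0 := by simpa using hp0
  have hgl : LocallyIntegrable g := hg.locallyIntegrable (by simpa using hp)
  have hgi := hg.integrable_norm_rpow hpE ENNReal.ofReal_ne_top
  rw [ENNReal.toReal_ofReal hp0.le] at hgi
  obtain ⟨h1, h2⟩ := integrable_mollifiedNorm_rpow hp hφ hφs hφ0 hφ1 hgl hgi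
  have hn : ∀ x, ‖mollifiedNorm φ g x‖ = mollifiedNorm φ g x := fun x =>
    Real.norm_of_nonneg (mollifiedNorm_nonneg hφ0 x)
  have hm : MemLp (mollifiedNorm φ g) (ENNReal.ofReal p) := by
    rw [← integrable_norm_rpow_iff (continuous_mollifiedNorm hφ hφs hgl).aestronglyMeasurable hpE
      ENNReal.ofReal_ne_top, ENNReal.toReal_ofReal hp0.le]
    simpa only [hn] using h1
  refine ⟨hm, ?_⟩
  rw [hm.eLpNorm_eq_integral_rpow_norm hpE ENNReal.ofReal_ne_top,
    hg.eLpNorm_eq_integral_rpow_norm hpE ENNReal.ofReal_ne_top, ENNReal.toReal_ofReal hp0.le]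
  simp only [hn]
  refine ENNReal.ofReal_le_ofReal (Real.rpow_le_rpow ?_ h2 (by positivity))
  exact integral_nonneg fun x => Real.rpow_nonneg (mollifiedNorm_nonneg hφ0 x) p

end young

theorem integral_rpow_le_of_eLpNorm_le {p : ℝ} (hp : 1 ≤ p) {H : E d → ℝ} (hH0 : ∀ x, 0 ≤ H x)
    (hH : MemLp H (ENNReal.ofReal p)) {C : ℝ} (hC : 0 ≤ C)
    (h : eLpNorm H (ENNReal.ofReal p) volume ≤ ENNReal.ofReal C) :
    Integrable (fun x => H x ^ p) ∧ ∫ x, H x ^ p ≤ C ^ p := by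
  have hp0 : 0 < p := by linarith
  have hpE : ENNReal.ofReal p ≠ 0 := by simpa using hp0
  have hi := hH.integrable_norm_rpow hpE ENNReal.ofReal_ne_top
  rw [hH.eLpNorm_eq_integral_rpow_norm hpE ENNReal.ofReal_ne_top,
    ENNReal.ofReal_le_ofReal_iff hC] at h
  simp only [ENNReal.toReal_ofReal hp0.le, Real.norm_of_nonneg (hH0 _)] at hi h
  refine ⟨hi, ?_⟩
  have hnn : 0 ≤ ∫ x, H x ^ p := integral_nonneg fun x => Real.rpow_nonneg (hH0 x) p
  rwa [Real.rpow_inv_le_iff_of_pos hnn hC hp0] at h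

/-- The mollification of `V`. -/
def mollify (φ : E d → ℝ) (V : E d → ℝ) : E d → ℝ :=
  φ ⋆[ContinuousLinearMap.lsmul ℝ ℝ, volume] V

theorem mollify_eq (φ V : E d → ℝ) (x : E d) : mollify φ V x = ∫ t, φ t * V (x - t) := rfl

theorem abs_mollify_le_mollifiedNorm {φ V : E d → ℝ} (hφ0 : ∀ x, 0 ≤ φ x) (x : E d) :
    |mollify φ V x| ≤ mollifiedNorm φ V x := by
  rw [mollify_eq, mollifiedNorm_eq, ← Real.norm_eq_abs]
  refine (norm_integral_le_integral_norm _).trans (le_of_eq ?_)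
  simp_rw [norm_mul, Real.norm_of_nonneg (hφ0 _)]

theorem abs_mollify_le {φ V : E d → ℝ} (hφi : Integrable φ) (hφ0 : ∀ x, 0 ≤ φ x)
    (hφ1 : ∫ x, φ x = 1) {M : ℝ} (hV : ∀ x, |V x| ≤ M) (x : E d) : |mollify φ V x| ≤ M := by
  rw [mollify_eq, ← Real.norm_eq_abs]
  refine (norm_integral_le_of_norm_le (hφi.mul_const M) (Eventually.of_forall fun t => ?_)).trans
    (le_of_eq ?_)
  · rw [norm_mul, Real.norm_of_nonneg (hφ0 t)]
    exact mul_le_mul_of_nonneg_left (hV _) (hφ0 t)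
  · rw [integral_mul_const, hφ1, one_mul]

theorem hasFDerivAt_mollify {φ V : E d → ℝ} (hφ : ContDiff ℝ (⊤ : ℕ∞) φ)
    (hφs : HasCompactSupport φ) (hV : LocallyIntegrable V) (x : E d) :
    HasFDerivAt (mollify φ V) (fderiv ℝ (mollify φ V) x) x :=
  ((hφs.contDiff_convolution_left (n := 1) (ContinuousLinearMap.lsmul ℝ ℝ) (hφ.of_le (by simp))
    hV).differentiable one_ne_zero x).hasFDerivAt

theorem continuous_fderiv_mollify {φ V : E d → ℝ} (hφ : ContDiff ℝ (⊤ : ℕ∞) φ)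
    (hφs : HasCompactSupport φ) (hV : LocallyIntegrable V) :
    Continuous (fderiv ℝ (mollify φ V)) :=
  (hφs.contDiff_convolution_left (n := 1) (ContinuousLinearMap.lsmul ℝ ℝ) (hφ.of_le (by simp))
    hV).continuous_fderiv one_ne_zero

/-- The derivative of the convolution falls on `φ`. The weak gradient is then tested with `y ↦ φ (x
- y)`, whose derivative carries a sign that cancels the one from integration by parts. -/
theorem fderiv_mollify_single {φ V : E d → ℝ} {G : E d → E d} (hφ : ContDiff ℝ (⊤ : ℕ∞) φ)
    (hφs : HasCompactSupport φ) (hVG : HasWeakGradient V G) (x : E d) (l : Fin d) :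
    fderiv ℝ (mollify φ V) x (EuclideanSpace.single l 1) = ∫ y, G y l * φ (x - y) := by
  have h1 := hφs.hasFDerivAt_convolution_left (ContinuousLinearMap.lsmul ℝ ℝ)
    (hφ.of_le (by simp) : ContDiff ℝ 1 φ) hVG.1 x
  have hex : ConvolutionExistsAt (fderiv ℝ φ) V x ((ContinuousLinearMap.lsmul ℝ ℝ).precompL (E d))
      volume := (hφs.fderiv ℝ).convolutionExists_left _ (hφ.continuous_fderiv (by simp)) hVG.1 x
  have e1 : fderiv ℝ (mollify φ V) x (EuclideanSpace.single l 1) =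
      ∫ y, V y * fderiv ℝ φ (x - y) (EuclideanSpace.single l 1) := by
    have h2 : fderiv ℝ (mollify φ V) x = _ := h1.fderiv
    rw [h2, convolution_eq_swap, ContinuousLinearMap.integral_apply hex.integrable_swap]
    refine integral_congr_ae (Eventually.of_forall fun y => ?_)
    simp [mul_comm]
  have h3 : ContDiff ℝ (⊤ : ℕ∞) fun y => φ (x - y) := hφ.comp (contDiff_const.sub contDiff_id)
  have h4 : HasCompactSupport fun y => φ (x - y) :=
    hφs.comp_homeomorph (Homeomorph.subLeft x)
  have h5 := hVG.2.2 _ h3 h4 l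
  have h6 : ∀ y, fderiv ℝ (fun y => φ (x - y)) y = -fderiv ℝ φ (x - y) := fun y => by
    have e2 : HasFDerivAt (fun y : E d => x - y) (-ContinuousLinearMap.id ℝ (E d)) y := by
      simpa using (hasFDerivAt_id y).const_sub x
    have e3 := (((hφ.differentiable (by simp)) (x - y)).hasFDerivAt.comp y e2).fderiv
    refine e3.trans ?_
    ext v
    simp
  simp_rw [h6] at h5
  rw [e1]
  simp only [_root_.neg_apply, mul_neg, integral_neg] at h5
  exact neg_injective h5

/-- The derivative in direction `v` is the integral of `⟨v, φ (x - y) G y⟩`, so Cauchy–Schwarz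
yields the Euclidean length of `G` without a dimensional factor. -/
theorem norm_fderiv_mollify_le {φ V : E d → ℝ} {G : E d → E d} (hφ : ContDiff ℝ (⊤ : ℕ∞) φ)
    (hφs : HasCompactSupport φ) (hφ0 : ∀ x, 0 ≤ φ x) (hVG : HasWeakGradient V G) (x : E d) :
    ‖fderiv ℝ (mollify φ V) x‖ ≤ mollifiedNorm φ G x := by
  refine ContinuousLinearMap.opNorm_le_bound _ (mollifiedNorm_nonneg hφ0 x) fun v => ?_
  have hex : Integrable fun y => φ (x - y) • G y :=
    (hφs.convolutionExists_left (ContinuousLinearMap.lsmul ℝ ℝ) hφ.continuous hVG.2.1 x).integrable_swap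
  have hv : v = ∑ l, v l • EuclideanSpace.single l (1 : ℝ) := by
    ext i
    simp [Finset.sum_apply, Pi.single_apply]
  have e1 : fderiv ℝ (mollify φ V) x v = ∫ y, inner ℝ v (φ (x - y) • G y) := by
    have hl : ∀ l, Integrable fun y => G y l * φ (x - y) := fun l => by
      have := (EuclideanSpace.proj (𝕜 := ℝ) l).integrable_comp hex
      simpa [mul_comm] using this
    have : ∀ y, inner ℝ v (φ (x - y) • G y) = ∑ l, v l * (G y l * φ (x - y)) := fun y => by
      rw [PiLp.inner_apply]
      refine Finset.sum_congr rfl fun l _ => ?_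
      simp
      ring
    simp_rw [this]
    rw [integral_finsetSum _ fun l _ => (hl l).const_mul _]
    conv_lhs => rw [hv]
    rw [map_sum]
    refine Finset.sum_congr rfl fun l _ => ?_
    rw [map_smul, fderiv_mollify_single hφ hφs hVG, smul_eq_mul, integral_const_mul]
  rw [e1, mollifiedNorm_eq_swap, ← integral_mul_const]
  refine norm_integral_le_of_norm_le ?_ (Eventually.of_forall fun y => ?_)
  · refine Integrable.mul_const ?_ _
    refine hex.norm.congr (Eventually.of_forall fun y => ?_)
    simp [norm_smul, Real.norm_of_nonneg (hφ0 _)]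
  · refine (norm_inner_le_norm _ _).trans (le_of_eq ?_)
    rw [norm_smul, Real.norm_of_nonneg (hφ0 _)]
    ring

end mollification

/-! ### The quadrature error for the product of a smooth function and `W` -/

section quadratureW

open Set Filter Topology
open scoped Convolution

variable {d : ℕ} {p M : ℝ} {V : E d → ℝ} {lam : ℂ}

theorem SobolevNormLE.exists_gradient (hp : 0 < p) (h : SobolevNormLE p M V) :
    ∃ G : E d → E d, HasWeakGradient V G ∧ MemLp V (ENNReal.ofReal p) ∧
      MemLp G (ENNReal.ofReal p) ∧ eLpNorm V (ENNReal.ofReal p) volume ≤ ENNReal.ofReal M ∧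
      eLpNorm G (ENNReal.ofReal p) volume ≤ ENNReal.ofReal M := by
  obtain ⟨G, h1, h2, h3, h4⟩ := h
  have key : ∀ a b : ℝ, 0 ≤ a → 0 ≤ b → a ≤ (a ^ p + b ^ p) ^ (1 / p) := fun a b ha hb => by
    calc a = (a ^ p) ^ (1 / p) := by
          rw [← Real.rpow_mul ha, mul_one_div_cancel hp.ne', Real.rpow_one]
      _ ≤ _ := Real.rpow_le_rpow (Real.rpow_nonneg ha p)
          (le_add_of_nonneg_right (Real.rpow_nonneg hb p)) (by positivity)
  refine ⟨G, h1, h2, h3, ?_, ?_⟩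
  · rw [← ENNReal.ofReal_toReal h2.eLpNorm_ne_top]
    exact ENNReal.ofReal_le_ofReal
      ((key _ _ ENNReal.toReal_nonneg ENNReal.toReal_nonneg).trans h4)
  · rw [← ENNReal.ofReal_toReal h3.eLpNorm_ne_top]
    rw [add_comm] at h4
    exact ENNReal.ofReal_le_ofReal
      ((key _ _ ENNReal.toReal_nonneg ENNReal.toReal_nonneg).trans h4)

theorem hasFDerivAt_W {V : E d → ℝ} {V' : E d →L[ℝ] ℝ} {x : E d} (lam : ℂ)
    (h : HasFDerivAt V V' x) :
    HasFDerivAt (W lam V) (V'.smulRight (2 * ((V x : ℂ) - lam))) x := by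
  have h1 : HasDerivAt (fun t : ℝ => (t : ℂ)) 1 (V x) := Complex.ofRealCLM.hasDerivAt
  have h2 : HasDerivAt (fun t : ℝ => (t : ℂ) ^ 2 - 2 * lam * (t : ℂ)) (2 * ((V x : ℂ) - lam)) (V x) :=
    ((h1.pow 2).sub (h1.const_mul (2 * lam))).congr_deriv (by push_cast; ring)
  refine (h2.hasFDerivAt.comp x h).congr_fderiv ?_
  ext v
  simp

theorem norm_W_le_of_abs_le {V : E d → ℝ} (hM : 0 ≤ M) (lam : ℂ) {x : E d} (h : |V x| ≤ M) :
    ‖W lam V x‖ ≤ M * (M + 2 * ‖lam‖) :=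
  (norm_W_le lam V x).trans (by gcongr)

/-- The quadrature error for `B * W` with a mollified potential. -/
theorem norm_sum_integral_mollify_sub_quad_le (hp : 1 ≤ p) (hdp : (d : ℝ) < p)
    (hV : Admissible p M V) {G : E d → E d} (hVG : HasWeakGradient V G)
    (hVp : MemLp V (ENNReal.ofReal p)) (hGp : MemLp G (ENNReal.ofReal p))
    (hVM : eLpNorm V (ENNReal.ofReal p) volume ≤ ENNReal.ofReal M)
    (hGM : eLpNorm G (ENNReal.ofReal p) volume ≤ ENNReal.ofReal M)
    {φ : E d → ℝ} (hφ : ContDiff ℝ (⊤ : ℕ∞) φ) (hφs : HasCompactSupport φ) (hφ0 : ∀ x, 0 ≤ φ x)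
    (hφ1 : ∫ x, φ x = 1) {B : E d → ℂ} {B' : E d → E d →L[ℝ] ℂ}
    (hB : ∀ x, HasFDerivAt B (B' x) x) (hB' : Continuous B') {β γ : ℝ} (hβ : 0 ≤ β) (hγ : 0 ≤ γ)
    (hBβ : ∀ x, ‖B x‖ ≤ β) (hBγ : ∀ x, ‖B' x‖ ≤ γ * β) (R : ℕ) {s : ℕ} (hs : 0 < s) :
    ‖(∑ i ∈ boxIndex d (R * s), ∫ x in cube (latticePoint s i) (1 / s),
        B x * W lam (mollify φ V) x) - quad R s fun x => B x * W lam (mollify φ V) x‖ ≤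
      √d / s * (2 * R) ^ (d - d / p : ℝ) / (1 - d / p) *
        (β * M * (γ * (M + 2 * ‖lam‖) + 2 * (M + ‖lam‖))) := by
  have hM := hV.nonneg
  have hφi : Integrable φ := hφ.continuous.integrable_of_hasCompactSupport hφs
  set v := mollify φ V with hv
  have hvM : ∀ x, |v x| ≤ M := abs_mollify_le hφi hφ0 hφ1 hV.abs_le
  have hv' : ∀ x, HasFDerivAt v (fderiv ℝ v x) x := hasFDerivAt_mollify hφ hφs hVG.1
  have hv'c : Continuous (fderiv ℝ v) := continuous_fderiv_mollify hφ hφs hVG.1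
  have hvc : Continuous v := continuous_iff_continuousAt.2 fun x => (hv' x).continuousAt
  have hBc : Continuous B := continuous_iff_continuousAt.2 fun x => (hB x).continuousAt
  have hWc : Continuous (W lam v) := continuous_W hvc
  -- `c1` and `c2` weigh the two terms of the product rule. When the derivative falls on `B`, one
  -- factor `|v|` of `W` is kept, so that the majorant lies in `L^p`; when it falls on `W`, it
  -- contributes `|∇v|`. Mollified norms make the majorant continuous.
  set c1 : ℝ := γ * β * (M + 2 * ‖lam‖) with hc1
  set c2 : ℝ := β * (2 * (M + ‖lam‖)) with hc2
  have hc10 : 0 ≤ c1 := by positivity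
  have hc20 : 0 ≤ c2 := by positivity
  set N1 := mollifiedNorm φ V with hN1
  set N2 := mollifiedNorm φ G with hN2
  obtain ⟨m1, l1⟩ := eLpNorm_mollifiedNorm_le hp hφ.continuous hφs hφ0 hφ1 hVp
  obtain ⟨m2, l2⟩ := eLpNorm_mollifiedNorm_le hp hφ.continuous hφs hφ0 hφ1 hGp
  have hN1c : Continuous N1 := continuous_mollifiedNorm hφ.continuous hφs hVG.1
  have hN2c : Continuous N2 := continuous_mollifiedNorm hφ.continuous hφs hVG.2.1
  have hN10 : ∀ x, 0 ≤ N1 x := mollifiedNorm_nonneg hφ0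
  have hN20 : ∀ x, 0 ≤ N2 x := mollifiedNorm_nonneg hφ0
  have hHm1 : MemLp (fun x => c1 * N1 x) (ENNReal.ofReal p) := m1.const_mul c1
  have hHm2 : MemLp (fun x => c2 * N2 x) (ENNReal.ofReal p) := m2.const_mul c2
  have hH0 : ∀ x, 0 ≤ c1 * N1 x + c2 * N2 x := fun x =>
    add_nonneg (mul_nonneg hc10 (hN10 x)) (mul_nonneg hc20 (hN20 x))
  have hHle : eLpNorm (fun x => c1 * N1 x + c2 * N2 x) (ENNReal.ofReal p) volume ≤
      ENNReal.ofReal (c1 * M + c2 * M) := by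
    refine (eLpNorm_add_le hHm1.1 hHm2.1 (by simpa using hp)).trans ?_
    rw [ENNReal.ofReal_add (by positivity) (by positivity), ENNReal.ofReal_mul hc10,
      ENNReal.ofReal_mul hc20]
    refine add_le_add ?_ ?_
    · have : (fun x => c1 * N1 x) = c1 • N1 := rfl
      rw [this, eLpNorm_const_smul, Real.enorm_of_nonneg hc10]
      gcongr
      exact l1.trans hVM
    · have : (fun x => c2 * N2 x) = c2 • N2 := rfl
      rw [this, eLpNorm_const_smul, Real.enorm_of_nonneg hc20]
      gcongr
      exact l2.trans hGM
  obtain ⟨hHi, hHC⟩ := integral_rpow_le_of_eLpNorm_le hp hH0 (hHm1.add hHm2)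
    (by positivity : 0 ≤ c1 * M + c2 * M) hHle
  have hmain := norm_sum_integral_sub_quad_le hp hdp (f := fun x => B x * W lam v x)
    (f' := fun x => B x • (fderiv ℝ v x).smulRight (2 * ((v x : ℂ) - lam)) + W lam v x • B' x)
    (H := fun x => c1 * N1 x + c2 * N2 x) (C := c1 * M + c2 * M)
    (fun x => (hB x).mul (hasFDerivAt_W lam (hv' x))) ?_ (by fun_prop) ?_ (by positivity) hHi hHC R hs
  · refine hmain.trans (le_of_eq ?_)
    rw [hc1, hc2]
    ring
  · have h1 : Continuous fun x => (fderiv ℝ v x).smulRight (2 * ((v x : ℂ) - lam)) :=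
      ((ContinuousLinearMap.smulRightL ℝ (E d) ℂ).continuous.comp hv'c).clm_apply (by fun_prop)
    exact (hBc.smul h1).add (hWc.smul hB')
  · intro x
    have hvN : |v x| ≤ N1 x := abs_mollify_le_mollifiedNorm hφ0 x
    refine (norm_add_le _ _).trans ?_
    rw [add_comm]
    refine add_le_add ?_ ?_
    · rw [norm_smul]
      calc ‖W lam v x‖ * ‖B' x‖ ≤ (N1 x * (M + 2 * ‖lam‖)) * (γ * β) := by
            have := hBγ x
            have h3 := hvM x
            have h4 := hN10 x
            have h5 := norm_W_le lam v x
            gcongr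
            exact h5.trans (by gcongr)
        _ = c1 * N1 x := by rw [hc1]; ring
    · rw [norm_smul, ContinuousLinearMap.norm_smulRight_apply]
      have h1 : ‖2 * ((v x : ℂ) - lam)‖ ≤ 2 * (M + ‖lam‖) := by
        rw [norm_mul, Complex.norm_ofNat]
        gcongr
        refine (norm_sub_le _ _).trans ?_
        rw [Complex.norm_real, Real.norm_eq_abs]
        gcongr
        exact hvM x
      have h2 := norm_fderiv_mollify_le hφ hφs hφ0 hVG x
      have h3 := hBβ x
      have h4 := hN20 x
      calc ‖B x‖ * (‖fderiv ℝ v x‖ * ‖2 * ((v x : ℂ) - lam)‖)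
          ≤ β * (N2 x * (2 * (M + ‖lam‖))) := by gcongr
        _ = c2 * N2 x := by rw [hc2]; ring

/-- The quadrature error for `B * W`. -/
theorem norm_sum_integral_mul_W_sub_quad_le (hp : 1 ≤ p) (hdp : (d : ℝ) < p)
    (hV : Admissible p M V) {B : E d → ℂ} {B' : E d → E d →L[ℝ] ℂ}
    (hB : ∀ x, HasFDerivAt B (B' x) x) (hB' : Continuous B') {β γ : ℝ} (hβ : 0 ≤ β) (hγ : 0 ≤ γ)
    (hBβ : ∀ x, ‖B x‖ ≤ β) (hBγ : ∀ x, ‖B' x‖ ≤ γ * β) (R : ℕ) {s : ℕ} (hs : 0 < s) :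
    ‖(∑ i ∈ boxIndex d (R * s), ∫ x in cube (latticePoint s i) (1 / s),
        B x * W lam V x) - quad R s fun x => B x * W lam V x‖ ≤
      √d / s * (2 * R) ^ (d - d / p : ℝ) / (1 - d / p) *
        (β * M * (γ * (M + 2 * ‖lam‖) + 2 * (M + ‖lam‖))) := by
  have hM := hV.nonneg
  obtain ⟨G, hVG, hVp, hGp, hVM, hGM⟩ := hV.sobolev.exists_gradient (by linarith : 0 < p)
  let φ : ℕ → ContDiffBump (0 : E d) := fun k =>
    ⟨1 / (2 * ((k : ℝ) + 1)), 1 / ((k : ℝ) + 1), by positivity, by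
      apply one_div_lt_one_div_of_lt <;> [positivity; linarith [(Nat.cast_nonneg k : (0 : ℝ) ≤ k)]]⟩
  have hφ : Tendsto (fun k => (φ k).rOut) atTop (𝓝 0) := tendsto_one_div_add_atTop_nhds_zero_nat
  have hBc : Continuous B := continuous_iff_continuousAt.2 fun x => (hB x).continuousAt
  set v : ℕ → E d → ℝ := fun k => mollify ((φ k).normed volume) V with hv
  -- Continuity of `V` gives convergence at every point. The Riemann sum reads point values, so
  -- convergence almost everywhere would not do.
  have hlim : ∀ x, Tendsto (fun k => v k x) atTop (𝓝 (V x)) := fun x =>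
    ContDiffBump.convolution_tendsto_right_of_continuous hφ hV.continuous x
  have hflim : ∀ x, Tendsto (fun k => B x * W lam (v k) x) atTop (𝓝 (B x * W lam V x)) := fun x => by
    have : Continuous fun t : ℝ => B x * ((t : ℂ) ^ 2 - 2 * lam * (t : ℂ)) := by fun_prop
    exact (this.tendsto (V x)).comp (hlim x)
  have hvM : ∀ k x, |v k x| ≤ M := fun k =>
    abs_mollify_le (φ k).integrable_normed (φ k).nonneg_normed (φ k).integral_normed hV.abs_le
  have hvc : ∀ k, Continuous (v k) := fun k => continuous_iff_continuousAt.2 fun x =>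
    (hasFDerivAt_mollify (φ k).contDiff_normed (φ k).hasCompactSupport_normed hVG.1 x).continuousAt
  have hint : ∀ i, Tendsto (fun k => ∫ x in cube (latticePoint s i) (1 / s), B x * W lam (v k) x)
      atTop (𝓝 (∫ x in cube (latticePoint s i) (1 / s), B x * W lam V x)) := by
    intro i
    refine tendsto_integral_of_dominated_convergence (fun _ => β * (M * (M + 2 * ‖lam‖)))
      (fun k => (hBc.mul (continuous_W (hvc k))).aestronglyMeasurable)
      (integrableOn_cube continuous_const _ _) (fun k => Eventually.of_forall fun x => ?_)
      (Eventually.of_forall hflim)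
    rw [norm_mul]
    exact mul_le_mul (hBβ x) (norm_W_le_of_abs_le hM lam (hvM k x)) (norm_nonneg _) hβ
  have hquad : Tendsto (fun k => quad R s fun x => B x * W lam (v k) x) atTop
      (𝓝 (quad R s fun x => B x * W lam V x)) :=
    (tendsto_finsetSum _ fun i _ => hflim _).const_mul _
  refine le_of_tendsto ((tendsto_finsetSum _ fun i _ => hint i).sub hquad).norm
    (Eventually.of_forall fun k => ?_)
  exact norm_sum_integral_mollify_sub_quad_le hp hdp hV hVG hVp hGp hVM hGM
    (φ k).contDiff_normed (φ k).hasCompactSupport_normed (φ k).nonneg_normed (φ k).integral_normed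
    hB hB' hβ hγ hBβ hBγ R hs

end quadratureW

/-! ### The basis functions and their approximate images in the frequency variable -/

section frequency

open Set

variable {d : ℕ}

theorem integral_indicator_comp_smul {F : Type*} [NormedAddCommGroup F] [NormedSpace ℝ F]
    {s : Set (E d)} (hs : MeasurableSet s) (f : E d → F) :
    ∫ y, s.indicator f ((2 * Real.pi) • y) = ((2 * Real.pi) ^ d)⁻¹ • ∫ ξ in s, f ξ := by
  have h := Measure.integral_comp_smul_of_nonneg (volume : Measure (E d)) (s.indicator f)
    (2 * Real.pi) (hR := by positivity)
  rw [finrank_euclideanSpace_fin, integral_indicator hs] at h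
  exact h

theorem volume_real_scaledCube {n : ℕ} (hn : 0 < n) (κ : Fin d → ℤ) :
    volume.real (scaledCube (d := d) n κ) = ((2 * Real.pi * n) ^ d)⁻¹ := by
  have hn' : (0 : ℝ) < n := by exact_mod_cast hn
  have h := integral_indicator_comp_smul (measurableSet_cube (latticePoint (d := d) n κ) (1 / n))
    (fun _ => (1 : ℝ))
  have e : ∀ y : E d, (cube (latticePoint n κ) (1 / n)).indicator (fun _ => (1 : ℝ))
      ((2 * Real.pi) • y) = (scaledCube n κ).indicator (fun _ => (1 : ℝ)) y := fun y => rfl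
  simp_rw [e] at h
  rw [integral_indicator (measurableSet_scaledCube n κ), setIntegral_const, setIntegral_const,
    volume_real_cube _ (by positivity)] at h
  simp only [smul_eq_mul, mul_one] at h
  rw [h, mul_pow _ (n : ℝ), mul_inv, one_div, inv_pow (n : ℝ)]

theorem disjoint_scaledCube {n : ℕ} (hn : 0 < n) {κ κ' : Fin d → ℤ} (h : κ ≠ κ') :
    Disjoint (scaledCube (d := d) n κ) (scaledCube n κ') :=
  (disjoint_cube_latticePoint hn h).preimage fun y => (2 * Real.pi) • y

/-- The function whose Fourier transform is the basis function. -/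
def bump (n : ℕ) (κ : Fin d → ℤ) : E d → ℂ :=
  (scaledCube n κ).indicator fun _ => (((2 * Real.pi * n) ^ ((d : ℝ) / 2) : ℝ) : ℂ)

theorem memLp_bump (n : ℕ) (κ : Fin d → ℤ) (q : ℝ≥0∞) : MemLp (bump (d := d) n κ) q :=
  memLp_indicator_const q (measurableSet_scaledCube n κ) _ (Or.inr (volume_scaledCube_ne_top n κ))

theorem basisFun_eq (n : ℕ) (κ : Fin d → ℤ) :
    basisFun n κ = (𝓕 ((memLp_bump n κ 2).toLp (bump n κ)) : L2 d) := rfl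

theorem fourierInv_basisFun (n : ℕ) (κ : Fin d → ℤ) :
    (𝓕⁻ (basisFun n κ) : L2 d) = (memLp_bump n κ 2).toLp (bump n κ) := by
  rw [basisFun_eq, FourierTransform.fourierInv_fourier_eq]

theorem amplitude_mul_self (n : ℕ) :
    (2 * Real.pi * n) ^ ((d : ℝ) / 2) * (2 * Real.pi * n) ^ ((d : ℝ) / 2) =
      (2 * Real.pi * n) ^ d := by
  rw [← Real.rpow_add_of_nonneg (by positivity) (by positivity) (by positivity), add_halves,
    Real.rpow_natCast]

/-- By Plancherel this concerns normalized indicators of disjoint cubes. -/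
theorem orthonormal_basisFun {n : ℕ} (hn : 0 < n) :
    Orthonormal ℂ (basisFun (d := d) n) := by
  have hn' : (0 : ℝ) < n := by exact_mod_cast hn
  rw [orthonormal_iff_ite]
  intro κ κ'
  have hA := amplitude_mul_self (d := d) n
  have e : (inner ℂ (basisFun (d := d) n κ) (basisFun n κ') : ℂ) =
      ∫ y, inner ℂ (bump n κ y) (bump (d := d) n κ' y) := by
    rw [basisFun_eq, basisFun_eq, Lp.inner_fourier_eq, L2.inner_def]
    refine integral_congr_ae ?_
    filter_upwards [(memLp_bump n κ 2).coeFn_toLp, (memLp_bump n κ' 2).coeFn_toLp] with y h1 h2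
    rw [h1, h2]
  rw [e]
  split_ifs with h
  · subst h
    have : ∀ y, inner ℂ (bump n κ y) (bump (d := d) n κ y) =
        (scaledCube n κ).indicator (fun _ => (((2 * Real.pi * n) ^ d : ℝ) : ℂ)) y := fun y => by
      unfold bump
      by_cases hy : y ∈ scaledCube n κ
      · rw [indicator_of_mem hy, indicator_of_mem hy, ← hA, RCLike.inner_apply, Complex.conj_ofReal,
          Complex.ofReal_mul]
      · rw [indicator_of_notMem hy, indicator_of_notMem hy]
        simp
    simp_rw [this]
    rw [integral_indicator (measurableSet_scaledCube n κ), setIntegral_const,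
      volume_real_scaledCube hn, Complex.real_smul, ← Complex.ofReal_mul,
      inv_mul_cancel₀ (by positivity), Complex.ofReal_one]
  · have : ∀ y, inner ℂ (bump n κ y) (bump (d := d) n κ' y) = 0 := fun y => by
      unfold bump
      by_cases hy : y ∈ scaledCube n κ
      · have hy' : y ∉ scaledCube n κ' := Set.disjoint_left.1 (disjoint_scaledCube hn h) hy
        rw [indicator_of_notMem hy', inner_zero_right]
      · rw [indicator_of_notMem hy, inner_zero_left]
    simp_rw [this, integral_zero]

/-- This `L¹` norm bounds the Fourier transform uniformly. In a product of two such transforms it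
produces the power `n^(-d)` that the factor `n^(1-d)` in `paramS` takes into account. -/
theorem integral_norm_bump {n : ℕ} (hn : 0 < n) (κ : Fin d → ℤ) :
    ∫ y, ‖bump (d := d) n κ y‖ = (2 * Real.pi * n) ^ (-((d : ℝ) / 2)) := by
  have hn' : (0 : ℝ) < n := by exact_mod_cast hn
  have hpos : (0 : ℝ) < 2 * Real.pi * n := by positivity
  have : ∀ y, ‖bump (d := d) n κ y‖ =
      (scaledCube n κ).indicator (fun _ => (2 * Real.pi * n) ^ ((d : ℝ) / 2)) y := fun y => by
    rw [bump, norm_indicator_eq_indicator_norm]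
    simp only [Complex.norm_real, Real.norm_of_nonneg (Real.rpow_nonneg hpos.le _)]
  simp_rw [this]
  rw [integral_indicator (measurableSet_scaledCube n κ), setIntegral_const,
    volume_real_scaledCube hn, smul_eq_mul, ← amplitude_mul_self, mul_inv, mul_assoc,
    inv_mul_cancel₀ (by positivity), mul_one, Real.rpow_neg hpos.le]

/-- The subcubes of the cube with index `κ`, in Mathlib's frequency variable. -/
def subCube (n N : ℕ) (κ : Fin d → ℤ) (t : Fin d → Fin N) : Set (E d) :=
  {y | (2 * Real.pi) • y ∈ cube (subPoint n N κ t) (1 / (N * n))}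

theorem subPoint_eq (n N : ℕ) (hN : 0 < N) (κ : Fin d → ℤ) (t : Fin d → Fin N) :
    subPoint n N κ t = latticePoint (N * n) fun l => N * κ l + (t l : ℕ) := by
  have hN' : (N : ℝ) ≠ 0 := by exact_mod_cast hN.ne'
  ext l
  simp only [subPoint, latticePoint]
  push_cast
  rw [add_div, mul_div_mul_left _ _ hN']

theorem mem_subCube_iff {n N : ℕ} (hn : 0 < n) (hN : 0 < N) (κ : Fin d → ℤ) (t : Fin d → Fin N)
    (y : E d) : y ∈ subCube n N κ t ↔
      (fun l => N * κ l + ((t l : ℕ) : ℤ)) = fun l => ⌊(N * n : ℕ) * ((2 * Real.pi) • y) l⌋ := by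
  rw [← mem_cube_latticePoint_iff (Nat.mul_pos hN hn), ← subPoint_eq n N hN, Nat.cast_mul]
  rfl

theorem measurableSet_subCube (n N : ℕ) (κ : Fin d → ℤ) (t : Fin d → Fin N) :
    MeasurableSet (subCube n N κ t) :=
  (measurable_const_smul (2 * Real.pi)) (measurableSet_cube _ _)

theorem subCube_subset {n N : ℕ} (hn : 0 < n) (hN : 0 < N) (κ : Fin d → ℤ) (t : Fin d → Fin N) :
    subCube n N κ t ⊆ scaledCube n κ := by
  intro y hy l
  have hN' : (0 : ℝ) < N := by exact_mod_cast hN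
  have hn' : (0 : ℝ) < n := by exact_mod_cast hn
  have h1 := (hy l).1
  have h2 := (hy l).2
  simp only [subPoint, latticePoint] at h1 h2 ⊢
  have h3 : (0 : ℝ) ≤ ((t l : ℕ) : ℝ) / (N * n) := by positivity
  have h4 : ((t l : ℕ) : ℝ) / (N * n) + 1 / (N * n) ≤ 1 / n := by
    have : ((t l : ℕ) : ℝ) + 1 ≤ N := by exact_mod_cast (t l).2
    rw [← add_div, div_le_div_iff₀ (by positivity) hn']
    nlinarith
  exact ⟨by linarith, by linarith⟩

theorem exists_mem_subCube {n N : ℕ} (hn : 0 < n) (hN : 0 < N) {κ : Fin d → ℤ} {y : E d}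
    (hy : y ∈ scaledCube n κ) : ∃ t : Fin d → Fin N, y ∈ subCube n N κ t ∧
      ∀ t', t' ≠ t → y ∉ subCube n N κ t' := by
  have hN' : (0 : ℝ) < N := by exact_mod_cast hN
  have hfl := (mem_cube_latticePoint_iff hn κ ((2 * Real.pi) • y)).1 hy
  have key : ∀ l, N * κ l ≤ ⌊((N * n : ℕ) : ℝ) * ((2 * Real.pi) • y) l⌋ ∧
      ⌊((N * n : ℕ) : ℝ) * ((2 * Real.pi) • y) l⌋ < N * κ l + N := fun l => by
    have h1 : κ l = ⌊n * ((2 * Real.pi) • y) l⌋ := congrFun hfl l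
    rw [eq_comm, Int.floor_eq_iff] at h1
    rw [Int.le_floor, Int.floor_lt]
    push_cast
    rw [mul_assoc]
    constructor
    · exact mul_le_mul_of_nonneg_left h1.1 hN'.le
    · have := mul_lt_mul_of_pos_left h1.2 hN'
      linarith
  -- The index on the fine lattice, counted from the lower corner `N κ` of the coarse cube.
  refine ⟨fun l => ⟨(⌊((N * n : ℕ) : ℝ) * ((2 * Real.pi) • y) l⌋ - N * κ l).toNat, ?_⟩, ?_, ?_⟩
  · have := key l
    omega
  · rw [mem_subCube_iff hn hN]
    funext l
    have := key l
    simp only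
    omega
  · intro t' ht' hmem
    refine ht' (funext fun l => Fin.ext ?_)
    rw [mem_subCube_iff hn hN] at hmem
    have h1 := congrFun hmem l
    simp only at h1 ⊢
    omega

/-- The piecewise constant approximation of `a` times `bump`. -/
def stepFun (n N : ℕ) (a : E d → ℂ) (κ : Fin d → ℤ) (y : E d) : ℂ :=
  (((2 * Real.pi * n) ^ ((d : ℝ) / 2) : ℝ) : ℂ) *
    ∑ t : Fin d → Fin N, a (subPoint n N κ t) * (subCube n N κ t).indicator (fun _ => (1 : ℂ)) y

theorem stepFun_of_mem {n N : ℕ} (hn : 0 < n) (hN : 0 < N) (a : E d → ℂ) {κ : Fin d → ℤ} {y : E d}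
    (hy : y ∈ scaledCube n κ) : ∃ t : Fin d → Fin N, y ∈ subCube n N κ t ∧
      stepFun n N a κ y = a (subPoint n N κ t) * bump n κ y := by
  obtain ⟨t, ht, ht'⟩ := exists_mem_subCube hn hN hy
  refine ⟨t, ht, ?_⟩
  rw [stepFun, Finset.sum_eq_single t, indicator_of_mem ht, bump, indicator_of_mem hy, mul_one,
    mul_comm]
  · intro t' _ h
    rw [indicator_of_notMem (ht' t' h), mul_zero]
  · simp

theorem stepFun_of_notMem {n N : ℕ} (hn : 0 < n) (hN : 0 < N) (a : E d → ℂ) {κ : Fin d → ℤ}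
    {y : E d} (hy : y ∉ scaledCube n κ) : stepFun n N a κ y = 0 := by
  rw [stepFun, Finset.sum_eq_zero, mul_zero]
  intro t _
  rw [indicator_of_notMem fun h => hy (subCube_subset hn hN κ t h), mul_zero]

theorem bump_of_notMem {n : ℕ} {κ : Fin d → ℤ} {y : E d} (hy : y ∉ scaledCube n κ) :
    bump n κ y = 0 := indicator_of_notMem hy _

theorem norm_stepFun_le {n N : ℕ} (hn : 0 < n) (hN : 0 < N) {a : E d → ℂ} {C : ℝ}
    (ha : ∀ ξ, ‖a ξ‖ ≤ C) (κ : Fin d → ℤ) (y : E d) :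
    ‖stepFun n N a κ y‖ ≤ C * ‖bump n κ y‖ := by
  by_cases hy : y ∈ scaledCube n κ
  · obtain ⟨t, -, h⟩ := stepFun_of_mem hn hN a hy
    rw [h, norm_mul]
    gcongr
    exact ha _
  · rw [stepFun_of_notMem hn hN a hy, bump_of_notMem hy]
    simp

theorem norm_mul_bump_sub_stepFun_le {n N : ℕ} (hn : 0 < n) (hN : 0 < N) {a : E d → ℂ} {C : ℝ}
    (ha : ∀ ξ η, ‖a ξ - a η‖ ≤ C * ‖ξ - η‖) (hC : 0 ≤ C) (κ : Fin d → ℤ) (y : E d) :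
    ‖a ((2 * Real.pi) • y) * bump n κ y - stepFun n N a κ y‖ ≤
      C * (√d * (1 / (N * n))) * ‖bump n κ y‖ := by
  by_cases hy : y ∈ scaledCube n κ
  · obtain ⟨t, ht, h⟩ := stepFun_of_mem hn hN a hy
    rw [h, ← sub_mul, norm_mul]
    gcongr
    refine (ha _ _).trans ?_
    gcongr
    exact norm_sub_le_of_mem_cube ht
  · rw [stepFun_of_notMem hn hN a hy, bump_of_notMem hy]
    simp

theorem measurable_stepFun (n N : ℕ) (a : E d → ℂ) (κ : Fin d → ℤ) :
    Measurable (stepFun n N a κ) := by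
  unfold stepFun
  refine Measurable.const_mul (Finset.measurable_fun_sum _ fun t _ => Measurable.const_mul ?_ _) _
  exact measurable_const.indicator (measurableSet_subCube n N κ t)

theorem memLp_stepFun {n N : ℕ} (hn : 0 < n) (hN : 0 < N) {a : E d → ℂ} {C : ℝ}
    (ha : ∀ ξ, ‖a ξ‖ ≤ C) (κ : Fin d → ℤ) (q : ℝ≥0∞) : MemLp (stepFun n N a κ) q :=
  (memLp_bump n κ q).of_le_mul (measurable_stepFun n N a κ).aestronglyMeasurable
    (Filter.Eventually.of_forall (norm_stepFun_le hn hN ha κ))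

/-- Each coordinate of the corner is at most `n` in modulus, and the side `1/n ≤ n` is added to it;
hence the factor `2`. The bound limits the bandwidth of the approximate images and thereby their
derivatives. -/
theorem norm_smul_le_of_mem_scaledCube {n : ℕ} (hn : 0 < n) {κ : Fin d → ℤ}
    (hκ : ∀ l, |κ l| ≤ n * n) {y : E d} (hy : y ∈ scaledCube n κ) :
    ‖(2 * Real.pi) • y‖ ≤ 2 * √d * n := by
  have hn' : (1 : ℝ) ≤ n := by exact_mod_cast hn
  have hn0 : (0 : ℝ) < n := by linarith
  rw [EuclideanSpace.norm_eq, Real.sqrt_le_left (by positivity), mul_pow, mul_pow,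
    Real.sq_sqrt (by positivity)]
  calc ∑ l, ‖((2 * Real.pi) • y) l‖ ^ 2 ≤ ∑ _l : Fin d, (2 * (n : ℝ)) ^ 2 := by
        refine Finset.sum_le_sum fun l _ => ?_
        rw [Real.norm_eq_abs]
        refine pow_le_pow_left₀ (abs_nonneg _) (abs_le.2 ?_) 2
        have h1 := (hy l).1
        have h2 := (hy l).2
        have h3 : |(κ l : ℝ)| ≤ n * n := by exact_mod_cast hκ l
        have h4 : |(κ l : ℝ) / n| ≤ n := by
          rw [abs_div, abs_of_pos hn0, div_le_iff₀ hn0]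
          exact h3
        have h5 : (1 : ℝ) / n ≤ 1 := by rw [div_le_one hn0]; exact hn'
        rw [abs_le] at h4
        rw [latticePoint_apply] at h1 h2
        constructor <;> linarith [h4.1, h4.2]
    _ = 2 ^ 2 * d * n ^ 2 := by
        simp
        ring

/-- Substitution `ξ = 2π y`: the Jacobian `(2π)^(-d)` turns the amplitude `(2πn)^(d/2)` into
`(n/2π)^(d/2)`. -/
theorem approxFun_eq_fourier {n N : ℕ} (hn : 0 < n) (a : E d → ℂ) (κ : Fin d → ℤ) (x : E d) :
    approxFun n N a κ x = 𝓕 (stepFun n N a κ) x := by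
  have hn' : (0 : ℝ) < n := by exact_mod_cast hn
  set A : ℝ := (2 * Real.pi * n) ^ ((d : ℝ) / 2) with hA
  have hAe : A * ((2 * Real.pi) ^ d)⁻¹ = (n / (2 * Real.pi)) ^ ((d : ℝ) / 2) := by
    have h1 : (0 : ℝ) < 2 * Real.pi := by positivity
    have h2 : (2 * Real.pi) ^ d = (2 * Real.pi) ^ ((d : ℝ) / 2) * (2 * Real.pi) ^ ((d : ℝ) / 2) := by
      rw [← Real.rpow_add h1, add_halves, Real.rpow_natCast]
    rw [hA, Real.mul_rpow h1.le hn'.le, Real.div_rpow hn'.le h1.le, h2]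
    field_simp
  set e : E d → ℂ := fun ξ => Complex.exp (-(Complex.I * ((inner ℝ ξ x : ℝ) : ℂ))) with he
  have hec : Continuous e := by fun_prop
  have hpt : ∀ y, Complex.exp ((↑(-2 * Real.pi * inner ℝ y x) * Complex.I)) • stepFun n N a κ y =
      ∑ t : Fin d → Fin N, (A : ℂ) * a (subPoint n N κ t) *
        (cube (subPoint n N κ t) (1 / (N * n))).indicator e ((2 * Real.pi) • y) := fun y => by
    have h1 : e ((2 * Real.pi) • y) = Complex.exp (↑(-2 * Real.pi * inner ℝ y x) * Complex.I) := by
      simp only [he, inner_smul_left]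
      congr 1
      simp
      ring
    rw [stepFun, smul_eq_mul, mul_left_comm, Finset.mul_sum, Finset.mul_sum]
    refine Finset.sum_congr rfl fun t _ => ?_
    by_cases hy : y ∈ subCube n N κ t
    · have hy' : (2 * Real.pi) • y ∈ cube (subPoint n N κ t) (1 / (N * n)) := hy
      rw [indicator_of_mem hy, indicator_of_mem hy', h1]
      ring
    · have hy' : (2 * Real.pi) • y ∉ cube (subPoint n N κ t) (1 / (N * n)) := hy
      rw [indicator_of_notMem hy, indicator_of_notMem hy']
      ring
  rw [Real.fourier_eq']
  simp_rw [hpt]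
  have hint : ∀ t : Fin d → Fin N, Integrable fun y : E d =>
      (cube (subPoint n N κ t) (1 / (N * n))).indicator e ((2 * Real.pi) • y) := fun t => by
    refine ((integrable_indicator_iff (measurableSet_cube _ _)).2
      (integrableOn_cube hec _ _)).comp_smul (by positivity)
  rw [integral_finsetSum _ fun t _ => (hint t).const_mul _, approxFun, ← hAe, Finset.mul_sum]
  refine Finset.sum_congr rfl fun t _ => ?_
  rw [integral_const_mul, integral_indicator_comp_smul (measurableSet_cube _ _), Complex.real_smul]
  push_cast
  ring

theorem continuous_fourier_of_integrable {f : E d → ℂ} (hf : Integrable f) : Continuous (𝓕 f) :=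
  VectorFourier.fourierIntegral_continuous Real.continuous_fourierChar
    (by exact continuous_inner) hf

theorem norm_fourier_le_integral {F : Type*} [NormedAddCommGroup F] [NormedSpace ℂ F]
    (f : E d → F) (x : E d) : ‖𝓕 f x‖ ≤ ∫ y, ‖f y‖ :=
  VectorFourier.norm_fourierIntegral_le_integral_norm _ _ _ _ _

end frequency

/-! ### Uniform bounds for the approximate images and their derivatives. -/

section approxFun

open Set

variable {d : ℕ} {n N : ℕ} {a : E d → ℂ} {C : ℝ} {κ : Fin d → ℤ}

theorem norm_approxFun_le (hn : 0 < n) (hN : 0 < N) (ha : ∀ ξ, ‖a ξ‖ ≤ C) (x : E d) :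
    ‖approxFun n N a κ x‖ ≤ C * (2 * Real.pi * n) ^ (-((d : ℝ) / 2)) := by
  rw [approxFun_eq_fourier hn, ← integral_norm_bump hn κ, ← integral_const_mul]
  refine (norm_fourier_le_integral _ x).trans (integral_mono_of_nonneg
    (Filter.Eventually.of_forall fun y => norm_nonneg _) ?_
    (Filter.Eventually.of_forall (norm_stepFun_le hn hN ha κ)))
  exact ((memLp_one_iff_integrable.1 (memLp_bump n κ 1)).norm).const_mul _

/-- The derivative of `approxFun`. -/
def approxFunDeriv (n N : ℕ) (a : E d → ℂ) (κ : Fin d → ℤ) : E d → E d →L[ℝ] ℂ :=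
  𝓕 (VectorFourier.fourierSMulRight (innerSL ℝ) (stepFun n N a κ))

theorem norm_mul_stepFun_le (hn : 0 < n) (hN : 0 < N) (ha : ∀ ξ, ‖a ξ‖ ≤ C)
    (hκ : ∀ l, |κ l| ≤ n * n) (y : E d) :
    2 * Real.pi * ‖y‖ * ‖stepFun n N a κ y‖ ≤ 2 * √d * n * (C * ‖bump n κ y‖) := by
  by_cases hy : y ∈ scaledCube n κ
  · have h1 := norm_smul_le_of_mem_scaledCube hn hκ hy
    rw [norm_smul, Real.norm_of_nonneg (by positivity)] at h1
    exact mul_le_mul h1 (norm_stepFun_le hn hN ha κ y) (norm_nonneg _) (by positivity)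
  · rw [stepFun_of_notMem hn hN a hy, bump_of_notMem hy]
    simp

theorem integrable_stepFun (hn : 0 < n) (hN : 0 < N) (ha : ∀ ξ, ‖a ξ‖ ≤ C) :
    Integrable (stepFun n N a κ) :=
  memLp_one_iff_integrable.1 (memLp_stepFun hn hN ha κ 1)

theorem integrable_norm_mul_stepFun (hn : 0 < n) (hN : 0 < N) (ha : ∀ ξ, ‖a ξ‖ ≤ C)
    (hκ : ∀ l, |κ l| ≤ n * n) : Integrable fun y : E d => ‖y‖ * ‖stepFun n N a κ y‖ := by
  have h1 : Integrable fun y : E d => (2 * Real.pi)⁻¹ * (2 * √d * n * (C * ‖bump n κ y‖)) :=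
    ((((memLp_one_iff_integrable.1 (memLp_bump n κ 1)).norm).const_mul _).const_mul _).const_mul _
  refine h1.mono' ?_ (Filter.Eventually.of_forall fun y => ?_)
  · exact (measurable_norm.mul (measurable_stepFun n N a κ).norm).aestronglyMeasurable
  · rw [Real.norm_of_nonneg (by positivity), ← div_eq_inv_mul, le_div_iff₀ (by positivity)]
    have := norm_mul_stepFun_le hn hN ha hκ y
    linarith

theorem hasFDerivAt_approxFun (hn : 0 < n) (hN : 0 < N) (ha : ∀ ξ, ‖a ξ‖ ≤ C)
    (hκ : ∀ l, |κ l| ≤ n * n) (x : E d) :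
    HasFDerivAt (approxFun n N a κ) (approxFunDeriv n N a κ x) x := by
  rw [funext (approxFun_eq_fourier hn a κ)]
  exact Real.hasFDerivAt_fourier (integrable_stepFun hn hN ha)
    (integrable_norm_mul_stepFun hn hN ha hκ) x

theorem norm_fourierSMulRight_stepFun_le (y : E d) :
    ‖VectorFourier.fourierSMulRight (innerSL ℝ) (stepFun n N a κ) y‖ ≤
      2 * Real.pi * ‖y‖ * ‖stepFun n N a κ y‖ := by
  refine (VectorFourier.norm_fourierSMulRight_le _ _ _).trans ?_
  have := norm_innerSL_le (𝕜 := ℝ) (E := E d)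
  have h : 2 * Real.pi * ‖innerSL ℝ (E := E d)‖ ≤ 2 * Real.pi * 1 := by gcongr
  rw [mul_one] at h
  gcongr

theorem continuous_approxFunDeriv (hn : 0 < n) (hN : 0 < N) (ha : ∀ ξ, ‖a ξ‖ ≤ C)
    (hκ : ∀ l, |κ l| ≤ n * n) : Continuous (approxFunDeriv n N a κ) := by
  refine VectorFourier.fourierIntegral_continuous Real.continuous_fourierChar
    (by exact continuous_inner) ?_
  refine ((integrable_norm_mul_stepFun hn hN ha hκ).const_mul (2 * Real.pi)).mono' ?_
    (Filter.Eventually.of_forall fun y => ?_)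
  · exact (integrable_stepFun hn hN ha).aestronglyMeasurable.fourierSMulRight
  · rw [← mul_assoc]
    exact norm_fourierSMulRight_stepFun_le y

/-- A Bernstein inequality: differentiation multiplies the frequency side by at most `|ξ| ≤ 2 √d n`
on the support. -/
theorem norm_approxFunDeriv_le (hn : 0 < n) (hN : 0 < N) (ha : ∀ ξ, ‖a ξ‖ ≤ C)
    (hκ : ∀ l, |κ l| ≤ n * n) (x : E d) :
    ‖approxFunDeriv n N a κ x‖ ≤ 2 * √d * n * (C * (2 * Real.pi * n) ^ (-((d : ℝ) / 2))) := by
  rw [← integral_norm_bump hn κ, ← integral_const_mul, ← integral_const_mul]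
  refine (norm_fourier_le_integral _ x).trans (integral_mono_of_nonneg
    (Filter.Eventually.of_forall fun y => norm_nonneg _) ?_
    (Filter.Eventually.of_forall fun y => ?_))
  · exact (((memLp_one_iff_integrable.1 (memLp_bump n κ 1)).norm).const_mul _).const_mul _
  · exact (norm_fourierSMulRight_stepFun_le y).trans (norm_mul_stepFun_le hn hN ha hκ y)

end approxFun

/-! ### Operators given by matrices -/

section matrixOp

variable {d : ℕ}

theorem GridIndex.toInt_injective {q : ℕ} :
    Function.Injective (GridIndex.toInt : GridIndex d q → Fin d → ℤ) := fun _ _ h =>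
  funext fun l => Subtype.ext (congrFun h l)

theorem GridIndex.abs_toInt_le {q : ℕ} (k : GridIndex d q) (l : Fin d) : |k.toInt l| ≤ q :=
  abs_le.2 (Finset.mem_Icc.1 (k l).2)

theorem card_gridIndex (d q : ℕ) : Fintype.card (GridIndex d q) = (2 * q + 1) ^ d := by
  rw [Fintype.card_fun, Fintype.card_fin, Fintype.card_coe, Int.card_Icc]
  congr 1
  omega

theorem orthonormal_gridIndex {n : ℕ} (hn : 0 < n) (q : ℕ) :
    Orthonormal ℂ fun k : GridIndex d q => basisFun n k.toInt :=
  (orthonormal_basisFun hn).comp _ GridIndex.toInt_injective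

theorem matrixOp_apply {n r : ℕ} (A : Matrix (GridIndex d (n * r)) (GridIndex d (n * r)) ℂ)
    (f : L2 d) : matrixOp n r A f =
      ∑ k, (∑ l, A k l * inner ℂ (basisFun n l.toInt) f) • basisFun n k.toInt := by
  simp only [matrixOp, _root_.sum_apply, _root_.smul_apply, InnerProductSpace.rankOne_apply,
    Finset.sum_smul, smul_smul]

theorem norm_sum_smul_sq_of_orthonormal {ι F : Type*} [NormedAddCommGroup F]
    [InnerProductSpace ℂ F] {v : ι → F} (hv : Orthonormal ℂ v) (s : Finset ι) (c : ι → ℂ) :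
    ‖∑ i ∈ s, c i • v i‖ ^ 2 = ∑ i ∈ s, ‖c i‖ ^ 2 := by
  have h := hv.inner_sum c c s
  rw [inner_self_eq_norm_sq_to_K] at h
  have h2 : ∀ i, (starRingEnd ℂ) (c i) * c i = ((‖c i‖ ^ 2 : ℝ) : ℂ) := fun i => by
    rw [RCLike.conj_mul]; push_cast; rfl
  simp_rw [h2] at h
  apply Complex.ofReal_injective
  push_cast at h ⊢
  exact h

/-- Cauchy–Schwarz in each row, Bessel's inequality for the coefficients and orthonormality of the
outputs: in effect a Hilbert–Schmidt bound. The loss is the number of basis functions, for which the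
parameters `N`, `R` and `s` have to compensate. -/
theorem norm_matrixOp_le {n r : ℕ} (hn : 0 < n)
    {A : Matrix (GridIndex d (n * r)) (GridIndex d (n * r)) ℂ} {ε : ℝ} (hε : 0 ≤ ε)
    (hA : ∀ k l, ‖A k l‖ ≤ ε) : ‖matrixOp n r A‖ ≤ (2 * (n * r) + 1 : ℕ) ^ d * ε := by
  refine ContinuousLinearMap.opNorm_le_bound _ (by positivity) fun f => ?_
  have hv := orthonormal_gridIndex (d := d) hn (n * r)
  set L : ℝ := (2 * (n * r) + 1 : ℕ) ^ d with hL
  have hcard : (Fintype.card (GridIndex d (n * r)) : ℝ) = L := by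
    rw [card_gridIndex, hL, Nat.cast_pow]
  have hL0 : 0 ≤ L := by positivity
  set x : GridIndex d (n * r) → ℝ := fun l => ‖inner ℂ (basisFun n l.toInt) f‖ with hx
  have hbes : ∑ l, x l ^ 2 ≤ ‖f‖ ^ 2 := hv.sum_inner_products_le f
  have hcs : (∑ l, x l) ^ 2 ≤ L * ‖f‖ ^ 2 := by
    refine sq_sum_le_card_mul_sum_sq.trans ?_
    rw [Finset.card_univ, hcard]
    gcongr
  have hk : ∀ k, ‖∑ l, A k l * inner ℂ (basisFun n l.toInt) f‖ ^ 2 ≤ ε ^ 2 * (L * ‖f‖ ^ 2) := by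
    intro k
    have : ‖∑ l, A k l * inner ℂ (basisFun n l.toInt) f‖ ≤ ε * ∑ l, x l := by
      rw [Finset.mul_sum]
      refine norm_sum_le_of_le _ fun l _ => ?_
      rw [norm_mul]
      gcongr
      exact hA k l
    calc _ ≤ (ε * ∑ l, x l) ^ 2 := by gcongr
      _ ≤ _ := by rw [mul_pow]; gcongr
  refine le_of_sq_le_sq ?_ (by positivity)
  rw [matrixOp_apply, norm_sum_smul_sq_of_orthonormal hv]
  calc _ ≤ ∑ _k : GridIndex d (n * r), ε ^ 2 * (L * ‖f‖ ^ 2) := Finset.sum_le_sum fun k _ => hk k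
    _ = (L * ε * ‖f‖) ^ 2 := by
      rw [Finset.sum_const, Finset.card_univ, nsmul_eq_mul, hcard]
      ring

theorem matrixOp_sub {n r : ℕ} (A B : Matrix (GridIndex d (n * r)) (GridIndex d (n * r)) ℂ) :
    matrixOp n r A - matrixOp n r B = matrixOp n r (A - B) := by
  simp only [matrixOp, ← Finset.sum_sub_distrib, ← sub_smul, Matrix.sub_apply]

/-- The orthogonal projection onto the span of the basis functions. -/
def basisProj (d n r : ℕ) : L2 d →L[ℂ] L2 d :=
  ∑ k : GridIndex d (n * r), InnerProductSpace.rankOne ℂ (basisFun n k.toInt) (basisFun n k.toInt)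

theorem basisProj_apply {n r : ℕ} (f : L2 d) : basisProj d n r f =
    ∑ k : GridIndex d (n * r), inner ℂ (basisFun n k.toInt) f • basisFun n k.toInt := by
  simp only [basisProj, _root_.sum_apply, InnerProductSpace.rankOne_apply]

theorem basisProj_mul_mul_basisProj {n r : ℕ} (T : L2 d →L[ℂ] L2 d) :
    basisProj d n r * T * basisProj d n r =
      matrixOp n r (Matrix.of fun k l => inner ℂ (basisFun n k.toInt) (T (basisFun n l.toInt))) := by
  ext1 f
  rw [mul_apply_eq_comp, mul_apply_eq_comp, basisProj_apply, matrixOp_apply]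
  refine Finset.sum_congr rfl fun k _ => ?_
  rw [basisProj_apply, map_sum, inner_sum]
  congr 1
  refine Finset.sum_congr rfl fun l _ => ?_
  rw [map_smul, inner_smul_right, Matrix.of_apply, mul_comm]

theorem isCompactOperator_matrixOp {n r : ℕ}
    (A : Matrix (GridIndex d (n * r)) (GridIndex d (n * r)) ℂ) :
    IsCompactOperator (matrixOp n r A) := by
  have h : ∀ k l, IsCompactOperator (A k l •
      InnerProductSpace.rankOne ℂ (basisFun (d := d) n (GridIndex.toInt k))
        (basisFun n (GridIndex.toInt l))) := fun k l => by
    exact ((isCompactOperator_id (E := ℂ)).clm_comp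
      (ContinuousLinearMap.toSpanSingleton ℂ (basisFun (d := d) n (GridIndex.toInt k)))).comp_clm
        (innerSL ℂ (basisFun n (GridIndex.toInt l))) |>.smul (A k l)
  exact (compactOperator (RingHom.id ℂ) (L2 d) (L2 d)).sum_mem fun k _ =>
    (compactOperator (RingHom.id ℂ) (L2 d) (L2 d)).sum_mem fun l _ => h k l

end matrixOp

/-! ### The images of the basis functions -/

section entries

open Set

variable {d n N : ℕ} {κ : Fin d → ℤ} {a : E d → ℂ} {C D : ℝ}

theorem fourierMultiplier_basisFun (ha : MemLp (fun ξ => a ((2 * Real.pi) • ξ)) ∞ volume)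
    (heven : ∀ x, a (-x) = a x) : fourierMultiplier a (basisFun n κ) =
      𝓕 (mulOp (fun ξ => a ((2 * Real.pi) • ξ)) ((memLp_bump n κ 2).toLp (bump n κ))) := by
  rw [fourierMultiplier_apply_of_even ha heven, fourierInv_basisFun]

theorem norm_toLp_bump (hn : 0 < n) : ‖(memLp_bump n κ 2).toLp (bump n κ)‖ = 1 := by
  rw [← fourierInv_basisFun, norm_fourierInv]
  exact (orthonormal_basisFun hn).1 κ

theorem fourier_toLp_stepFun (hn : 0 < n) (hN : 0 < N) (ha : ∀ ξ, ‖a ξ‖ ≤ C) :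
    (𝓕 ((memLp_stepFun hn hN ha κ 2).toLp (stepFun n N a κ)) : L2 d) =ᵐ[volume]
      approxFun n N a κ := by
  rw [funext (approxFun_eq_fourier hn a κ)]
  exact fourier_toLp_ae _ (integrable_stepFun hn hN ha)

theorem memLp_approxFun (hn : 0 < n) (hN : 0 < N) (ha : ∀ ξ, ‖a ξ‖ ≤ C) :
    MemLp (approxFun n N a κ) 2 :=
  (memLp_congr_ae (fourier_toLp_stepFun hn hN ha)).1 (Lp.memLp _)

theorem toLp_approxFun (hn : 0 < n) (hN : 0 < N) (ha : ∀ ξ, ‖a ξ‖ ≤ C) :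
    (memLp_approxFun hn hN ha).toLp (approxFun n N a κ) =
      (𝓕 ((memLp_stepFun hn hN ha κ 2).toLp (stepFun n N a κ)) : L2 d) :=
  Lp.ext ((memLp_approxFun hn hN ha).coeFn_toLp.trans (fourier_toLp_stepFun hn hN ha).symm)

theorem norm_toLp_approxFun_le (hn : 0 < n) (hN : 0 < N) (ha : ∀ ξ, ‖a ξ‖ ≤ C) :
    ‖(memLp_approxFun hn hN ha).toLp (approxFun n N a κ)‖ ≤ C := by
  rw [toLp_approxFun hn hN ha, Lp.norm_fourier_eq]
  have h : ‖(memLp_stepFun hn hN ha κ 2).toLp (stepFun n N a κ)‖ ≤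
      C * ‖(memLp_bump n κ 2).toLp (bump n κ)‖ := by
    refine norm_le_of_ae_le_mul ?_
    filter_upwards [(memLp_stepFun hn hN ha κ 2).coeFn_toLp, (memLp_bump n κ 2).coeFn_toLp]
      with y h1 h2
    rw [h1, h2]
    exact norm_stepFun_le hn hN ha κ y
  rwa [norm_toLp_bump hn, mul_one] at h

theorem fourier_L2_sub (f g : L2 d) : (𝓕 (f - g) : L2 d) = 𝓕 f - 𝓕 g :=
  map_sub (Lp.fourierTransformₗᵢ (E d) ℂ) f g

/-- By Plancherel the difference is that of the symbol and its step approximation, at most the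
Lipschitz constant times the diameter `√d / (N n)` of a subcube. -/
theorem norm_fourierMultiplier_basisFun_sub_le (hn : 0 < n) (hN : 0 < N)
    (ham : MemLp (fun ξ => a ((2 * Real.pi) • ξ)) ∞ volume) (heven : ∀ x, a (-x) = a x)
    (ha : ∀ ξ, ‖a ξ‖ ≤ C) (haD : ∀ ξ η, ‖a ξ - a η‖ ≤ D * ‖ξ - η‖) (hD : 0 ≤ D) :
    ‖fourierMultiplier a (basisFun n κ) -
      (memLp_approxFun hn hN ha).toLp (approxFun n N a κ)‖ ≤ D * (√d * (1 / (N * n))) := by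
  rw [fourierMultiplier_basisFun ham heven, toLp_approxFun hn hN ha, ← fourier_L2_sub,
    Lp.norm_fourier_eq]
  set b := (memLp_bump n κ 2).toLp (bump (d := d) n κ) with hb
  have h : ‖mulOp (fun ξ => a ((2 * Real.pi) • ξ)) b -
      (memLp_stepFun hn hN ha κ 2).toLp (stepFun n N a κ)‖ ≤ D * (√d * (1 / (N * n))) * ‖b‖ := by
    refine norm_le_of_ae_le_mul ?_
    filter_upwards [(memLp_stepFun hn hN ha κ 2).coeFn_toLp, (memLp_bump n κ 2).coeFn_toLp,
      mulOp_coeFn ham b, Lp.coeFn_sub (mulOp (fun ξ => a ((2 * Real.pi) • ξ)) b)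
        ((memLp_stepFun hn hN ha κ 2).toLp (stepFun n N a κ))] with y h1 h2 h3 h4
    rw [h4, Pi.sub_apply, h3, h1, hb, h2]
    exact norm_mul_bump_sub_stepFun_le hn hN haD hD κ y
  rwa [norm_toLp_bump hn, mul_one] at h

theorem norm_fourierMultiplier_basisFun_le (hn : 0 < n)
    (ham : MemLp (fun ξ => a ((2 * Real.pi) • ξ)) ∞ volume) (ha : ∀ ξ, ‖a ξ‖ ≤ C) :
    ‖fourierMultiplier a (basisFun n κ)‖ ≤ C := by
  have hC : 0 ≤ C := (norm_nonneg _).trans (ha 0)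
  have h := (fourierMultiplier a).le_of_opNorm_le (norm_fourierMultiplier_le ham ha hC)
    (basisFun n κ)
  rwa [(orthonormal_basisFun hn).1 κ, mul_one] at h

/-- The sesquilinear form of a multiplication operator. -/
theorem inner_mulOp_toLp {f g w : E d → ℂ} (hf : MemLp f 2) (hg : MemLp g 2)
    (hw : MemLp w ∞ volume) :
    inner ℂ (hf.toLp f) (mulOp w (hg.toLp g)) = ∫ x, (starRingEnd ℂ) (f x) * g x * w x := by
  rw [L2.inner_def]
  refine integral_congr_ae ?_
  filter_upwards [hf.coeFn_toLp, hg.coeFn_toLp, mulOp_coeFn hw (hg.toLp g)] with x h1 h2 h3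
  rw [h1, h3, h2, RCLike.inner_apply]
  ring

theorem norm_integral_conj_mul_mul_le {f g w : E d → ℂ} (hf : MemLp f 2) (hg : MemLp g 2)
    (hw : MemLp w ∞ volume) (hwC : ∀ x, ‖w x‖ ≤ C) :
    ‖∫ x, (starRingEnd ℂ) (f x) * g x * w x‖ ≤ C * (‖hf.toLp f‖ * ‖hg.toLp g‖) := by
  rw [← inner_mulOp_toLp hf hg hw]
  refine (norm_inner_le_norm _ _).trans ?_
  have := norm_mulOp_apply_le hw (Filter.Eventually.of_forall hwC) (hg.toLp g)
  calc _ ≤ ‖hf.toLp f‖ * (C * ‖hg.toLp g‖) := by gcongr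
    _ = _ := by ring

theorem integrable_conj_mul_mul {f g w : E d → ℂ} (hf : MemLp f 2) (hg : MemLp g 2)
    (hw : MemLp w ∞ volume) : Integrable fun x => (starRingEnd ℂ) (f x) * g x * w x := by
  have h1 : Integrable fun x => (starRingEnd ℂ) (f x) * g x :=
    memLp_one_iff_integrable.1 (hg.mul hf.star)
  exact memLp_one_iff_integrable.1 (hw.mul (memLp_one_iff_integrable.2 h1))

variable {m M p : ℝ} {lam : ℂ} {V : E d → ℝ}

/-- The error of restricting the integral to the box `[-R, R)^d`. -/
theorem norm_integral_sub_sum_cube_le (hV : Admissible p M V) {f g : E d → ℂ} (hf : MemLp f 2)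
    (hg : MemLp g 2) {R s : ℕ} (hR : 0 < R) (hs : 0 < s) :
    ‖(∫ x, (starRingEnd ℂ) (f x) * g x * W lam V x) -
        ∑ i ∈ boxIndex d (R * s), ∫ x in cube (latticePoint s i) (1 / s),
          (starRingEnd ℂ) (f x) * g x * W lam V x‖ ≤
      2 * M * (M + ‖lam‖) / R * (‖hf.toLp f‖ * ‖hg.toLp g‖) := by
  have hR' : (0 : ℝ) < R := by exact_mod_cast hR
  have hs' : (0 : ℝ) < s := by exact_mod_cast hs
  have hM := hV.nonneg
  set F : E d → ℂ := fun x => (starRingEnd ℂ) (f x) * g x * W lam V x with hF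
  have hFi : Integrable F := integrable_conj_mul_mul hf hg hV.memLp_W
  set U : Set (E d) := ⋃ i ∈ boxIndex d (R * s), cube (latticePoint s i) (1 / s) with hU
  have hUm : MeasurableSet U := Finset.measurableSet_biUnion _ fun i _ => measurableSet_cube _ _
  have h1 : ∑ i ∈ boxIndex d (R * s), ∫ x in cube (latticePoint s i) (1 / s), F x =
      ∫ x in U, F x := by
    rw [hU, integral_biUnion_finset _ (fun i _ => measurableSet_cube _ _)
      (fun i _ j _ hij => disjoint_cube_latticePoint hs hij) fun i _ => hFi.integrableOn]
  have h2 : (∫ x, F x) - ∫ x in U, F x = ∫ x, (starRingEnd ℂ) (f x) * g x *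
      Uᶜ.indicator (W lam V) x := by
    rw [← integral_add_compl hUm hFi, add_sub_cancel_left, ← integral_indicator hUm.compl]
    refine integral_congr_ae (Filter.Eventually.of_forall fun x => ?_)
    by_cases hx : x ∈ Uᶜ
    · simp only [indicator_of_mem hx, hF]
    · simp only [indicator_of_notMem hx, mul_zero]
  rw [h1, h2]
  refine norm_integral_conj_mul_mul_le hf hg (hV.memLp_W.indicator hUm.compl) fun x => ?_
  by_cases hx : x ∈ Uᶜ
  · rw [indicator_of_mem hx]
    -- The cubes fill the box `[-R, R)^d` exactly, so `|x| ≥ R` off their union, and there `|V| ≤ M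
    -- / R`.
    have hxR : (R : ℝ) ≤ ‖x‖ := by
      have := le_norm_of_notMem_cube (q := R * s) hs (x := x) fun κ hκ hmem => hx ?_
      · push_cast at this
        nlinarith
      · refine mem_biUnion (x := κ) ?_ hmem
        exact Fintype.mem_piFinset.2 fun l => Finset.mem_Ico.2 (hκ l)
    have h3 := hV.norm_mul_abs_le x
    have h4 := hV.abs_le x
    have h5 := norm_W_le lam V x
    have h6 : |V x| ≤ M / R := by
      rw [le_div_iff₀ hR']
      nlinarith [abs_nonneg (V x)]
    calc _ ≤ |V x| * (|V x| + 2 * ‖lam‖) := h5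
      _ ≤ M / R * (M + 2 * ‖lam‖) := by gcongr
      _ = M * (M + 2 * ‖lam‖) / R := by ring
      _ ≤ 2 * M * (M + ‖lam‖) / R := by
        rw [mul_assoc 2 M, mul_left_comm]
        gcongr
        linarith [norm_nonneg lam]
  · rw [indicator_of_notMem hx, norm_zero]
    positivity

theorem norm_symbol_sub_le (hm : 0 < m) (h : 0 < specDist m lam) (ξ η : E d) :
    ‖symbol m lam ξ - symbol m lam η‖ ≤ (symbolSize d m lam).grad * ‖ξ - η‖ :=
  Convex.norm_image_sub_le_of_norm_fderiv_le (𝕜 := ℝ)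
    (fun _ _ => (differentiable_symbol hm h).differentiableAt)
    (fun x _ => norm_fderiv_symbol_le_size hm h x) convex_univ (mem_univ η) (mem_univ ξ)

theorem norm_symbol_conj (ξ : E d) :
    ‖symbol m ((starRingEnd ℂ) lam) ξ‖ = ‖symbol m lam ξ‖ := by
  rw [symbol_conj, RCLike.norm_conj]

theorem norm_symbol_conj_le (hm : 0 < m) (h : 0 < specDist m lam) (ξ : E d) :
    ‖symbol m ((starRingEnd ℂ) lam) ξ‖ ≤ (symbolSize d m lam).sup := by
  rw [norm_symbol_conj]
  exact norm_symbol_le_size hm h ξ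

theorem norm_symbol_conj_sub_le (hm : 0 < m) (h : 0 < specDist m lam) (ξ η : E d) :
    ‖symbol m ((starRingEnd ℂ) lam) ξ - symbol m ((starRingEnd ℂ) lam) η‖ ≤
      (symbolSize d m lam).grad * ‖ξ - η‖ := by
  rw [symbol_conj, symbol_conj, ← map_sub, RCLike.norm_conj]
  exact norm_symbol_sub_le hm h ξ η

/-- Moving the left multiplier across the inner product conjugates its symbol, and the conjugate of
`a_λ` is the symbol of the conjugate of `λ`; hence that parameter in the matrix entries. -/
theorem inner_K (hm : 0 < m) (h : 0 < specDist m lam) (f g : L2 d) :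
    inner ℂ f (K m lam V g) = inner ℂ (fourierMultiplier (symbol m ((starRingEnd ℂ) lam)) f)
      (mulOp (W lam V) (fourierMultiplier (symbol m 0) g)) := by
  have h' : 0 < specDist m ((starRingEnd ℂ) lam) := by rwa [specDist_conj]
  rw [K_eq hm h, mul_apply_eq_comp, mul_apply_eq_comp,
    inner_fourierMultiplier_left (memLp_symbol hm h')]
  simp_rw [symbol_conj, Complex.conj_conj]

/-- The error of replacing the symbols by piecewise constant functions. -/
theorem norm_inner_K_sub_integral_le (hm : 0 < m) (h : 0 < specDist m lam) (hV : Admissible p M V)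
    (hn : 0 < n) (hN : 0 < N) (κ κ' : Fin d → ℤ) :
    ‖inner ℂ (basisFun n κ) (K m lam V (basisFun n κ')) -
        ∫ x, (starRingEnd ℂ) (approxFun n N (symbol m ((starRingEnd ℂ) lam)) κ x) *
          approxFun n N (symbol m 0) κ' x * W lam V x‖ ≤
      constD1 d M lam (symbolSize d m lam) (symbolSize d m 0) / (N * n) := by
  have h' : 0 < specDist m ((starRingEnd ℂ) lam) := by rwa [specDist_conj]
  have h0 := specDist_zero_pos hm
  have hM := hV.nonneg
  have ha := norm_symbol_conj_le (d := d) hm h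
  have ha0 := norm_symbol_le_size (d := d) hm h0
  set S := symbolSize d m lam
  set S₀ := symbolSize d m 0
  have e1 : 0 ≤ S.grad := symbolSize_grad_nonneg
  have e2 : 0 ≤ S₀.grad := symbolSize_grad_nonneg
  have e3 : 0 ≤ S.sup := symbolSize_sup_nonneg
  have e4 : 0 ≤ S₀.sup := symbolSize_sup_nonneg
  rw [inner_K hm h, ← inner_mulOp_toLp (memLp_approxFun hn hN ha) (memLp_approxFun hn hN ha0)
    hV.memLp_W]
  have hx := norm_fourierMultiplier_basisFun_sub_le (κ := κ) hn hN (memLp_symbol hm h') symbol_neg ha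
    (norm_symbol_conj_sub_le hm h) e1
  have hy := norm_fourierMultiplier_basisFun_sub_le (κ := κ') hn hN (memLp_symbol hm h0) symbol_neg
    ha0 (norm_symbol_sub_le hm h0) e2
  have hx' := norm_toLp_approxFun_le (κ := κ) hn hN ha
  have hy' := norm_fourierMultiplier_basisFun_le (κ := κ') hn (memLp_symbol hm h0) ha0
  set x := fourierMultiplier (symbol m ((starRingEnd ℂ) lam)) (basisFun n κ)
  set y := fourierMultiplier (symbol m 0) (basisFun n κ')
  set x' := (memLp_approxFun hn hN ha).toLp
    (approxFun n N (symbol m ((starRingEnd ℂ) lam)) κ)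
  set y' := (memLp_approxFun hn hN ha0).toLp (approxFun n N (symbol m 0) κ')
  set w := M * (M + 2 * ‖lam‖)
  have hw0 : 0 ≤ w := by positivity
  have hw : ∀ f : L2 d, ‖mulOp (W lam V) f‖ ≤ w * ‖f‖ :=
    norm_mulOp_apply_le hV.memLp_W (Filter.Eventually.of_forall hV.norm_W_le)
  -- The second term uses `x'`, whose norm is also at most `S.sup`, so no product of two errors
  -- arises; the product of the two gradients in `D₁` is merely added at the end.
  have hsplit : inner ℂ x (mulOp (W lam V) y) - inner ℂ x' (mulOp (W lam V) y') =
      inner ℂ (x - x') (mulOp (W lam V) y) + inner ℂ x' (mulOp (W lam V) (y - y')) := by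
    rw [inner_sub_left, map_sub, inner_sub_right]
    ring
  rw [hsplit]
  calc _ ≤ ‖x - x'‖ * ‖mulOp (W lam V) y‖ + ‖x'‖ * ‖mulOp (W lam V) (y - y')‖ :=
        (norm_add_le _ _).trans (add_le_add (norm_inner_le_norm _ _) (norm_inner_le_norm _ _))
    _ ≤ (S.grad * (√d * (1 / (N * n)))) * (w * S₀.sup) +
        S.sup * (w * (S₀.grad * (√d * (1 / (N * n))))) := by
        have h1 := (hw y).trans (mul_le_mul_of_nonneg_left hy' hw0)
        have h2 := (hw (y - y')).trans (mul_le_mul_of_nonneg_left hy hw0)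
        gcongr
    _ = √d * w * (S.grad * S₀.sup + S.sup * S₀.grad) / (N * n) := by ring
    _ ≤ _ := by
        rw [constD1]
        have : 0 ≤ √d * w * (√d * S.grad * S₀.grad) := by positivity
        simp only [w] at this ⊢
        apply div_le_div_of_nonneg_right _ (by positivity)
        linarith

theorem paramN_pos (d n : ℕ) : 0 < paramN d n := pow_pos (by omega) d

theorem paramR_pos (hn : 0 < n) : 0 < paramR d n := Nat.mul_pos (pow_pos (by omega) d) hn

theorem paramR_eq (d n : ℕ) : paramR d n = paramN d n * n := rfl

theorem le_paramS : (paramN d n : ℝ) * (n : ℝ) ^ (1 - (d : ℝ)) * n *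
    (paramR d n : ℝ) ^ ((d : ℝ) - d / p) ≤ paramS d p n := by
  rw [paramN, Nat.cast_pow]
  exact Nat.le_ceil _

theorem paramS_pos (hn : 0 < n) : 0 < paramS d p n := by
  have hn' : (0 : ℝ) < n := by exact_mod_cast hn
  have h1 : (0 : ℝ) < paramN d n := by exact_mod_cast paramN_pos d n
  have h2 : (0 : ℝ) < paramR d n := by exact_mod_cast paramR_pos hn
  have := le_paramS (d := d) (n := n) (p := p)
  have h3 : (0 : ℝ) < paramS d p n := lt_of_lt_of_le (by positivity) this
  exact_mod_cast h3

/-- The lower bound `le_paramS` cancels three things: the power of `R` from the size of the box, the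
`n^(-d)` of the two amplitudes, and the factor `n` of the derivatives. What is left is `1 / (N_n
n)`. -/
theorem quadrature_constant_le (hd : 0 < d) (hdp : (d : ℝ) < p) (hM : 0 ≤ M) (hn : 0 < n)
    {b b₀ : ℝ} (hb : 0 ≤ b) (hb₀ : 0 ≤ b₀) :
    √d / paramS d p n * (2 * paramR d n) ^ (d - d / p : ℝ) / (1 - d / p) *
        (b * b₀ * (((2 * Real.pi) ^ d)⁻¹ * ((n : ℝ) ^ d)⁻¹) * M *
          (4 * √d * n * (M + 2 * ‖lam‖) + 2 * (M + ‖lam‖))) ≤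
      2 ^ (1 + (d : ℝ) - d / p) / ((1 - d / p) * (2 * Real.pi) ^ d) *
        (4 * √2 * d) * M * (M + ‖lam‖) * b * b₀ / (paramN d n * n) := by
  have hd1 : (1 : ℝ) ≤ d := by exact_mod_cast hd
  have hp0 : 0 < p := by linarith
  have hq : 0 < 1 - d / p := by rw [sub_pos, div_lt_one hp0]; exact hdp
  have hn1 : (1 : ℝ) ≤ n := by exact_mod_cast hn
  have hn' : (0 : ℝ) < n := by linarith
  have hN' : (0 : ℝ) < paramN d n := by exact_mod_cast paramN_pos d n
  have hR' : (0 : ℝ) < paramR d n := by exact_mod_cast paramR_pos hn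
  have hs := le_paramS (d := d) (n := n) (p := p)
  have hs0 : (0 : ℝ) < paramN d n * (n : ℝ) ^ (1 - (d : ℝ)) * n *
    (paramR d n : ℝ) ^ ((d : ℝ) - d / p) := by positivity
  have hnd : (n : ℝ) ^ (1 - (d : ℝ)) = n * ((n : ℝ) ^ d)⁻¹ := by
    rw [Real.rpow_sub hn', Real.rpow_one, Real.rpow_natCast, div_eq_mul_inv]
  have h2R : (2 * (paramR d n : ℝ)) ^ ((d : ℝ) - d / p) =
      2 ^ ((d : ℝ) - d / p) * (paramR d n : ℝ) ^ ((d : ℝ) - d / p) :=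
    Real.mul_rpow (by norm_num) hR'.le
  have h2a : (2 : ℝ) ^ (1 + (d : ℝ) - d / p) = 2 * 2 ^ ((d : ℝ) - d / p) := by
    rw [add_sub_assoc, Real.rpow_add (by norm_num), Real.rpow_one]
  -- In units of `d n M (M + |λ|)` the left side is at most `8 + 2 = 10`, and `10 = 8 · (5/4) ≤ 8
  -- √2`.
  have hnum : √d * (M * ((4 * √d * n) * (M + 2 * ‖lam‖) + 2 * (M + ‖lam‖))) ≤
      n * (2 * (4 * √2 * d) * M * (M + ‖lam‖)) := by
    have s1 : √(d : ℝ) * √d = d := Real.mul_self_sqrt (by linarith)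
    have s2 : √(d : ℝ) ≤ d := by
      have : 1 ≤ √(d : ℝ) := Real.one_le_sqrt.2 hd1
      nlinarith
    have s3 : (5 / 4 : ℝ) ≤ √2 := Real.le_sqrt_of_sq_le (by norm_num)
    have s4 : √(d : ℝ) ≤ d * n := by nlinarith
    have hr := norm_nonneg lam
    calc _ = M * (4 * (√d * √d) * n * (M + 2 * ‖lam‖) + 2 * √d * (M + ‖lam‖)) := by ring
      _ ≤ M * (4 * d * n * (2 * (M + ‖lam‖)) + 2 * (d * n) * (M + ‖lam‖)) := by
        rw [s1]
        gcongr
        linarith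
      _ = n * (2 * (4 * (5 / 4) * d) * M * (M + ‖lam‖)) := by ring
      _ ≤ _ := by gcongr
  calc _ ≤ √d / (paramN d n * (n : ℝ) ^ (1 - (d : ℝ)) * n *
        (paramR d n : ℝ) ^ ((d : ℝ) - d / p)) * (2 * (paramR d n : ℝ)) ^ ((d : ℝ) - d / p) /
        (1 - d / p) * (b * b₀ * (((2 * Real.pi) ^ d)⁻¹ * ((n : ℝ) ^ d)⁻¹) * M *
          ((4 * √d * n) * (M + 2 * ‖lam‖) + 2 * (M + ‖lam‖))) := by gcongr
    _ = 2 ^ ((d : ℝ) - d / p) / ((1 - d / p) * (2 * Real.pi) ^ d) * (b * b₀) /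
        (paramN d n * n * n) *
        (√d * (M * ((4 * √d * n) * (M + 2 * ‖lam‖) + 2 * (M + ‖lam‖)))) := by
      rw [hnd, h2R]
      have : (n : ℝ) ^ d ≠ 0 := by positivity
      have : (paramR d n : ℝ) ^ ((d : ℝ) - d / p) ≠ 0 := by positivity
      generalize (paramR d n : ℝ) ^ ((d : ℝ) - d / p) = y at *
      field_simp
    _ ≤ 2 ^ ((d : ℝ) - d / p) / ((1 - d / p) * (2 * Real.pi) ^ d) * (b * b₀) /
        (paramN d n * n * n) * (n * (2 * (4 * √2 * d) * M * (M + ‖lam‖))) := by gcongr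
    _ = _ := by
      rw [h2a]
      field_simp

/-- The quadrature error. -/
theorem norm_sum_integral_sub_Kmatrix_le (hd : 0 < d) (hdp : (d : ℝ) < p) (hm : 0 < m)
    (h : 0 < specDist m lam) (hV : Admissible p M V) (hn : 0 < n) (k l : GridIndex d (n * n)) :
    ‖(∑ i ∈ boxIndex d (paramR d n * paramS d p n),
        ∫ x in cube (latticePoint (paramS d p n) i) (1 / paramS d p n),
          (starRingEnd ℂ) (approxFun n (paramN d n) (symbol m ((starRingEnd ℂ) lam)) k.toInt x) *
            approxFun n (paramN d n) (symbol m 0) l.toInt x * W lam V x) -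
        Kmatrix p n m lam V k l‖ ≤
      constD3 d p M lam (symbolSize d m lam) (symbolSize d m 0) / (paramN d n * n) := by
  have hd1 : (1 : ℝ) ≤ d := by exact_mod_cast hd
  have hp0 : 0 < p := by linarith
  have hq : 0 < 1 - d / p := by rw [sub_pos, div_lt_one hp0]; exact hdp
  have hn1 : (1 : ℝ) ≤ n := by exact_mod_cast hn
  have hn' : (0 : ℝ) < n := by linarith
  have hM := hV.nonneg
  have hN := paramN_pos d n
  have hN' : (0 : ℝ) < paramN d n := by exact_mod_cast hN
  have hR' : (0 : ℝ) < paramR d n := by exact_mod_cast paramR_pos hn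
  have h0 := specDist_zero_pos hm
  have ha := norm_symbol_conj_le (d := d) hm h
  have ha0 := norm_symbol_le_size (d := d) hm h0
  have hk : ∀ l, |k.toInt l| ≤ n * n := fun j => by exact_mod_cast k.abs_toInt_le j
  have hl : ∀ j, |l.toInt j| ≤ n * n := fun j => by exact_mod_cast l.abs_toInt_le j
  rw [constD3]
  set S := symbolSize d m lam
  set S₀ := symbolSize d m 0
  have e3 : 0 ≤ S.sup := symbolSize_sup_nonneg
  have e4 : 0 ≤ S₀.sup := symbolSize_sup_nonneg
  set e : ℝ := (2 * Real.pi * n) ^ (-((d : ℝ) / 2)) with he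
  have he0 : 0 ≤ e := by positivity
  have hee : e * e = ((2 * Real.pi) ^ d)⁻¹ * ((n : ℝ) ^ d)⁻¹ := by
    rw [he, Real.rpow_neg (by positivity), ← mul_inv, amplitude_mul_self, mul_pow _ (n : ℝ), mul_inv]
  set f := approxFun n (paramN d n) (symbol m ((starRingEnd ℂ) lam)) k.toInt with hf
  set g := approxFun n (paramN d n) (symbol (d := d) m 0) l.toInt with hg
  set f' := approxFunDeriv n (paramN d n) (symbol m ((starRingEnd ℂ) lam)) k.toInt
  set g' := approxFunDeriv n (paramN d n) (symbol (d := d) m 0) l.toInt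
  have hfb : ∀ x, ‖f x‖ ≤ S.sup * e := norm_approxFun_le hn hN ha
  have hgb : ∀ x, ‖g x‖ ≤ S₀.sup * e := norm_approxFun_le hn hN ha0
  have hf'b : ∀ x, ‖f' x‖ ≤ 2 * √d * n * (S.sup * e) := norm_approxFunDeriv_le hn hN ha hk
  have hg'b : ∀ x, ‖g' x‖ ≤ 2 * √d * n * (S₀.sup * e) := norm_approxFunDeriv_le hn hN ha0 hl
  have hf' : ∀ x, HasFDerivAt f (f' x) x := hasFDerivAt_approxFun hn hN ha hk
  have hg' : ∀ x, HasFDerivAt g (g' x) x := hasFDerivAt_approxFun hn hN ha0 hl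
  have hfc : Continuous f := continuous_iff_continuousAt.2 fun x => (hf' x).continuousAt
  have hgc : Continuous g := continuous_iff_continuousAt.2 fun x => (hg' x).continuousAt
  have hf'c : Continuous f' := continuous_approxFunDeriv hn hN ha hk
  have hg'c : Continuous g' := continuous_approxFunDeriv hn hN ha0 hl
  set cf' : E d → E d →L[ℝ] ℂ := fun x => (Complex.conjCLE : ℂ →L[ℝ] ℂ).comp (f' x) with hcf'
  have hcf : ∀ x, HasFDerivAt (fun x => (starRingEnd ℂ) (f x)) (cf' x) x := fun x =>
    (Complex.conjCLE : ℂ →L[ℝ] ℂ).hasFDerivAt.comp x (hf' x)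
  have hcfb : ∀ x, ‖cf' x‖ ≤ ‖f' x‖ := fun x => by
    refine ContinuousLinearMap.opNorm_le_bound _ (norm_nonneg _) fun v => ?_
    have : ‖cf' x v‖ = ‖f' x v‖ := RCLike.norm_conj (f' x v)
    rw [this]
    exact (f' x).le_opNorm v
  have hcf'c : Continuous cf' := continuous_const.clm_comp hf'c
  -- `β` is the product of the two sup bounds. Each factor contributes `2 √d n` to the logarithmic
  -- size of the derivative, whence `γ = 4 √d n`.
  have hmain := norm_sum_integral_mul_W_sub_quad_le (lam := lam) (by linarith) hdp hV
    (B := fun x => (starRingEnd ℂ) (f x) * g x)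
    (B' := fun x => (starRingEnd ℂ) (f x) • g' x + g x • cf' x)
    (fun x => (hcf x).mul (hg' x))
    (((Complex.continuous_conj.comp hfc).smul hg'c).add (hgc.smul hcf'c))
    (β := S.sup * S₀.sup * (e * e)) (γ := 4 * √d * n) (by positivity) (by positivity)
    (fun x => by
      rw [norm_mul, RCLike.norm_conj]
      calc _ ≤ (S.sup * e) * (S₀.sup * e) := by gcongr; exacts [hfb x, hgb x]
        _ = _ := by ring)
    (fun x => by
      refine (norm_add_le _ _).trans ?_
      rw [norm_smul, norm_smul, RCLike.norm_conj]
      calc _ ≤ (S.sup * e) * (2 * √d * n * (S₀.sup * e)) +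
            (S₀.sup * e) * (2 * √d * n * (S.sup * e)) := by
              gcongr
              exacts [hfb x, hg'b x, hgb x, (hcfb x).trans (hf'b x)]
        _ = _ := by ring) (paramR d n) (paramS_pos (p := p) (d := d) hn)
  refine hmain.trans ?_
  rw [hee]
  exact quadrature_constant_le hd hdp hM hn e3 e4

/-- The error in the matrix entries. -/
theorem norm_inner_K_sub_Kmatrix_le (hd : 0 < d) (hdp : (d : ℝ) < p) (hm : 0 < m)
    (h : 0 < specDist m lam) (hV : Admissible p M V) (hn : 0 < n) (k l : GridIndex d (n * n)) :
    ‖inner ℂ (basisFun n k.toInt) (K m lam V (basisFun n l.toInt)) - Kmatrix p n m lam V k l‖ ≤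
      constMat d p M lam (symbolSize d m lam) (symbolSize d m 0) / (paramN d n * n) := by
  have hN := paramN_pos d n
  have hM := hV.nonneg
  have ha := norm_symbol_conj_le (d := d) hm h
  have ha0 := norm_symbol_le_size (d := d) hm (specDist_zero_pos hm)
  have h1 := norm_inner_K_sub_integral_le hm h hV hn hN k.toInt l.toInt
  have h2 := norm_integral_sub_sum_cube_le (lam := lam) hV
    (memLp_approxFun (κ := k.toInt) hn hN ha) (memLp_approxFun (κ := l.toInt) hn hN ha0)
    (paramR_pos (d := d) hn) (paramS_pos (d := d) (p := p) hn)
  have h3 := norm_sum_integral_sub_Kmatrix_le hd hdp hm h hV hn k l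
  have h4 : 2 * M * (M + ‖lam‖) / paramR d n *
      (‖(memLp_approxFun hn hN ha).toLp
        (approxFun n (paramN d n) (symbol m ((starRingEnd ℂ) lam)) k.toInt)‖ *
      ‖(memLp_approxFun hn hN ha0).toLp (approxFun n (paramN d n) (symbol m 0) l.toInt)‖) ≤
        constD2 M lam (symbolSize d m lam) (symbolSize d m 0) / (paramN d n * n) := by
    have e1 := norm_toLp_approxFun_le (κ := k.toInt) hn hN ha
    have e2 := norm_toLp_approxFun_le (κ := l.toInt) hn hN ha0
    have e3 : 0 ≤ (symbolSize d m lam).sup := symbolSize_sup_nonneg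
    calc _ ≤ 2 * M * (M + ‖lam‖) / paramR d n *
          ((symbolSize d m lam).sup * (symbolSize d m 0).sup) := by gcongr
      _ = _ := by
        rw [constD2, paramR_eq, Nat.cast_mul]
        ring
  calc _ ≤ _ := norm_sub_le_norm_sub_add_norm_sub _ _ _
    _ ≤ _ := add_le_add h1 ((norm_sub_le_norm_sub_add_norm_sub _ _ _).trans
      (add_le_add (h2.trans h4) h3))
    _ = _ := by rw [constMat]; ring

/-- The error in the compression of `K` to the span of the basis functions. -/
theorem norm_basisProj_K_sub_Kapprox_le (hd : 0 < d) (hdp : (d : ℝ) < p) (hm : 0 < m)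
    (h : 0 < specDist m lam) (hV : Admissible p M V) (hn : 0 < n) :
    ‖basisProj d n n * K m lam V * basisProj d n n - Kapprox p n m lam V‖ ≤
      constMat d p M lam (symbolSize d m lam) (symbolSize d m 0) / n := by
  have hN' : (0 : ℝ) < paramN d n := by exact_mod_cast paramN_pos d n
  have hn' : (0 : ℝ) < n := by exact_mod_cast hn
  rw [basisProj_mul_mul_basisProj, Kapprox, matrixOp_sub]
  have hent := norm_inner_K_sub_Kmatrix_le hd hdp hm h hV hn
  -- Nonnegativity of the common bound, read off at the entry with both indices zero.
  have hε := (norm_nonneg _).trans (hent (fun _ => ⟨0, by simp; positivity⟩) (fun _ => ⟨0, by simp; positivity⟩))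
  refine (norm_matrixOp_le hn hε hent).trans (le_of_eq ?_)
  -- The number of basis functions is `N_n` itself, so it cancels and `1/n` remains.
  have : (2 * (n * n) + 1 : ℕ) ^ d = paramN d n := by rw [paramN, mul_assoc]
  rw [← Nat.cast_pow, this]
  field_simp

end entries

/-! ### The projection onto the span of the basis functions -/

section projection

variable {d n r : ℕ}

theorem basisProj_basisFun (hn : 0 < n) (k : GridIndex d (n * r)) :
    basisProj d n r (basisFun n k.toInt) = basisFun n k.toInt := by
  have hv := orthonormal_iff_ite.1 (orthonormal_gridIndex (d := d) hn (n * r))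
  rw [basisProj_apply]
  simp_rw [hv, ite_smul, zero_smul, one_smul]
  rw [Finset.sum_ite_eq' Finset.univ k]
  simp

theorem basisProj_basisProj (hn : 0 < n) (f : L2 d) :
    basisProj d n r (basisProj d n r f) = basisProj d n r f := by
  conv_lhs => rw [basisProj_apply f, map_sum]
  rw [basisProj_apply f]
  refine Finset.sum_congr rfl fun k _ => ?_
  rw [map_smul, basisProj_basisFun hn]

theorem inner_basisProj_left (f g : L2 d) :
    inner ℂ (basisProj d n r f) g = inner ℂ f (basisProj d n r g) := by
  rw [basisProj_apply, basisProj_apply, sum_inner, inner_sum]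
  refine Finset.sum_congr rfl fun k _ => ?_
  rw [inner_smul_left, inner_smul_right, inner_conj_symm, mul_comm]

theorem norm_sub_add_basisProj_sq (hn : 0 < n) (f g : L2 d) :
    ‖f - basisProj d n r f + basisProj d n r g‖ ^ 2 =
      ‖f - basisProj d n r f‖ ^ 2 + ‖basisProj d n r g‖ ^ 2 := by
  have h : inner ℂ (f - basisProj d n r f) (basisProj d n r g) = 0 := by
    rw [← inner_basisProj_left, map_sub, basisProj_basisProj hn, sub_self, inner_zero_left]
  simp only [sq]
  exact norm_add_sq_eq_norm_sq_add_norm_sq_of_inner_eq_zero _ _ h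

theorem norm_sub_basisProj_sq_add (hn : 0 < n) (f : L2 d) :
    ‖f - basisProj d n r f‖ ^ 2 + ‖basisProj d n r f‖ ^ 2 = ‖f‖ ^ 2 := by
  rw [← norm_sub_add_basisProj_sq hn f f, sub_add_cancel]

theorem norm_sub_basisProj_le (hn : 0 < n) (f : L2 d) : ‖f - basisProj d n r f‖ ≤ ‖f‖ :=
  le_of_sq_le_sq (by nlinarith [norm_sub_basisProj_sq_add (r := r) hn f, sq_nonneg ‖basisProj d n r f‖])
    (norm_nonneg _)

theorem norm_basisProj_le (hn : 0 < n) (f : L2 d) : ‖basisProj d n r f‖ ≤ ‖f‖ := by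
  have h1 := norm_sub_basisProj_sq_add (r := r) hn f
  have h2 := sq_nonneg ‖f - basisProj d n r f‖
  exact le_of_sq_le_sq (by linarith) (norm_nonneg _)

/-- The projection gives the best approximation from the span. -/
theorem norm_sub_basisProj_le_norm_sub_sum (hn : 0 < n) (f : L2 d)
    (c : GridIndex d (n * r) → ℂ) :
    ‖f - basisProj d n r f‖ ≤ ‖f - ∑ k, c k • basisFun n k.toInt‖ := by
  have h : basisProj d n r (∑ k, c k • basisFun n (GridIndex.toInt k)) =
      ∑ k, c k • basisFun n (GridIndex.toInt k) := by
    rw [map_sum]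
    refine Finset.sum_congr rfl fun k _ => ?_
    rw [map_smul, basisProj_basisFun hn]
  refine le_trans (le_of_eq ?_) (norm_sub_basisProj_le (r := r) hn _)
  rw [map_sub, h, sub_sub_sub_cancel_right]

/-- Compression to the span in terms of one-sided errors. -/
theorem norm_sub_basisProj_mul_mul_basisProj_le (hn : 0 < n) {T : L2 d →L[ℂ] L2 d} {α β : ℝ}
    (hα : ∀ f, ‖T f - basisProj d n r (T f)‖ ≤ α * ‖f‖)
    (hβ : ∀ f, ‖T (f - basisProj d n r f)‖ ≤ β * ‖f‖) :
    ‖T - basisProj d n r * T * basisProj d n r‖ ≤ √(α ^ 2 + β ^ 2) := by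
  refine ContinuousLinearMap.opNorm_le_bound _ (Real.sqrt_nonneg _) fun f => ?_
  refine le_of_sq_le_sq ?_ (by positivity)
  -- The decomposition `T - PTP = (1 - P)T + PT(1 - P)`; its two summands are orthogonal, which
  -- gives the root of a sum of squares.
  have h : (T - basisProj d n r * T * basisProj d n r) f =
      T f - basisProj d n r (T f) + basisProj d n r (T (f - basisProj d n r f)) := by
    simp only [_root_.sub_apply, mul_apply_eq_comp, map_sub]
    abel
  rw [h, norm_sub_add_basisProj_sq hn, mul_pow, Real.sq_sqrt (by positivity), add_mul, ← mul_pow,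
    ← mul_pow]
  exact add_le_add (pow_le_pow_left₀ (norm_nonneg _) (hα f) 2)
    (pow_le_pow_left₀ (norm_nonneg _) ((norm_basisProj_le hn _).trans (hβ f)) 2)

end projection

/-! ### The Poincaré inequality on cubes -/

section poincare

open Set

variable {d : ℕ}

theorem cubeMap_update (c : E d) (h : ℝ) (x : Fin d → ℝ) (l : Fin d) (t : ℝ) :
    cubeMap c h (Function.update x l t) =
      cubeMap c h (Function.update x l 0) + t • (h • EuclideanSpace.single l (1 : ℝ)) := by
  ext j
  rcases eq_or_ne j l with rfl | hj
  · simp [mul_comm]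
  · simp [hj]

theorem poincare_cube {g : E d → ℂ} {g' : E d → E d →L[ℝ] ℂ} (hg : ∀ y, HasFDerivAt g (g' y) y)
    (hg' : ∀ l, Continuous fun y => g' y (EuclideanSpace.single l 1)) (c : E d) {h : ℝ}
    (hh : 0 < h) : ∫ y in cube c h, ‖g y - ∫ z in Icc (0 : Fin d → ℝ) 1, g (cubeMap c h z)‖ ^ 2 ≤
      (h / Real.pi) ^ 2 * ∑ l, ∫ y in cube c h, ‖g' y (EuclideanSpace.single l 1)‖ ^ 2 := by
  have hgc : Continuous g := continuous_iff_continuousAt.2 fun x => (hg x).continuousAt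
  have hP := poincare_unitCube (g := fun x => g (cubeMap c h x))
    (g' := fun l x => (h : ℂ) * g' (cubeMap c h x) (EuclideanSpace.single l 1))
    (hgc.comp (continuous_cubeMap c h))
    (fun l => continuous_const.mul ((hg' l).comp (continuous_cubeMap c h))) fun l x t => by
      have h1 : HasDerivAt (fun t : ℝ => cubeMap c h (Function.update x l t))
          (h • EuclideanSpace.single l (1 : ℝ)) t := by
        rw [funext fun t => cubeMap_update c h x l t]
        exact (((hasDerivAt_id t).smul_const (h • EuclideanSpace.single l (1 : ℝ))).const_add
          (cubeMap c h (Function.update x l 0))).congr_deriv (one_smul _ _)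
      have h2 := (hg (cubeMap c h (Function.update x l t))).comp_hasDerivAt t h1
      rw [map_smul, Complex.real_smul] at h2
      exact h2
  simp_rw [setIntegral_cube c hh, smul_eq_mul]
  refine (mul_le_mul_of_nonneg_left hP (by positivity)).trans (le_of_eq ?_)
  simp_rw [norm_mul, mul_pow, integral_const_mul, ← Finset.mul_sum, Complex.norm_real,
    Real.norm_of_nonneg hh.le]
  field_simp

theorem scaledCube_eq_cube {n : ℕ} (hn : 0 < n) (κ : Fin d → ℤ) :
    scaledCube (d := d) n κ = cube ((2 * Real.pi)⁻¹ • latticePoint n κ) (1 / (2 * Real.pi * n)) := by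
  have hn' : (0 : ℝ) < n := by exact_mod_cast hn
  have h2 : (0 : ℝ) < 2 * Real.pi := by positivity
  ext y
  refine forall_congr' fun l => and_congr ?_ ?_
  · simp only [PiLp.smul_apply, smul_eq_mul]
    rw [inv_mul_le_iff₀ h2]
  · simp only [PiLp.smul_apply, smul_eq_mul]
    rw [← mul_lt_mul_iff_right₀ h2 (b := y l), mul_add, mul_inv_cancel_left₀ h2.ne']
    have : 2 * Real.pi * (1 / (2 * Real.pi * n)) = 1 / n := by field_simp
    rw [this]

theorem norm_sq_eq_integral (f : L2 d) : ‖f‖ ^ 2 = ∫ x, ‖f x‖ ^ 2 := by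
  have h : inner ℂ f f = ((‖f‖ ^ 2 : ℝ) : ℂ) := by
    rw [inner_self_eq_norm_sq_to_K]; push_cast; rfl
  rw [L2.inner_def] at h
  have h2 : ∀ x, (inner ℂ (f x) (f x) : ℂ) = ((‖f x‖ ^ 2 : ℝ) : ℂ) := fun x => by
    rw [inner_self_eq_norm_sq_to_K]; push_cast; rfl
  simp_rw [h2] at h
  rw [integral_complex_ofReal] at h
  exact Complex.ofReal_injective h.symm

theorem norm_toLp_sq_eq_integral {f : E d → ℂ} (hf : MemLp f 2) :
    ‖hf.toLp f‖ ^ 2 = ∫ x, ‖f x‖ ^ 2 := by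
  rw [norm_sq_eq_integral]
  refine integral_congr_ae ?_
  filter_upwards [hf.coeFn_toLp] with x hx
  rw [hx]

theorem integrable_norm_sq {f : E d → ℂ} (hf : MemLp f 2) : Integrable fun x => ‖f x‖ ^ 2 :=
  hf.integrable_norm_pow two_ne_zero

theorem toLp_sub_sum_smul {ι : Type*} (s : Finset ι) {g : E d → ℂ}
    (hg : MemLp g 2 volume) {b : ι → E d → ℂ} (hb : ∀ i, MemLp (b i) 2 volume) (c : ι → ℂ)
    (h : MemLp (fun y : E d => g y - ∑ i ∈ s, c i * b i y) 2 volume) :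
    hg.toLp g - ∑ i ∈ s, c i • (hb i).toLp (b i) = h.toLp _ := by
  classical
  induction s using Finset.induction_on with
  | empty =>
    simp only [Finset.sum_empty, sub_zero]
  | insert i s hi ih =>
    have h' : MemLp (fun y => g y - ∑ i ∈ s, c i * b i y) 2 := by
      have e : MemLp (fun y => ∑ i ∈ s, c i * b i y) 2 :=
        memLp_finsetSum _ fun i _ => (hb i).const_mul (c i)
      exact hg.sub e
    rw [Finset.sum_insert hi, add_comm, ← sub_sub, ih h']
    apply Lp.ext
    filter_upwards [Lp.coeFn_sub (h'.toLp _) (c i • (hb i).toLp (b i)),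
      Lp.coeFn_smul (c i) ((hb i).toLp (b i)), h'.coeFn_toLp, h.coeFn_toLp, (hb i).coeFn_toLp]
      with y h1 h2 h3 h4 h5
    rw [h1, Pi.sub_apply, h2, Pi.smul_apply, h3, h4, h5, Finset.sum_insert hi, smul_eq_mul]
    ring

/-- The union of the cubes that carry the basis functions. -/
def basisRegion (d n : ℕ) : Set (E d) :=
  ⋃ k ∈ (Finset.univ : Finset (GridIndex d (n * n))), scaledCube n k.toInt

theorem measurableSet_basisRegion (d n : ℕ) : MeasurableSet (basisRegion d n) :=
  Finset.measurableSet_biUnion _ fun _ _ => measurableSet_scaledCube _ _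

theorem le_norm_of_notMem_basisRegion {n : ℕ} (hn : 0 < n) {y : E d} (hy : y ∉ basisRegion d n) :
    (n : ℝ) ≤ ‖(2 * Real.pi) • y‖ := by
  have hn' : (0 : ℝ) < n := by exact_mod_cast hn
  have := le_norm_of_notMem_cube (q := n * n) hn (x := (2 * Real.pi) • y) fun κ hκ hmem => hy ?_
  · push_cast at this
    nlinarith
  · exact mem_biUnion (x := (fun l => ⟨κ l, Finset.mem_Icc.2 ⟨(hκ l).1, (hκ l).2.le⟩⟩ :
      GridIndex d (n * n))) (Finset.mem_coe.2 (Finset.mem_univ _)) hmem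

theorem integral_eq_sum_scaledCube {n : ℕ} (hn : 0 < n) {f : E d → ℝ} (hf : Integrable f) :
    ∫ y in basisRegion d n, f y = ∑ k : GridIndex d (n * n), ∫ y in scaledCube n k.toInt, f y :=
  integral_biUnion_finset _ (fun _ _ => measurableSet_scaledCube _ _)
    (fun _ _ _ _ hij => disjoint_scaledCube hn fun h => hij (GridIndex.toInt_injective h))
    fun _ _ => hf.integrableOn

/-- The distance of a differentiable function in the frequency variable from the span of the
basis functions. -/
theorem norm_fourier_sub_basisProj_sq_le {n : ℕ} (hn : 0 < n) {g : E d → ℂ}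
    {g' : E d → E d →L[ℝ] ℂ} (hg : ∀ y, HasFDerivAt g (g' y) y)
    (hg' : ∀ l, Continuous fun y => g' y (EuclideanSpace.single l 1)) (hg2 : MemLp g 2)
    (hg'2 : ∀ l, MemLp (fun y => g' y (EuclideanSpace.single l 1)) 2) :
    ‖(𝓕 (hg2.toLp g) : L2 d) - basisProj d n n (𝓕 (hg2.toLp g) : L2 d)‖ ^ 2 ≤
      (2 * Real.pi ^ 2 * n)⁻¹ ^ 2 * ∑ l, ‖(hg'2 l).toLp _‖ ^ 2 +
        ∫ y in (basisRegion d n)ᶜ, ‖g y‖ ^ 2 := by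
  have hn' : (0 : ℝ) < n := by exact_mod_cast hn
  set A : ℂ := (((2 * Real.pi * n) ^ ((d : ℝ) / 2) : ℝ) : ℂ) with hA
  have hA0 : A ≠ 0 := by
    have : (2 * Real.pi * n) ^ ((d : ℝ) / 2) ≠ 0 := by positivity
    exact Complex.ofReal_ne_zero.2 this
  -- The means of `g` over the cubes. Since `P` gives the best approximation, this choice of
  -- coefficients, divided by the amplitude `A` of the bumps, bounds its error from above.
  set c : GridIndex d (n * n) → ℂ := fun k => ∫ z in Icc (0 : Fin d → ℝ) 1,
    g (cubeMap ((2 * Real.pi)⁻¹ • latticePoint n k.toInt) (1 / (2 * Real.pi * n)) z) with hc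
  have hb : ∀ k : GridIndex d (n * n), MemLp (bump (d := d) n k.toInt) 2 := fun k =>
    memLp_bump n k.toInt 2
  have hF : MemLp (fun y => g y - ∑ k, c k / A * bump n (GridIndex.toInt k) y) 2 := by
    have e : MemLp (fun y => ∑ k, c k / A * bump (d := d) n (GridIndex.toInt k) y) 2 :=
      memLp_finsetSum _ fun i _ => (hb i).const_mul (c i / A)
    exact hg2.sub e
  have h1 : (𝓕 (hg2.toLp g) : L2 d) - ∑ k, (c k / A) • basisFun n (GridIndex.toInt k) =
      𝓕 (hF.toLp _) := by
    rw [← toLp_sub_sum_smul Finset.univ hg2 hb (fun k => c k / A) hF, fourier_L2_sub]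
    congr 1
    exact ((map_sum (Lp.fourierTransformₗᵢ (E d) ℂ) _ _).trans
      (Finset.sum_congr rfl fun k _ => map_smul (Lp.fourierTransformₗᵢ (E d) ℂ) _ _)).symm
  have h2 := norm_sub_basisProj_le_norm_sub_sum hn (𝓕 (hg2.toLp g) : L2 d) fun k => c k / A
  rw [h1, Lp.norm_fourier_eq] at h2
  refine (pow_le_pow_left₀ (norm_nonneg _) h2 2).trans ?_
  rw [norm_toLp_sq_eq_integral, ← integral_add_compl (measurableSet_basisRegion d n)
    (integrable_norm_sq hF), integral_eq_sum_scaledCube hn (integrable_norm_sq hF)]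
  refine add_le_add ?_ (le_of_eq ?_)
  · have hk : ∀ k : GridIndex d (n * n), ∫ y in scaledCube n k.toInt,
        ‖g y - ∑ k, c k / A * bump n (GridIndex.toInt k) y‖ ^ 2 ≤ (2 * Real.pi ^ 2 * n)⁻¹ ^ 2 *
          ∑ l, ∫ y in scaledCube n k.toInt, ‖g' y (EuclideanSpace.single l 1)‖ ^ 2 := fun k => by
      have e1 : ∫ y in scaledCube n k.toInt,
          ‖g y - ∑ k, c k / A * bump n (GridIndex.toInt k) y‖ ^ 2 =
            ∫ y in scaledCube n k.toInt, ‖g y - c k‖ ^ 2 := by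
        refine setIntegral_congr_fun (measurableSet_scaledCube _ _) fun y hy => ?_
        have : ∑ k, c k / A * bump n (GridIndex.toInt k) y = c k := by
          rw [Finset.sum_eq_single k]
          · rw [bump, indicator_of_mem hy, div_mul_cancel₀ _ hA0]
          · intro k' _ hk'
            rw [bump_of_notMem, mul_zero]
            exact Set.disjoint_left.1 (disjoint_scaledCube hn fun h =>
              hk' (GridIndex.toInt_injective h).symm) hy
          · simp
        simp only [this]
      rw [e1]
      -- In the variable `y = ξ / 2π` the side is `1 / (2πn)`, so the Poincaré constant is `1 / (2π²
      -- n)`.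
      have := poincare_cube hg hg' ((2 * Real.pi)⁻¹ • latticePoint n k.toInt)
        (h := 1 / (2 * Real.pi * n)) (by positivity)
      rw [← scaledCube_eq_cube hn] at this
      refine this.trans (le_of_eq ?_)
      congr 2
      field_simp
    refine (Finset.sum_le_sum fun k _ => hk k).trans ?_
    rw [← Finset.mul_sum, Finset.sum_comm]
    refine mul_le_mul_of_nonneg_left (Finset.sum_le_sum fun l _ => ?_) (by positivity)
    rw [← integral_eq_sum_scaledCube hn (integrable_norm_sq (hg'2 l)), norm_toLp_sq_eq_integral]
    exact setIntegral_le_integral (integrable_norm_sq (hg'2 l))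
      (Filter.Eventually.of_forall fun y => sq_nonneg _)
  · refine setIntegral_congr_fun (measurableSet_basisRegion d n).compl fun y hy => ?_
    have : ∑ k, c k / A * bump n (GridIndex.toInt k) y = 0 :=
      Finset.sum_eq_zero fun k _ => by
        rw [bump_of_notMem fun h => hy (mem_biUnion (Finset.mem_coe.2 (Finset.mem_univ k)) h),
          mul_zero]
    simp only [this, sub_zero]

end poincare

/-! ### The truncation error -/

section truncation

open Set

variable {d n : ℕ} {m : ℝ} {lam : ℂ}

/-- Minkowski's inequality in `ℓ²(ι; F)`; it adds the two parts of the gradient without a factor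
depending on `d`. -/
theorem sum_norm_add_sq_le {ι F : Type*} [Fintype ι] [SeminormedAddCommGroup F] {x y : ι → F}
    {X Y : ℝ} (hX0 : 0 ≤ X) (hY0 : 0 ≤ Y) (hX : ∑ i, ‖x i‖ ^ 2 ≤ X ^ 2)
    (hY : ∑ i, ‖y i‖ ^ 2 ≤ Y ^ 2) : ∑ i, ‖x i + y i‖ ^ 2 ≤ (X + Y) ^ 2 := by
  have key : ∀ z : ι → F, ‖(WithLp.toLp 2 z : PiLp 2 fun _ : ι => F)‖ ^ 2 = ∑ i, ‖z i‖ ^ 2 :=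
    fun z => PiLp.norm_sq_eq_of_L2 _ _
  have h := norm_add_le (WithLp.toLp 2 x : PiLp 2 fun _ : ι => F) (WithLp.toLp 2 y)
  rw [← WithLp.toLp_add] at h
  have hx : ‖(WithLp.toLp 2 x : PiLp 2 fun _ : ι => F)‖ ≤ X :=
    le_of_sq_le_sq (by rwa [key]) hX0
  have hy : ‖(WithLp.toLp 2 y : PiLp 2 fun _ : ι => F)‖ ≤ Y :=
    le_of_sq_le_sq (by rwa [key]) hY0
  have h2 := pow_le_pow_left₀ (norm_nonneg _) (h.trans (add_le_add hx hy)) 2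
  rwa [key] at h2

theorem memLp_fourier {φ : E d → ℂ} (h1 : Integrable φ) (h2 : MemLp φ 2 volume) :
    MemLp (𝓕 φ) 2 volume :=
  (memLp_congr_ae (fourier_toLp_ae h2 h1)).1 (Lp.memLp _)

theorem toLp_fourier {φ : E d → ℂ} (h1 : Integrable φ) (h2 : MemLp φ 2 volume) :
    (memLp_fourier h1 h2).toLp (𝓕 φ) = (𝓕 (h2.toLp φ) : L2 d) :=
  Lp.ext ((memLp_fourier h1 h2).coeFn_toLp.trans (fourier_toLp_ae h2 h1).symm)

theorem norm_toLp_fourier {φ : E d → ℂ} (h1 : Integrable φ) (h2 : MemLp φ 2 volume) :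
    ‖(memLp_fourier h1 h2).toLp (𝓕 φ)‖ = ‖h2.toLp φ‖ := by
  rw [toLp_fourier h1, Lp.norm_fourier_eq]

theorem integrable_coord_mul {φ : E d → ℂ} (h1 : Integrable φ)
    (hx1 : Integrable fun x => ‖x‖ * ‖φ x‖) (l : Fin d) :
    Integrable fun x => (x l : ℂ) * φ x := by
  have hm : AEStronglyMeasurable (fun x : E d => (x l : ℂ)) volume :=
    Continuous.aestronglyMeasurable (by fun_prop)
  refine hx1.mono' (hm.mul h1.aestronglyMeasurable) (Filter.Eventually.of_forall fun x => ?_)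
  rw [norm_mul, Complex.norm_real]
  gcongr
  exact PiLp.norm_apply_le x l

theorem fourier_fourierSMulRight_single {φ : E d → ℂ} (h1 : Integrable φ)
    (hx1 : Integrable fun x => ‖x‖ * ‖φ x‖) (l : Fin d) (y : E d) :
    𝓕 (VectorFourier.fourierSMulRight (innerSL ℝ) φ) y (EuclideanSpace.single l 1) =
      -(2 * Real.pi * Complex.I) * 𝓕 (fun x => (x l : ℂ) * φ x) y := by
  have hi : Integrable (VectorFourier.fourierSMulRight (innerSL ℝ) φ) := by
    refine (hx1.const_mul (2 * Real.pi * ‖innerSL ℝ (E := E d)‖)).mono'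
      h1.aestronglyMeasurable.fourierSMulRight (Filter.Eventually.of_forall fun y => ?_)
    rw [← mul_assoc]
    exact VectorFourier.norm_fourierSMulRight_le _ _ _
  rw [Real.fourier_continuousLinearMap_apply hi]
  have e : (fun x => VectorFourier.fourierSMulRight (innerSL ℝ) φ x (EuclideanSpace.single l 1)) =
      fun x => -(2 * Real.pi * Complex.I) • ((x l : ℂ) * φ x) := by
    funext x
    rw [VectorFourier.fourierSMulRight_apply, innerSL_apply_apply, EuclideanSpace.inner_single_right]
    simp
  rw [e]
  simp only [Real.fourier_eq', smul_eq_mul]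
  rw [← integral_const_mul]
  congr 1
  funext x
  ring

theorem norm_coord_mul_symbolDer_le (hm : 0 < m) (h : 0 < specDist m lam) (ξ : E d) (l : Fin d) :
    ‖ξ l‖ * ‖symbolDer m lam ξ‖ ≤ (symbolSize d m lam).grad :=
  (mul_le_mul_of_nonneg_right (PiLp.norm_apply_le ξ l) (norm_nonneg _)).trans
    ((norm_fderiv_symbol hm h ξ).symm.le.trans (norm_fderiv_symbol_le_size hm h ξ))

/-- The truncation error for the image of a function with finite moments under the multiplier. -/
theorem norm_multiplier_sub_basisProj_sq_le (hm : 0 < m) (h : 0 < specDist m lam) (hn : 0 < n)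
    {φ : E d → ℂ} (h1 : Integrable φ) (h2 : MemLp φ 2 volume)
    (hx1 : Integrable fun x => ‖x‖ * ‖φ x‖)
    (hx2 : ∀ l, MemLp (fun x : E d => (x l : ℂ) * φ x) 2 volume) {X : ℝ} (hX0 : 0 ≤ X)
    (hX : ∑ l, ‖(hx2 l).toLp _‖ ^ 2 ≤ X ^ 2) {F : L2 d}
    (hF : F = 𝓕 (mulOp (fun ξ => symbol m lam ((2 * Real.pi) • ξ)) (𝓕 (h2.toLp φ) : L2 d))) :
    ‖F - basisProj d n n F‖ ^ 2 ≤
      ((((symbolSize d m lam).grad * ‖h2.toLp φ‖ + (symbolSize d m lam).sup * X) / Real.pi) ^ 2 +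
        ((symbolSize d m lam).xi * ‖h2.toLp φ‖) ^ 2) / n ^ 2 := by
  have hn' : (0 : ℝ) < n := by exact_mod_cast hn
  have hpi := Real.pi_pos
  set S := symbolSize d m lam with hS
  have e1 : 0 ≤ S.grad := symbolSize_grad_nonneg
  have e2 : 0 ≤ S.sup := symbolSize_sup_nonneg
  have e3 : 0 ≤ S.xi := symbolSize_xi_nonneg
  set a : E d → ℂ := fun y => symbol m lam ((2 * Real.pi) • y) with ha
  set b : E d → ℂ := fun y => symbolDer m lam ((2 * Real.pi) • y) with hb
  have hac : Continuous a := (continuous_symbol h).comp (continuous_const_smul _)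
  have hbc : Continuous b := (continuous_symbolDer hm h).comp (continuous_const_smul _)
  have haS : ∀ y, ‖a y‖ ≤ S.sup := fun y => norm_symbol_le_size hm h _
  set u := 𝓕 φ with hu
  have huc : Continuous u := continuous_fourier_of_integrable h1
  have hu2 : MemLp u 2 volume := memLp_fourier h1 h2
  have hun : ‖hu2.toLp u‖ = ‖h2.toLp φ‖ := norm_toLp_fourier h1 h2
  have hc1 := integrable_coord_mul h1 hx1
  set v : Fin d → E d → ℂ := fun l => 𝓕 (fun x => (x l : ℂ) * φ x) with hv
  have hvc : ∀ l, Continuous (v l) := fun l => continuous_fourier_of_integrable (hc1 l)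
  have hv2 : ∀ l, MemLp (v l) 2 volume := fun l => memLp_fourier (hc1 l) (hx2 l)
  have hvn : ∀ l, ‖(hv2 l).toLp (v l)‖ = ‖(hx2 l).toLp _‖ := fun l =>
    norm_toLp_fourier (hc1 l) (hx2 l)
  set u' := 𝓕 (VectorFourier.fourierSMulRight (innerSL ℝ) φ) with hu'
  have hud : ∀ y, HasFDerivAt u (u' y) y := Real.hasFDerivAt_fourier h1 hx1
  set g : E d → ℂ := fun y => a y * u y with hg
  set g' : E d → E d →L[ℝ] ℂ := fun y => a y • u' y +
    u y • ((innerSL ℝ ((2 * Real.pi) • y)).smulRight (b y)).comp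
      ((2 * Real.pi) • ContinuousLinearMap.id ℝ (E d)) with hg'
  have hgd : ∀ y, HasFDerivAt g (g' y) y := fun y => by
    have h3 : HasFDerivAt (fun y : E d => (2 * Real.pi) • y)
        ((2 * Real.pi) • ContinuousLinearMap.id ℝ (E d)) y :=
      ((2 * Real.pi) • ContinuousLinearMap.id ℝ (E d)).hasFDerivAt
    exact ((hasFDerivAt_symbol hm h ((2 * Real.pi) • y)).comp y h3).mul (hud y)
  -- Product rule: in `A` the symbol is differentiated, in `B` the transform of `φ`, which brings
  -- down the coordinate `x l`. Both carry a factor `2π`, which reduces the Poincaré constant `1 /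
  -- (2π² n)` to `1 / (πn)`.
  set A : Fin d → E d → ℂ := fun l y =>
    2 * Real.pi * ((((2 * Real.pi) • y) l : ℝ) : ℂ) * b y * u y with hA
  set B : Fin d → E d → ℂ := fun l y => -(2 * Real.pi * Complex.I) * a y * v l y with hB
  have hg'e : ∀ l, (fun y => g' y (EuclideanSpace.single l 1)) = fun y => A l y + B l y := fun l => by
    funext y
    simp only [hg', _root_.add_apply, _root_.smul_apply, hu',
      fourier_fourierSMulRight_single h1 hx1, ContinuousLinearMap.comp_apply,
      ContinuousLinearMap.id_apply, ContinuousLinearMap.smulRight_apply, innerSL_apply_apply,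
      inner_smul_right, EuclideanSpace.inner_single_right, hA, hB, smul_eq_mul, Complex.real_smul]
    simp
    ring
  have hAc : ∀ l, Continuous (A l) := fun l => by
    have : Continuous fun y : E d => 2 * Real.pi * ((((2 * Real.pi) • y) l : ℝ) : ℂ) := by fun_prop
    exact (this.mul hbc).mul huc
  have hBc : ∀ l, Continuous (B l) := fun l => (continuous_const.mul hac).mul (hvc l)
  have hAn : ∀ l y, ‖A l y‖ = 2 * Real.pi * (‖((2 * Real.pi) • y) l‖ * ‖b y‖) * ‖u y‖ := fun l y => by
    simp only [hA, norm_mul, Complex.norm_real, Complex.norm_ofNat, Real.norm_of_nonneg hpi.le]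
    ring
  have hBn : ∀ l y, ‖B l y‖ = 2 * Real.pi * ‖a y‖ * ‖v l y‖ := fun l y => by
    simp only [hB, norm_mul, norm_neg, Complex.norm_real, Complex.norm_ofNat, Complex.norm_I,
      Real.norm_of_nonneg hpi.le]
    ring
  have hA2 : ∀ l, MemLp (A l) 2 volume := fun l =>
    hu2.of_le_mul (c := 2 * Real.pi * S.grad) (hAc l).aestronglyMeasurable
      (Filter.Eventually.of_forall fun y => by
        rw [hAn]
        have := norm_coord_mul_symbolDer_le hm h ((2 * Real.pi) • y) l
        gcongr)
  have hBle : ∀ l y, ‖B l y‖ ≤ 2 * Real.pi * S.sup * ‖v l y‖ := fun l y => by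
    rw [hBn]
    have := haS y
    gcongr
  have hB2 : ∀ l, MemLp (B l) 2 volume := fun l =>
    (hv2 l).of_le_mul (hBc l).aestronglyMeasurable (Filter.Eventually.of_forall (hBle l))
  have hg2 : MemLp g 2 volume :=
    hu2.of_le_mul (c := S.sup) (hac.mul huc).aestronglyMeasurable
      (Filter.Eventually.of_forall fun y => by
        simp only [hg, norm_mul]
        have := haS y
        gcongr)
  have hg'2 : ∀ l, MemLp (fun y => g' y (EuclideanSpace.single l 1)) 2 volume := fun l => by
    rw [hg'e]
    exact (hA2 l).add (hB2 l)
  have hmain := norm_fourier_sub_basisProj_sq_le hn hgd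
    (fun l => by rw [hg'e]; exact (hAc l).add (hBc l)) hg2 hg'2
  have hFg : F = 𝓕 (hg2.toLp g) := by
    rw [hF, ← toLp_fourier h1 h2, mulOp_toLp (memLp_symbol hm h) _ hg2]
  rw [hFg]
  refine hmain.trans ?_
  have hAsum : ∑ l, ‖(hA2 l).toLp (A l)‖ ^ 2 ≤ (2 * Real.pi * (S.grad * ‖h2.toLp φ‖)) ^ 2 := by
    simp_rw [fun l => norm_toLp_sq_eq_integral (hA2 l)]
    rw [← integral_finsetSum _ fun l _ => integrable_norm_sq (hA2 l), ← mul_assoc, mul_pow, ← hun,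
      norm_toLp_sq_eq_integral, ← integral_const_mul]
    refine integral_mono (integrable_finsetSum _ fun l _ => integrable_norm_sq (hA2 l))
      ((integrable_norm_sq hu2).const_mul _) fun y => ?_
    have e4 := (norm_fderiv_symbol hm h ((2 * Real.pi) • y)).symm.le.trans
      (norm_fderiv_symbol_le_size hm h ((2 * Real.pi) • y))
    -- The directions are summed pointwise before estimating, so the Euclidean length of the
    -- gradient appears and `S.grad` is charged only once.
    calc ∑ l, ‖A l y‖ ^ 2 = (2 * Real.pi) ^ 2 * (‖b y‖ ^ 2 * ‖u y‖ ^ 2) *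
          ∑ l, ‖((2 * Real.pi) • y) l‖ ^ 2 := by
          rw [Finset.mul_sum]
          refine Finset.sum_congr rfl fun l _ => ?_
          rw [hAn]
          ring
      _ = (2 * Real.pi) ^ 2 * (‖(2 * Real.pi) • y‖ * ‖b y‖) ^ 2 * ‖u y‖ ^ 2 := by
          rw [← EuclideanSpace.norm_sq_eq]
          ring
      _ ≤ (2 * Real.pi) ^ 2 * S.grad ^ 2 * ‖u y‖ ^ 2 := by gcongr
      _ = _ := by ring
  have hBsum : ∑ l, ‖(hB2 l).toLp (B l)‖ ^ 2 ≤ (2 * Real.pi * (S.sup * X)) ^ 2 := by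
    calc _ ≤ ∑ l, (2 * Real.pi * S.sup * ‖(hx2 l).toLp _‖) ^ 2 := by
          refine Finset.sum_le_sum fun l _ => pow_le_pow_left₀ (norm_nonneg _) ?_ 2
          rw [← hvn]
          refine norm_le_of_ae_le_mul ?_
          filter_upwards [(hB2 l).coeFn_toLp, (hv2 l).coeFn_toLp] with y h3 h4
          rw [h3, h4]
          exact hBle l y
      _ = (2 * Real.pi * S.sup) ^ 2 * ∑ l, ‖(hx2 l).toLp _‖ ^ 2 := by
          rw [Finset.mul_sum]
          exact Finset.sum_congr rfl fun l _ => mul_pow _ _ _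
      _ ≤ (2 * Real.pi * S.sup) ^ 2 * X ^ 2 := by gcongr
      _ = _ := by ring
  have hsum : ∑ l, ‖(hg'2 l).toLp _‖ ^ 2 ≤
      (2 * Real.pi * (S.grad * ‖h2.toLp φ‖) + 2 * Real.pi * (S.sup * X)) ^ 2 := by
    refine le_trans (le_of_eq (Finset.sum_congr rfl fun l _ => ?_))
      (sum_norm_add_sq_le (by positivity) (by positivity) hAsum hBsum)
    rw [← MemLp.toLp_add]
    congr 2
    exact MemLp.toLp_congr _ _ (Filter.EventuallyEq.of_eq (hg'e l))
  have hout : ∫ y in (basisRegion d n)ᶜ, ‖g y‖ ^ 2 ≤ (S.xi / n) ^ 2 * ‖h2.toLp φ‖ ^ 2 := by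
    rw [← hun, norm_toLp_sq_eq_integral, ← integral_const_mul]
    have hi : Integrable fun y => (S.xi / n) ^ 2 * ‖u y‖ ^ 2 := (integrable_norm_sq hu2).const_mul _
    refine (setIntegral_mono_on (integrable_norm_sq hg2).integrableOn hi.integrableOn
      (measurableSet_basisRegion d n).compl fun y hy => ?_).trans
      (setIntegral_le_integral hi (Filter.Eventually.of_forall fun y => by positivity))
    have h3 := le_norm_of_notMem_basisRegion hn hy
    have h4 : ‖a y‖ ≤ S.xi / n := by
      rw [le_div_iff₀ hn', mul_comm]
      exact (mul_le_mul_of_nonneg_right h3 (norm_nonneg _)).trans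
        (norm_xi_symbol_le_size hm h ((2 * Real.pi) • y))
    rw [hg, norm_mul, mul_pow]
    gcongr
  calc _ ≤ (2 * Real.pi ^ 2 * n)⁻¹ ^ 2 *
        (2 * Real.pi * (S.grad * ‖h2.toLp φ‖) + 2 * Real.pi * (S.sup * X)) ^ 2 +
        (S.xi / n) ^ 2 * ‖h2.toLp φ‖ ^ 2 := by gcongr
    _ = _ := by field_simp

/-- The truncation error for `A w`, where `A` is the multiplier and `w` decays. -/
theorem norm_multiplier_mulOp_sub_basisProj_le (hm : 0 < m) (h : 0 < specDist m lam) (hn : 0 < n)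
    {w : E d → ℂ} (hw : Continuous w) {w₀ x₀ : ℝ} (hw₀ : ∀ x, ‖w x‖ ≤ w₀)
    (hx₀ : ∀ x, ‖x‖ * ‖w x‖ ≤ x₀) (f : L2 d) :
    ‖fourierMultiplier (symbol m lam) (mulOp w f) -
        basisProj d n n (fourierMultiplier (symbol m lam) (mulOp w f))‖ ≤
      √((((symbolSize d m lam).grad * w₀ + (symbolSize d m lam).sup * x₀) / Real.pi) ^ 2 +
        ((symbolSize d m lam).xi * w₀) ^ 2) / n * ‖f‖ := by
  have hn' : (0 : ℝ) < n := by exact_mod_cast hn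
  have hwm : MemLp w ∞ volume :=
    memLp_top_of_bound hw.aestronglyMeasurable w₀ (Filter.Eventually.of_forall hw₀)
  have hw₀' : 0 ≤ w₀ := (norm_nonneg _).trans (hw₀ 0)
  have hx₀' : 0 ≤ x₀ := (mul_nonneg (norm_nonneg _) (norm_nonneg _)).trans (hx₀ 0)
  -- Both sides are continuous in `f`. For a Schwartz function `f`, `w f` and its first moments are
  -- integrable, as needed to differentiate the Fourier integral.
  refine DenseRange.induction_on (p := fun f : L2 d => ‖fourierMultiplier (symbol m lam) (mulOp w f) -
        basisProj d n n (fourierMultiplier (symbol m lam) (mulOp w f))‖ ≤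
      √((((symbolSize d m lam).grad * w₀ + (symbolSize d m lam).sup * x₀) / Real.pi) ^ 2 +
        ((symbolSize d m lam).xi * w₀) ^ 2) / n * ‖f‖)
    (SchwartzMap.denseRange_toLpCLM (p := 2) (F := ℂ) (E := E d) (μ := volume)
      ENNReal.ofNat_ne_top) f ?_ ?_
  · exact isClosed_le (by fun_prop) (by fun_prop)
  intro f
  rw [SchwartzMap.toLpCLM_apply]
  set S := symbolSize d m lam with hS
  have e1 : 0 ≤ S.grad := symbolSize_grad_nonneg
  have e2 : 0 ≤ S.sup := symbolSize_sup_nonneg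
  have e3 : 0 ≤ S.xi := symbolSize_xi_nonneg
  -- Reflected, because the multiplier is used in the form `𝓕 a 𝓕⁻`, and `𝓕⁻` is `𝓕` after
  -- reflection.
  set φ : E d → ℂ := fun x => w (-x) * f (-x) with hφ
  have hfn1 : Integrable fun x => f (-x) := f.integrable.comp_neg
  have hf2 : MemLp (fun x => f (-x)) 2 volume :=
    (f.memLp 2 volume).comp_measurePreserving (Measure.measurePreserving_neg volume)
  have hxf : Integrable fun x => ‖x‖ * ‖f (-x)‖ := by
    have := (f.integrable_pow_mul volume 1).comp_neg
    simpa using this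
  have hφc : Continuous φ := by
    have := f.continuous
    fun_prop
  have hφle : ∀ x, ‖φ x‖ ≤ w₀ * ‖f (-x)‖ := fun x => by
    rw [hφ, norm_mul]
    have := hw₀ (-x)
    gcongr
  have hxφle : ∀ x, ‖x‖ * ‖φ x‖ ≤ x₀ * ‖f (-x)‖ := fun x => by
    rw [hφ, norm_mul, ← mul_assoc]
    have := hx₀ (-x)
    rw [norm_neg] at this
    gcongr
  have h1 : Integrable φ := (hfn1.norm.const_mul w₀).mono' hφc.aestronglyMeasurable
    (Filter.Eventually.of_forall hφle)
  have h2 : MemLp φ 2 volume := hf2.of_le_mul hφc.aestronglyMeasurable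
    (Filter.Eventually.of_forall hφle)
  have hx1 : Integrable fun x => ‖x‖ * ‖φ x‖ :=
    (hfn1.norm.const_mul x₀).mono' (by fun_prop) (Filter.Eventually.of_forall fun x => by
      rw [Real.norm_of_nonneg (by positivity)]
      exact hxφle x)
  have hx2 : ∀ l, MemLp (fun x : E d => (x l : ℂ) * φ x) 2 volume := fun l =>
    hf2.of_le_mul (c := x₀) (Continuous.aestronglyMeasurable (by fun_prop))
      (Filter.Eventually.of_forall fun x => by
        rw [norm_mul, Complex.norm_real]
        exact (mul_le_mul_of_nonneg_right (PiLp.norm_apply_le x l) (norm_nonneg _)).trans (hxφle x))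
  have hfn : ∫ x, ‖f (-x)‖ ^ 2 = ‖f.toLp 2 volume‖ ^ 2 := by
    rw [integral_neg_eq_self (fun x => ‖f x‖ ^ 2), norm_sq_eq_integral]
    refine integral_congr_ae ?_
    filter_upwards [f.coeFn_toLp 2 volume] with x hx
    rw [hx]
  have hX : ∑ l, ‖(hx2 l).toLp _‖ ^ 2 ≤ (x₀ * ‖f.toLp 2 volume‖) ^ 2 := by
    simp_rw [fun l => norm_toLp_sq_eq_integral (hx2 l)]
    rw [← integral_finsetSum _ fun l _ => integrable_norm_sq (hx2 l), mul_pow, ← hfn,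
      ← integral_const_mul]
    refine integral_mono (integrable_finsetSum _ fun l _ => integrable_norm_sq (hx2 l))
      ((integrable_norm_sq hf2).const_mul _) fun x => ?_
    calc ∑ l, ‖(x l : ℂ) * φ x‖ ^ 2 = (‖x‖ * ‖φ x‖) ^ 2 := by
          rw [mul_pow, EuclideanSpace.norm_sq_eq, Finset.sum_mul]
          refine Finset.sum_congr rfl fun l _ => ?_
          rw [norm_mul, mul_pow, Complex.norm_real]
      _ ≤ (x₀ * ‖f (-x)‖) ^ 2 := by
          have := hxφle x
          gcongr
      _ = _ := mul_pow _ _ _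
  have hΦ : h2.toLp φ = reflection d (mulOp w (f.toLp 2 volume)) := by
    apply Lp.ext
    filter_upwards [h2.coeFn_toLp, reflection_coeFn (mulOp w (f.toLp 2 volume)),
      ae_neg (mulOp_coeFn hwm (f.toLp 2 volume)), ae_neg (f.coeFn_toLp 2 volume)] with x a1 a2 a3 a4
    rw [a1, a2, a3, a4]
  have hΦn : ‖h2.toLp φ‖ ≤ w₀ * ‖f.toLp 2 volume‖ := by
    rw [hΦ, (reflection d).norm_map]
    exact norm_mulOp_apply_le hwm (Filter.Eventually.of_forall hw₀) _
  have hF : fourierMultiplier (symbol m lam) (mulOp w (f.toLp 2 volume)) =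
      𝓕 (mulOp (fun ξ => symbol m lam ((2 * Real.pi) • ξ)) (𝓕 (h2.toLp φ) : L2 d)) := by
    rw [fourierMultiplier_apply_of_even (memLp_symbol hm h) symbol_neg, hΦ,
      fourierInv_eq_fourier_reflection]
  have hmain := norm_multiplier_sub_basisProj_sq_le hm h hn h1 h2 hx1 hx2
    (mul_nonneg hx₀' (norm_nonneg (f.toLp 2 volume))) hX hF
  refine le_of_sq_le_sq (hmain.trans ?_) (by positivity)
  rw [mul_pow (√_ / _), div_pow (√_), Real.sq_sqrt (by positivity), ← hS]
  calc _ ≤ (((S.grad * (w₀ * ‖f.toLp 2 volume‖) + S.sup * (x₀ * ‖f.toLp 2 volume‖)) /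
        Real.pi) ^ 2 + (S.xi * (w₀ * ‖f.toLp 2 volume‖)) ^ 2) / n ^ 2 := by gcongr
    _ = _ := by ring

variable {M p : ℝ} {V : E d → ℝ}

/-- Duality: with `y` the vector on the left, `‖y‖²` is the inner product of `f` with `(1 - P) A_0`
applied to the conjugate of `w` times `y`. The preceding estimate applies, since conjugation does
not change the sizes of `w`, and one factor `‖y‖` cancels. -/
theorem norm_mulOp_invSqrt_sub_basisProj_le (hm : 0 < m) (hn : 0 < n)
    {w : E d → ℂ} (hw : Continuous w) {w₀ x₀ : ℝ} (hw₀ : ∀ x, ‖w x‖ ≤ w₀)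
    (hx₀ : ∀ x, ‖x‖ * ‖w x‖ ≤ x₀) (f : L2 d) :
    ‖mulOp w (fourierMultiplier (symbol m 0) (f - basisProj d n n f))‖ ≤
      √((((symbolSize d m 0).grad * w₀ + (symbolSize d m 0).sup * x₀) / Real.pi) ^ 2 +
        ((symbolSize d m 0).xi * w₀) ^ 2) / n * ‖f‖ := by
  have h0 := specDist_zero_pos hm
  have hwm : MemLp w ∞ volume :=
    memLp_top_of_bound hw.aestronglyMeasurable w₀ (Filter.Eventually.of_forall hw₀)
  set y := mulOp w (fourierMultiplier (symbol m 0) (f - basisProj d n n f)) with hy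
  set z := fourierMultiplier (symbol m 0) (mulOp (fun x => (starRingEnd ℂ) (w x)) y) with hz
  have hconj : (fun ξ : E d => (starRingEnd ℂ) (symbol m 0 ξ)) = symbol m 0 := by
    funext ξ
    rw [← symbol_conj, map_zero]
  have h1 : inner ℂ y y = inner ℂ f (z - basisProj d n n z) := by
    conv_lhs => rw [hy]
    rw [inner_mulOp_left hwm, inner_fourierMultiplier_left (memLp_symbol hm h0), hconj, ← hy, ← hz,
      inner_sub_left, inner_sub_right, inner_basisProj_left]
  have h2 := norm_multiplier_mulOp_sub_basisProj_le hm h0 hn (Complex.continuous_conj.comp hw)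
    (fun x => (RCLike.norm_conj (w x)).le.trans (hw₀ x))
    (fun x => (congrArg (‖x‖ * ·) (RCLike.norm_conj (w x))).le.trans (hx₀ x)) y
  have h3 : ‖y‖ * ‖y‖ ≤ ‖f‖ * ‖z - basisProj d n n z‖ := by
    have h4 : ‖(inner ℂ y y : ℂ)‖ = ‖y‖ * ‖y‖ := by
      rw [inner_self_eq_norm_sq_to_K, norm_pow, sq]
      simp
    rw [← h4, h1]
    exact norm_inner_le_norm _ _
  rcases (norm_nonneg y).eq_or_lt with h5 | h5
  · rw [← h5]
    positivity
  · refine le_of_mul_le_mul_right (h3.trans ?_) h5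
    calc _ ≤ ‖f‖ * (_ * ‖y‖) := mul_le_mul_of_nonneg_left h2 (norm_nonneg _)
      _ = _ := by ring

/-- The truncation error for `K`. -/
theorem norm_K_sub_basisProj_le (hm : 0 < m) (h : 0 < specDist m lam) (hV : Admissible p M V)
    (hn : 0 < n) :
    ‖K m lam V - basisProj d n n * K m lam V * basisProj d n n‖ ≤
      constTrunc m lam (symbolSize d m lam) (symbolSize d m 0) (supNorm (W lam V))
        (supNorm fun x : E d => (‖x‖ : ℂ) * W lam V x) / n := by
  have hn' : (0 : ℝ) < n := by exact_mod_cast hn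
  set w₀ := supNorm (W lam V)
  set x₀ := supNorm fun x : E d => (‖x‖ : ℂ) * W lam V x
  have hWc := continuous_W (lam := lam) hV.continuous
  set c : SymbolSize → ℝ := fun S => √(((S.grad * w₀ + S.sup * x₀) / Real.pi) ^ 2 +
    (S.xi * w₀) ^ 2) with hc
  have hc0 : ∀ S, 0 ≤ c S := fun S => Real.sqrt_nonneg _
  have hcS : ∀ S, (c S * m⁻¹) ^ 2 = const1 m S w₀ x₀ ^ 2 + const2 m S w₀ ^ 2 := fun S => by
    rw [mul_pow, hc, Real.sq_sqrt (by positivity), const1, const2]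
    ring
  have hA := norm_invSqrtH0_le (d := d) hm
  -- The factor `m⁻¹` is the norm bound of the right inverse root.
  have h1 : ∀ f, ‖K m lam V f - basisProj d n n (K m lam V f)‖ ≤
      c (symbolSize d m lam) * m⁻¹ / n * ‖f‖ := fun f => by
    rw [K_eq hm h, mul_apply_eq_comp, mul_apply_eq_comp]
    refine (norm_multiplier_mulOp_sub_basisProj_le hm h hn hWc hV.norm_W_le_supNorm
      hV.norm_mul_W_le_supNorm _).trans ?_
    calc _ ≤ c (symbolSize d m lam) / n * (m⁻¹ * ‖f‖) :=
          mul_le_mul_of_nonneg_left (ContinuousLinearMap.le_of_opNorm_le _ hA f)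
            (div_nonneg (hc0 _) hn'.le)
      _ = _ := by ring
  -- Here `m⁻¹` comes from the left inverse root, and the resolvent adds the factor `1 + |λ|²/δ`.
  have h2 : ∀ f, ‖K m lam V (f - basisProj d n n f)‖ ≤
      (1 + ‖lam‖ ^ 2 / specDist m lam) * (c (symbolSize d m 0) * m⁻¹) / n * ‖f‖ := fun f => by
    rw [K_eq_resolvent hm h, mul_apply_eq_comp, mul_apply_eq_comp, mul_apply_eq_comp]
    have h3 := norm_mulOp_invSqrt_sub_basisProj_le hm hn hWc hV.norm_W_le_supNorm
      hV.norm_mul_W_le_supNorm f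
    refine (ContinuousLinearMap.le_of_opNorm_le _ (norm_resolvent_le h) _).trans ?_
    calc _ ≤ (1 + ‖lam‖ ^ 2 / specDist m lam) *
          (m⁻¹ * (c (symbolSize d m 0) / n * ‖f‖)) :=
          mul_le_mul_of_nonneg_left ((ContinuousLinearMap.le_of_opNorm_le _ hA _).trans
            (mul_le_mul_of_nonneg_left h3 (by positivity))) (by positivity)
      _ = _ := by ring
  refine (norm_sub_basisProj_mul_mul_basisProj_le hn h1 h2).trans (le_of_eq ?_)
  rw [constTrunc, ← hcS, ← hcS, ← Real.sqrt_sq hn'.le, ← Real.sqrt_div (by positivity),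
    Real.sqrt_sq hn'.le]
  congr 1
  ring

end truncation

/-! ### The matrix entries are computed by finitely many arithmetic operations -/

section arithmetic

open Set

variable {d : ℕ}

/-- The function of `m` and `λ` is the value of a coefficient formula. -/
def IsCoeff (f : ℝ → ℂ → ℂ) : Prop := ∃ c : Coeff, ∀ m lam, c.eval m lam = f m lam

namespace IsCoeff

variable {f g : ℝ → ℂ → ℂ}

theorem rat (q : ℚ) : IsCoeff fun _ _ => (q : ℂ) := ⟨.rat q, fun _ _ => rfl⟩

theorem natCast (q : ℕ) : IsCoeff fun _ _ => (q : ℂ) := by simpa using rat (q : ℚ)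

theorem pi : IsCoeff fun _ _ => (Real.pi : ℂ) := ⟨.pi, fun _ _ => rfl⟩

theorem imag : IsCoeff fun _ _ => Complex.I := ⟨.imag, fun _ _ => rfl⟩

theorem mass : IsCoeff fun m _ => (m : ℂ) := ⟨.mass, fun _ _ => rfl⟩

theorem spec : IsCoeff fun _ lam => lam := ⟨.spec, fun _ _ => rfl⟩

theorem add (hf : IsCoeff f) (hg : IsCoeff g) : IsCoeff fun m lam => f m lam + g m lam := by
  obtain ⟨c, hc⟩ := hf
  obtain ⟨e, he⟩ := hg
  exact ⟨.add c e, fun m lam => by rw [Coeff.eval, hc, he]⟩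

theorem mul (hf : IsCoeff f) (hg : IsCoeff g) : IsCoeff fun m lam => f m lam * g m lam := by
  obtain ⟨c, hc⟩ := hf
  obtain ⟨e, he⟩ := hg
  exact ⟨.mul c e, fun m lam => by rw [Coeff.eval, hc, he]⟩

theorem inv (hf : IsCoeff f) : IsCoeff fun m lam => (f m lam)⁻¹ := by
  obtain ⟨c, hc⟩ := hf
  exact ⟨.inv c, fun m lam => by rw [Coeff.eval, hc]⟩

theorem exp (hf : IsCoeff f) : IsCoeff fun m lam => Complex.exp (f m lam) := by
  obtain ⟨c, hc⟩ := hf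
  exact ⟨.exp c, fun m lam => by rw [Coeff.eval, hc]⟩

/-- The formula `Coeff.sqrt` reads the real part of its argument only, so a real-valued `f` is
required. -/
theorem sqrt {f : ℝ → ℂ → ℝ} (hf : IsCoeff fun m lam => (f m lam : ℂ)) :
    IsCoeff fun m lam => ((√(f m lam) : ℝ) : ℂ) := by
  obtain ⟨c, hc⟩ := hf
  exact ⟨.sqrt c, fun m lam => by rw [Coeff.eval, hc, Complex.ofReal_re]⟩

theorem neg (hf : IsCoeff f) : IsCoeff fun m lam => -f m lam := by
  simpa using (rat (-1)).mul hf

theorem sub (hf : IsCoeff f) (hg : IsCoeff g) : IsCoeff fun m lam => f m lam - g m lam := by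
  simpa only [sub_eq_add_neg] using hf.add hg.neg

theorem div (hf : IsCoeff f) (hg : IsCoeff g) : IsCoeff fun m lam => f m lam / g m lam := by
  simpa only [div_eq_mul_inv] using hf.mul hg.inv

theorem pow (hf : IsCoeff f) (k : ℕ) : IsCoeff fun m lam => f m lam ^ k := by
  induction k with
  | zero => simpa using natCast 1
  | succ k ih => simpa only [pow_succ] using ih.mul hf

theorem sum {ι : Type*} (s : Finset ι) {f : ι → ℝ → ℂ → ℂ} (hf : ∀ i, IsCoeff (f i)) :
    IsCoeff fun m lam => ∑ i ∈ s, f i m lam := by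
  classical
  induction s using Finset.induction_on with
  | empty => simpa using natCast 0
  | insert i s hi ih => simpa only [Finset.sum_insert hi] using (hf i).add ih

theorem prod {ι : Type*} (s : Finset ι) {f : ι → ℝ → ℂ → ℂ} (hf : ∀ i, IsCoeff (f i)) :
    IsCoeff fun m lam => ∏ i ∈ s, f i m lam := by
  classical
  induction s using Finset.induction_on with
  | empty => simpa using natCast 1
  | insert i s hi ih => simpa only [Finset.prod_insert hi] using (hf i).mul ih

end IsCoeff

/-- The function of `m`, `λ` and `V` is the result of an arithmetic computation that reads `V` in
the set `S` only. -/
def IsArith (S : Set (Fin d → ℚ)) (f : ℝ → ℂ → (E d → ℝ) → ℂ) : Prop :=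
  ∃ P : Arith d, P.queries ⊆ S ∧ ∀ m lam V, P.eval m lam V = f m lam V

namespace IsArith

variable {S : Set (Fin d → ℚ)} {f g : ℝ → ℂ → (E d → ℝ) → ℂ}

theorem coeff {f : ℝ → ℂ → ℂ} (hf : IsCoeff f) :
    IsArith S fun m lam _ => f m lam := by
  obtain ⟨c, hc⟩ := hf
  exact ⟨.coeff c, empty_subset _, fun m lam _ => hc m lam⟩

theorem value {q : Fin d → ℚ} (hq : q ∈ S) :
    IsArith S fun _ _ V => ((V (WithLp.toLp 2 fun l => (q l : ℝ)) : ℝ) : ℂ) :=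
  ⟨.value q, singleton_subset_iff.2 hq, fun _ _ _ => rfl⟩

theorem add (hf : IsArith S f) (hg : IsArith S g) :
    IsArith S fun m lam V => f m lam V + g m lam V := by
  obtain ⟨P, hP, hP'⟩ := hf
  obtain ⟨Q, hQ, hQ'⟩ := hg
  exact ⟨.add P Q, union_subset hP hQ, fun m lam V => by rw [Arith.eval, hP', hQ']⟩

theorem sub (hf : IsArith S f) (hg : IsArith S g) :
    IsArith S fun m lam V => f m lam V - g m lam V := by
  obtain ⟨P, hP, hP'⟩ := hf
  obtain ⟨Q, hQ, hQ'⟩ := hg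
  exact ⟨.sub P Q, union_subset hP hQ, fun m lam V => by rw [Arith.eval, hP', hQ']⟩

theorem mul (hf : IsArith S f) (hg : IsArith S g) :
    IsArith S fun m lam V => f m lam V * g m lam V := by
  obtain ⟨P, hP, hP'⟩ := hf
  obtain ⟨Q, hQ, hQ'⟩ := hg
  exact ⟨.mul P Q, union_subset hP hQ, fun m lam V => by rw [Arith.eval, hP', hQ']⟩

theorem sum {ι : Type*} (s : Finset ι) {f : ι → ℝ → ℂ → (E d → ℝ) → ℂ}
    (hf : ∀ i ∈ s, IsArith S (f i)) : IsArith S fun m lam V => ∑ i ∈ s, f i m lam V := by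
  classical
  induction s using Finset.induction_on with
  | empty => simpa using coeff (S := S) (IsCoeff.natCast 0)
  | insert i s hi ih =>
    simpa only [Finset.sum_insert hi] using (hf i (Finset.mem_insert_self i s)).add
      (ih fun j hj => hf j (Finset.mem_insert_of_mem hj))

end IsArith

/-- The point of Euclidean space with the given rational coordinates. -/
def ratPoint (q : Fin d → ℚ) : E d := WithLp.toLp 2 fun l => (q l : ℝ)

theorem latticePoint_eq_ratPoint (s : ℕ) (i : Fin d → ℤ) :
    latticePoint s i = ratPoint fun l => (i l : ℚ) / s := by
  ext l
  simp [latticePoint, ratPoint]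

theorem subPoint_eq_ratPoint (n N : ℕ) (κ : Fin d → ℤ) (t : Fin d → Fin N) :
    subPoint n N κ t = ratPoint fun l => (κ l : ℚ) / n + ((t l : ℕ) : ℚ) / (N * n) := by
  ext l
  simp [subPoint, ratPoint]

/-- At a rational frequency `|ξ|²` is a rational number, so one real root and one division suffice.
-/
theorem isCoeff_symbol (q : Fin d → ℚ) {μ : ℝ → ℂ → ℂ} (hμ : IsCoeff μ) :
    IsCoeff fun m lam => symbol m (μ m lam) (ratPoint q) := by
  have h1 : ∀ m : ℝ, ((‖ratPoint q‖ ^ 2 + m ^ 2 : ℝ) : ℂ) =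
      ((∑ l, q l ^ 2 : ℚ) : ℂ) + (m : ℂ) ^ 2 := fun m => by
    rw [EuclideanSpace.norm_sq_eq]
    push_cast
    congr 1
    refine Finset.sum_congr rfl fun l _ => ?_
    rw [ratPoint, ← Complex.ofReal_pow, Real.norm_eq_abs, sq_abs]
    push_cast
    rfl
  have h2 : IsCoeff fun m _ => ((‖ratPoint q‖ ^ 2 + m ^ 2 : ℝ) : ℂ) := by
    simp_rw [h1]
    exact (IsCoeff.rat _).add (IsCoeff.mass.pow 2)
  exact h2.sqrt.div (h2.sub (hμ.pow 2))

/-- The integrand is a product over the coordinates, so Fubini leaves one-dimensional integrals of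
exponentials. Coordinates with `x l = 0` are separate because the primitive would divide by zero. -/
theorem integral_cube_exp (c x : E d) {h : ℝ} (hh : 0 < h) :
    ∫ ξ in cube c h, Complex.exp (-(Complex.I * ((inner ℝ ξ x : ℝ) : ℂ))) =
      (h : ℂ) ^ d * ∏ l, (Complex.exp (-(Complex.I * (c l * x l : ℂ))) *
        if x l = 0 then 1 else
          (Complex.exp (-(Complex.I * (h * x l : ℂ))) - 1) / -(Complex.I * (h * x l : ℂ))) := by
  have e1 : ∀ y : Fin d → ℝ,
      Complex.exp (-(Complex.I * ((inner ℝ (cubeMap c h y) x : ℝ) : ℂ))) =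
        ∏ l, (Complex.exp (-(Complex.I * (c l * x l : ℂ))) *
          Complex.exp (-(Complex.I * (h * x l : ℂ)) * (y l : ℂ))) := fun y => by
    simp_rw [← Complex.exp_add]
    rw [← Complex.exp_sum, PiLp.inner_apply]
    congr 1
    push_cast
    rw [Finset.mul_sum, ← Finset.sum_neg_distrib]
    refine Finset.sum_congr rfl fun l _ => ?_
    rw [cubeMap_apply, RCLike.inner_apply]
    simp only [conj_trivial]
    push_cast
    ring
  have e2 : (volume : Measure (Fin d → ℝ)).restrict (Icc 0 1) =
      Measure.pi fun _ : Fin d => (volume : Measure ℝ).restrict (Icc 0 1) := by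
    rw [← Measure.restrict_pi_pi, volume_pi, ← Set.pi_univ_Icc]
    rfl
  have e3 : ∀ l, ∫ t in Icc (0 : ℝ) 1, Complex.exp (-(Complex.I * (c l * x l : ℂ))) *
      Complex.exp (-(Complex.I * (h * x l : ℂ)) * (t : ℂ)) =
        Complex.exp (-(Complex.I * (c l * x l : ℂ))) * if x l = 0 then 1 else
          (Complex.exp (-(Complex.I * (h * x l : ℂ))) - 1) / -(Complex.I * (h * x l : ℂ)) := fun l => by
    rw [integral_const_mul]
    congr 1
    rw [integral_Icc_eq_integral_Ioc, ← intervalIntegral.integral_of_le zero_le_one]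
    split_ifs with hx
    · simp [hx]
    · rw [integral_exp_mul_complex]
      · simp
      · have : (h : ℂ) * x l ≠ 0 := mul_ne_zero (by exact_mod_cast hh.ne') (by exact_mod_cast hx)
        exact neg_ne_zero.2 (mul_ne_zero Complex.I_ne_zero this)
  rw [setIntegral_cube c hh]
  simp_rw [e1]
  rw [e2, integral_fintype_prod_eq_prod (𝕜 := ℂ) (fun l (t : ℝ) =>
    Complex.exp (-(Complex.I * (c l * x l : ℂ))) *
      Complex.exp (-(Complex.I * (h * x l : ℂ)) * (t : ℂ)))]
  simp_rw [e3]
  rw [Complex.real_smul, Complex.ofReal_pow]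

theorem isCoeff_integral_cube (c x : Fin d → ℚ) {h : ℚ} (hh : 0 < h) :
    IsCoeff fun _ _ => ∫ ξ in cube (ratPoint c) (h : ℝ),
      Complex.exp (-(Complex.I * ((inner ℝ ξ (ratPoint x) : ℝ) : ℂ))) := by
  rw [integral_cube_exp _ _ (by exact_mod_cast hh)]
  have h1 : IsCoeff fun _ _ => ((h : ℝ) : ℂ) := by simpa using IsCoeff.rat h
  have h2 : ∀ q : Fin d → ℚ, ∀ l, IsCoeff fun _ _ => ((ratPoint q l : ℝ) : ℂ) := fun q l => by
    simpa [ratPoint] using IsCoeff.rat (q l)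
  refine (h1.pow d).mul (IsCoeff.prod _ fun l => ?_)
  refine (IsCoeff.imag.mul ((h2 c l).mul (h2 x l))).neg.exp.mul ?_
  have h3 := (IsCoeff.imag.mul (h1.mul (h2 x l))).neg
  -- Whether `x l = 0` is decided by the rational grid point, independently of `m`, `λ` and `V`; the
  -- formula itself contains no branching.
  split_ifs
  · simpa using IsCoeff.natCast 1
  · refine (h3.exp.sub ?_).div h3
    simpa using IsCoeff.natCast 1

theorem isCoeff_approxFun {n N : ℕ} (hn : 0 < n) (hN : 0 < N) {μ : ℝ → ℂ → ℂ} (hμ : IsCoeff μ)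
    (κ : Fin d → ℤ) (x : Fin d → ℚ) :
    IsCoeff fun m lam => approxFun n N (symbol m (μ m lam)) κ (ratPoint x) := by
  have h1 : IsCoeff fun _ _ => (((n / (2 * Real.pi)) ^ ((d : ℝ) / 2) : ℝ) : ℂ) := by
    -- For odd `d` the exponent is not an integer; one square root and a natural power replace it.
    have h2 : (n / (2 * Real.pi)) ^ ((d : ℝ) / 2) = √(n / (2 * Real.pi)) ^ d := by
      rw [Real.sqrt_eq_rpow, ← Real.rpow_natCast, ← Real.rpow_mul (by positivity)]
      congr 1
      ring
    rw [h2]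
    push_cast
    refine IsCoeff.pow (IsCoeff.sqrt ?_) d
    push_cast
    exact (IsCoeff.natCast n).div ((IsCoeff.natCast 2).mul IsCoeff.pi)
  refine h1.mul (IsCoeff.sum _ fun t => ?_)
  have hh : (0 : ℚ) < 1 / (N * n) := by positivity
  have h3 := isCoeff_integral_cube
    (fun l => (κ l : ℚ) / n + ((t l : ℕ) : ℚ) / (N * n)) x hh
  rw [← subPoint_eq_ratPoint] at h3
  push_cast at h3
  have h4 := isCoeff_symbol (fun l => (κ l : ℚ) / n + ((t l : ℕ) : ℚ) / (N * n)) hμ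
  rw [← subPoint_eq_ratPoint] at h4
  exact h4.mul h3

/-- Conjugation is not among the operations of `Coeff`. It is removed here: on the exponential it
reflects `x`, and on the symbol it undoes the conjugate of `λ`. -/
theorem conj_approxFun (n N : ℕ) (m : ℝ) (lam : ℂ) (κ : Fin d → ℤ) (x : E d) :
    (starRingEnd ℂ) (approxFun n N (symbol m ((starRingEnd ℂ) lam)) κ x) =
      approxFun n N (symbol m lam) κ (-x) := by
  rw [approxFun, map_mul, Complex.conj_ofReal, map_sum, approxFun]
  congr 1
  refine Finset.sum_congr rfl fun t _ => ?_
  rw [map_mul, symbol_conj, Complex.conj_conj, ← integral_conj]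
  congr 2
  funext ξ
  rw [← Complex.exp_conj, inner_neg_right]
  congr 1
  simp

/-- No condition on `m` or `λ` is needed: where a denominator vanishes, formula and entry share the
convention that the inverse of `0` is `0`. -/
theorem isArith_Kmatrix {p : ℝ} {n : ℕ} (hn : 0 < n) (k l : GridIndex d (n * n)) :
    IsArith (rationalGrid d (paramR d n) (paramS d p n))
      fun m lam V => Kmatrix p n m lam V k l := by
  have hN := paramN_pos d n
  have hs := paramS_pos (d := d) (p := p) hn
  set s := paramS d p n with hsdef
  set R := paramR d n with hR
  have hs' : (0 : ℚ) < s := by exact_mod_cast hs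
  have h1 : IsCoeff fun _ _ => ((((s : ℝ) ^ d)⁻¹ : ℝ) : ℂ) := by
    push_cast
    exact ((IsCoeff.natCast s).pow d).inv
  refine (IsArith.coeff h1).mul (IsArith.sum _ fun i hi => ?_)
  have hgrid : (fun l => (i l : ℚ) / s) ∈ rationalGrid d R s := fun j => by
    have h2 := Finset.mem_Ico.1 (Fintype.mem_piFinset.1 hi j)
    have h3 : -((R : ℚ) * s) ≤ i j := by exact_mod_cast h2.1
    have h4 : (i j : ℚ) < (R : ℚ) * s := by exact_mod_cast h2.2
    refine ⟨⟨i j, rfl⟩, ?_, ?_⟩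
    · rw [le_div_iff₀ hs']
      linarith
    · rwa [div_lt_iff₀ hs']
  have hV := IsArith.value hgrid
  have hneg : -latticePoint s i = ratPoint fun l => -((i l : ℚ) / s) := by
    rw [latticePoint_eq_ratPoint]
    ext l
    simp [ratPoint]
  have ha := isCoeff_approxFun hn hN IsCoeff.spec k.toInt fun l => -((i l : ℚ) / s)
  have hb := isCoeff_approxFun hn hN (by simpa using IsCoeff.natCast 0 : IsCoeff fun _ _ => (0 : ℂ))
    l.toInt fun l => (i l : ℚ) / s
  rw [← hneg] at ha
  rw [← latticePoint_eq_ratPoint] at hb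
  have hW : IsArith (rationalGrid d R s) fun _ lam V => W lam V (latticePoint s i) := by
    simp only [W, sq, latticePoint_eq_ratPoint]
    exact (hV.mul hV).sub ((IsArith.coeff ((IsCoeff.natCast 2).mul IsCoeff.spec)).mul hV)
  simp_rw [conj_approxFun]
  exact ((IsArith.coeff ha).mul (IsArith.coeff hb)).mul hW

end arithmetic

/-! ### The approximation of `K` -/

section main

variable {d : ℕ} {p M m : ℝ} {lam : ℂ} {V : E d → ℝ}

theorem norm_K_sub_Kapprox_le (hd : 0 < d) (hdp : (d : ℝ) < p) (hm : 0 < m)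
    (h : 0 < specDist m lam) (hV : Admissible p M V) {n : ℕ} (hn : 0 < n) :
    ‖K m lam V - Kapprox p n m lam V‖ ≤ constK p M m lam V / n := by
  rw [constK, add_div]
  exact (norm_sub_le_norm_sub_add_norm_sub _ _ _).trans
    (add_le_add (norm_K_sub_basisProj_le hm h hV hn)
      (norm_basisProj_K_sub_Kapprox_le hd hdp hm h hV hn))

/-- The error estimate exhibits the operator as a norm limit of operators of finite rank. -/
theorem isCompactOperator_K (hd : 0 < d) (hdp : (d : ℝ) < p) (hm : 0 < m)
    (h : 0 < specDist m lam) (hV : Admissible p M V) : IsCompactOperator (K m lam V) := by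
  refine isCompactOperator_of_tendsto (l := Filter.atTop)
    (F := fun n : ℕ => Kapprox p n m lam V) ?_
    (Filter.Eventually.of_forall fun n => isCompactOperator_matrixOp _)
  rw [tendsto_iff_norm_sub_tendsto_zero]
  refine squeeze_zero' (Filter.Eventually.of_forall fun n => norm_nonneg _) ?_
    (tendsto_const_div_atTop_nhds_zero_nat (constK p M m lam V))
  filter_upwards [Filter.eventually_gt_atTop 0] with n hn
  rw [norm_sub_rev]
  exact norm_K_sub_Kapprox_le hd hdp hm h hV hn

end main

end KleinGordon

end

theorem mainTheorem2 (d : ℕ) (hd : 0 < d) (p : ℝ) (hp : (d : ℝ) < p) :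
    -- every entry of the approximating matrices is obtained from the values of the potential on a
    -- finite rational grid by finitely many arithmetic operations, which do not depend on `m`, `λ`, `V`
    (∀ n : ℕ, 1 ≤ n → ∀ k l : GridIndex d (n * n), ∃ P : Arith d,
      P.queries ⊆ rationalGrid d (paramR d n) (paramS d p n) ∧
      ∀ (m : ℝ) (lam : ℂ) (V : E d → ℝ), P.eval m lam V = Kmatrix p n m lam V k l) ∧
    -- the approximation of `K(λ)`
    (∀ m M : ℝ, 0 < m → 0 < M → ∀ lam : ℂ, (∀ t : ℝ, m ≤ |t| → lam ≠ (t : ℂ)) →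
      ∀ V : E d → ℝ, Admissible p M V →
        IsUnit (1 - lam ^ 2 • invH0 d m) ∧
        IsCompactOperator (K m lam V) ∧
        0 < constK p M m lam V ∧
        constK p M m lam V ≤ constKExplicit d p M m lam ∧
        ∀ n : ℕ, 1 ≤ n → ‖K m lam V - Kapprox p n m lam V‖ ≤ constK p M m lam V / n) := by
  refine ⟨fun n hn k l => isArith_Kmatrix hn k l, fun m M hm hM lam hlam V hV => ?_⟩
  have h := specDist_pos hlam
  exact ⟨isUnit_one_sub hm h, isCompactOperator_K hd hp hm h hV, constK_pos hp hM hm h,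
    hV.constK_le_explicit hp hm h, fun n hn => norm_K_sub_Kapprox_le hd hp hm h hV hn⟩
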